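/- **Setting.** A little-oh polynomial is a function $x:\mathbb R_{\ge 0}\to\mathbb R$ with $x_s=r+\sum_{i=1}^k\alpha_i s^{a_i}+o(s)$ as $s\to0^+$ ($k\in\mathbb N$; $r,\alpha_i\in\mathbb R$; $a_i\ge 0$; every $o(s)$ is understood to vanish at $s=0$). The ring ${}^\bullet\mathbb R$ of Fermat reals is the ring of little-oh polynomials modulo $x\sim y\iff x_s=y_s+o(s)$. It contains $\mathbb R$ (constant functions), and it is ordered by: $x\le y$ iff $x_s\le y_s+z_s$ for all small $s\ge 0$, for some $z\sim 0$; $x<y$ means $x\le y$ and $x\ne y$. Intervals are intervals of ${}^\bullet\mathbb R$. Each $x\in{}^\bullet\mathbb R$ has a unique decomposition $x=r+\sum_{i=1}^k\alpha_i s^{a_i}$ with $0<a_1<\dots<a_k\le1$ and all $\alpha_i\neq0$; its standard part is ${}^\circ x=r$, and its order is $\omega(x)=1/a_1$ (and $\omega(x)=0$ if $k=0$). Put $D=\{x:{}^\circ x=0,\ \omega(x)<2\}$ and $I_k=\{x:{}^\circ x=0,\ \omega(x)\le k\}$. Write $x=_k y$ if $x$ and $y$ become equal once the terms of order $1/a_i\le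 k$ are deleted from their decompositions; for vectors, $=_k$ is meant componentwise. A smooth $g$ on an open set extends to Fermat points by composition with representatives. A map $f:X\to{}^\bullet\mathbb R^m$, $X\subseteq{}^\bullet\mathbb R^n$, is *non-standard smooth* if near every $z_0\in X$ it has the form $f(z)=g(p,z)$, for all $z\in X$ with standard part in $V$, where $g\in C^\infty(U\times V,\mathbb R^m)$, $U\subseteq\mathbb R^d$ and $V\subseteq\mathbb R^n$ are open, ${}^\circ z_0\in V$, and $p\in{}^\bullet\mathbb R^d$ is a parameter with ${}^\circ p\in U$. Its partial derivatives are $\frac{\partial f}{\partial z_j}(z)=\frac{\partial g}{\partial z_j}(p,z)$. For $a,b\in\mathbb R$, $\int_a^bf(x)\,dx:=F(b)$, where $F$ is the non-standard smooth function on $[a,b]$ with $F'=f$ and $F(a)=0$. **Theorem.** Let $a<b$ be real, let $\gamma,\mathbf G,\mathbf T:[a,b]\times[0,+\infty)\to{}^\bullet\mathbb R^2$ and $\rho:[a,b]\times[0,+\infty)\to{}^\bullet\mathbb R$ be non-standard smooth, and let $T\in{}^\bullet\mathbb R$ be invertible. Suppose that $$\gamma_1(x,t)=[1+\alpha(t)]\,x+\beta(t)\qquad\text{for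 all }(x,t)\in[a,b]\times[0,+\infty),$$ where $\alpha,\beta:[0,+\infty)\to{}^\bullet\mathbb R$ and $\alpha(t)\in I_2$ for all $t$. Then at each point of $[a,b]\times[0,+\infty)$ the curve $\gamma(-,t)$ has exactly one unit tangent vector $\mathbf t=(\mathbf t_1,\mathbf t_2)$, that is, $\partial\gamma/\partial x=\sigma\,\mathbf t$ with $\sigma>0$ invertible and $\mathbf t_1^2+\mathbf t_2^2=1$; and there is exactly one angle $\phi\in(-\pi,\pi]$ with $\mathbf t=(\cos\phi,\sin\phi)$. Suppose further that for every $(x,t)\in(a,b)\times[0,+\infty)$ $$\mathbf T(x,t)=_2T\cdot\mathbf t(x,t),$$ and that for every such $(x,t)$ and every $\delta x\in D$ with $x+\delta x\in[a,b]$ $$\rho\,\delta x\,\frac{\partial^2\gamma}{\partial t^2}(x,t)=\mathbf T(x+\delta x,t)-\mathbf T(x,t)+\mathbf G\,\rho\,\delta x ,$$ where $\rho$ and $\mathbf G$ are evaluated at $(x,t)$. Then: (i) At every point $(x,t)\in(a,b)\times[0,+\infty)$ at which $\frac{\partial\phi}{\partial x}(x,t)$ is invertible, the following are equivalent: 1.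 $\rho\,\dfrac{\partial^2\gamma_2}{\partial t^2}=_2T\,\dfrac{\partial^2\gamma_2}{\partial x^2}+G_2\,\rho$ at $(x,t)$; 2. $\phi(x,t)\in I_4$. (ii) If $\phi(x,t)\in I_4$ for every $(x,t)\in(a,b)\times[0,+\infty)$, then for every $t\in[0,+\infty)$ the length $$\operatorname{length}(\gamma_{-,t})=\int_a^b\sqrt{\Big(\frac{\partial\gamma_1}{\partial x}\Big)^2+\Big(\frac{\partial\gamma_2}{\partial x}\Big)^2}\,dx$$ exists, is uniquely determined, and satisfies $\operatorname{length}(\gamma_{-,t})=_2b-a$. -/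

import Mathlib

open Filter Topology Asymptotics
open scoped NNReal ContDiff

namespace FermatReals

/-- `x : ℝ≥0 → ℝ` is a little-oh polynomial: `x_t = r + ∑ αᵢ t ^ aᵢ + o(t)` as `t → 0⁺`.
The filter `𝓝 0` of `ℝ≥0` contains the point `0`, so that `o(t)` includes the convention that the
remainder vanishes at `t = 0`. -/
def IsLittleOhPoly (x : ℝ≥0 → ℝ) : Prop :=
  ∃ (k : ℕ) (r : ℝ) (α : Fin k → ℝ) (a : Fin k → ℝ≥0),
    (fun t : ℝ≥0 => x t - (r + ∑ i, α i * (t : ℝ) ^ (a i : ℝ))) =o[𝓝 0] (fun t : ℝ≥0 => (t : ℝ))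

/-- The linear span of the power functions `t ↦ t ^ a`, `a ≥ 0`. -/
def powSpan : Submodule ℝ (ℝ≥0 → ℝ) :=
  Submodule.span ℝ (Set.range fun (a : ℝ≥0) (t : ℝ≥0) => (t : ℝ) ^ (a : ℝ))

theorem isLittleOhPoly_iff (x : ℝ≥0 → ℝ) :
    IsLittleOhPoly x ↔ ∃ y ∈ powSpan, (x - y) =o[𝓝 0] (fun t : ℝ≥0 => (t : ℝ)) := by
  constructor
  · rintro ⟨k, r, α, a, h⟩
    refine ⟨fun t => r + ∑ i, α i * (t : ℝ) ^ (a i : ℝ), ?_, h⟩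
    have h1 : (fun t : ℝ≥0 => r + ∑ i, α i * (t : ℝ) ^ (a i : ℝ))
        = r • (fun t : ℝ≥0 => (t : ℝ) ^ ((0 : ℝ≥0) : ℝ))
          + ∑ i, α i • (fun t : ℝ≥0 => (t : ℝ) ^ (a i : ℝ)) := by
      funext t
      simp
    rw [h1]
    exact powSpan.add_mem (powSpan.smul_mem _ (Submodule.subset_span ⟨0, rfl⟩))
      (powSpan.sum_mem fun i _ => powSpan.smul_mem _ (Submodule.subset_span ⟨a i, rfl⟩))
  · rintro ⟨y, hy, h⟩
    obtain ⟨c, rfl⟩ := (Finsupp.mem_span_range_iff_exists_finsupp).1 hy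
    refine ⟨c.support.card, 0, fun i => c (c.support.equivFin.symm i),
      fun i => (c.support.equivFin.symm i : ℝ≥0), ?_⟩
    refine h.congr_left fun t => ?_
    have h2 : ∑ i, c (c.support.equivFin.symm i) * (t : ℝ) ^ ((c.support.equivFin.symm i : ℝ≥0) : ℝ)
        = ∑ a ∈ c.support, c a * (t : ℝ) ^ (a : ℝ) := by
      rw [← Finset.sum_coe_sort c.support (fun a => c a * (t : ℝ) ^ (a : ℝ))]
      exact Equiv.sum_comp c.support.equivFin.symm
        (fun a : c.support => c a * (t : ℝ) ^ ((a : ℝ≥0) : ℝ))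
    rw [h2]
    simp [Finsupp.sum]

theorem one_mem_powSpan : (1 : ℝ≥0 → ℝ) ∈ powSpan :=
  Submodule.subset_span ⟨0, by funext t; simp⟩

theorem mul_mem_powSpan {x y : ℝ≥0 → ℝ} (hx : x ∈ powSpan) (hy : y ∈ powSpan) :
    x * y ∈ powSpan := by
  have h := Submodule.mul_mem_mul hx hy
  rw [powSpan, Submodule.span_mul_span] at h
  refine Submodule.span_mono ?_ h
  rintro _ ⟨_, ⟨a, rfl⟩, _, ⟨b, rfl⟩, rfl⟩
  refine ⟨a + b, ?_⟩
  funext t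
  show (t : ℝ) ^ ((a + b : ℝ≥0) : ℝ) = (t : ℝ) ^ (a : ℝ) * (t : ℝ) ^ (b : ℝ)
  rw [NNReal.coe_add]
  exact Real.rpow_add_of_nonneg t.coe_nonneg a.coe_nonneg b.coe_nonneg

theorem isBigO_one_of_mem_powSpan {x : ℝ≥0 → ℝ} (hx : x ∈ powSpan) :
    x =O[𝓝 0] (fun _ : ℝ≥0 => (1 : ℝ)) := by
  induction hx using Submodule.span_induction with
  | mem x h =>
    obtain ⟨a, rfl⟩ := h
    have hc : Continuous fun t : ℝ≥0 => (t : ℝ) ^ (a : ℝ) :=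
      NNReal.continuous_coe.rpow_const fun _ => Or.inr a.2
    exact (hc.tendsto 0).isBigO_one ℝ
  | zero => exact isBigO_zero _ _
  | add x y _ _ hx hy => exact hx.add hy
  | smul c x _ hx => exact hx.const_smul_left c

theorem isBigO_one_of_isLittleO {x : ℝ≥0 → ℝ} (hx : x =o[𝓝 0] (fun t : ℝ≥0 => (t : ℝ))) :
    x =O[𝓝 0] (fun _ : ℝ≥0 => (1 : ℝ)) :=
  hx.isBigO.trans ((NNReal.continuous_coe.tendsto 0).isBigO_one ℝ)

theorem IsLittleOhPoly.isBigO_one {x : ℝ≥0 → ℝ} (hx : IsLittleOhPoly x) :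
    x =O[𝓝 0] (fun _ : ℝ≥0 => (1 : ℝ)) := by
  obtain ⟨y, hy, h⟩ := (isLittleOhPoly_iff x).1 hx
  have h1 := (isBigO_one_of_isLittleO h).add (isBigO_one_of_mem_powSpan hy)
  exact h1.congr_left fun t => by simp

theorem isLittleO_mul {x y : ℝ≥0 → ℝ} (hx : x =O[𝓝 0] (fun _ : ℝ≥0 => (1 : ℝ)))
    (hy : y =o[𝓝 0] (fun t : ℝ≥0 => (t : ℝ))) : (x * y) =o[𝓝 0] (fun t : ℝ≥0 => (t : ℝ)) :=
  (hx.mul_isLittleO hy).congr_right fun t => by simp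

/-- The algebra of little-oh polynomials, with pointwise operations. -/
def littleOhPoly : Subalgebra ℝ (ℝ≥0 → ℝ) where
  carrier := {x | IsLittleOhPoly x}
  mul_mem' := by
    intro x y hx hy
    obtain ⟨u, hu, hxu⟩ := (isLittleOhPoly_iff x).1 hx
    obtain ⟨v, hv, hyv⟩ := (isLittleOhPoly_iff y).1 hy
    refine (isLittleOhPoly_iff _).2 ⟨u * v, mul_mem_powSpan hu hv, ?_⟩
    have h1 := isLittleO_mul (IsLittleOhPoly.isBigO_one hx) hyv
    have h2 := isLittleO_mul (isBigO_one_of_mem_powSpan hv) hxu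
    refine (h1.add h2).congr_left fun t => ?_
    simp only [Pi.mul_apply, Pi.sub_apply]
    ring
  add_mem' := by
    intro x y hx hy
    obtain ⟨u, hu, hxu⟩ := (isLittleOhPoly_iff x).1 hx
    obtain ⟨v, hv, hyv⟩ := (isLittleOhPoly_iff y).1 hy
    refine (isLittleOhPoly_iff _).2 ⟨u + v, powSpan.add_mem hu hv, ?_⟩
    refine (hxu.add hyv).congr_left fun t => ?_
    simp only [Pi.add_apply, Pi.sub_apply]
    ring
  algebraMap_mem' := by
    intro r
    refine (isLittleOhPoly_iff _).2 ⟨r • 1, powSpan.smul_mem _ one_mem_powSpan, ?_⟩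
    refine (isLittleO_zero (fun t : ℝ≥0 => (t : ℝ)) (𝓝 (0 : ℝ≥0))).congr_left fun t => ?_
    simp

/-- The little-oh polynomials that are `o(t)`: the ones that are equivalent to `0`. -/
def nullIdeal : Ideal littleOhPoly where
  carrier := {x | (x : ℝ≥0 → ℝ) =o[𝓝 0] (fun t : ℝ≥0 => (t : ℝ))}
  add_mem' := fun hx hy => hx.add hy
  zero_mem' := isLittleO_zero _ _
  smul_mem' := fun c _ hx => isLittleO_mul (IsLittleOhPoly.isBigO_one c.2) hx

end FermatReals

/-- The ring of Fermat reals: little-oh polynomials modulo `x ~ y ↔ x_t = y_t + o(t)`. -/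
def FermatReal : Type := FermatReals.littleOhPoly ⧸ FermatReals.nullIdeal

namespace FermatReal

open FermatReals

noncomputable instance : CommRing FermatReal :=
  inferInstanceAs (CommRing (littleOhPoly ⧸ nullIdeal))

noncomputable instance : Algebra ℝ FermatReal :=
  inferInstanceAs (Algebra ℝ (littleOhPoly ⧸ nullIdeal))

/-- The class of a little-oh polynomial. -/
noncomputable def mk : littleOhPoly →+* FermatReal := Ideal.Quotient.mk nullIdeal

/-- Standard reals as (classes of) constant functions. -/
noncomputable instance : Coe ℝ FermatReal := ⟨fun r => algebraMap ℝ FermatReal r⟩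

/-- The standard part `x ↦ x(0)`. -/
noncomputable def st : FermatReal →+* ℝ :=
  Ideal.Quotient.lift nullIdeal ((Pi.evalRingHom (fun _ : ℝ≥0 => ℝ) 0).comp littleOhPoly.val.toRingHom)
    (fun x hx => by
      have h : (x : ℝ≥0 → ℝ) =o[𝓝 0] (fun t : ℝ≥0 => (t : ℝ)) := hx
      have h0 := (h.def one_pos).self_of_nhds
      simpa using h0)

/-- `x ≤ y` iff `x_t ≤ y_t + z_t` for all small `t ≥ 0` and some `z` that is `0` in the ring of
Fermat reals. -/
instance : LE FermatReal :=
  ⟨fun x y => ∃ u v z : littleOhPoly, mk u = x ∧ mk v = y ∧ mk z = 0 ∧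
    ∀ᶠ t in 𝓝 (0 : ℝ≥0), u.1 t ≤ v.1 t + z.1 t⟩

instance : LT FermatReal := ⟨fun x y => x ≤ y ∧ x ≠ y⟩

theorem isLittleOhPoly_pow (a : ℝ≥0) : (fun t : ℝ≥0 => (t : ℝ) ^ (a : ℝ)) ∈ littleOhPoly :=
  (isLittleOhPoly_iff _).2 ⟨_, Submodule.subset_span ⟨a, rfl⟩,
    (isLittleO_zero (fun t : ℝ≥0 => (t : ℝ)) (𝓝 (0 : ℝ≥0))).congr_left fun t => by simp⟩

/-- The Fermat real `t ^ a` (that is, `dt_{1/a}`). -/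
noncomputable def tpow (a : ℝ≥0) : FermatReal := mk ⟨fun t : ℝ≥0 => (t : ℝ) ^ (a : ℝ), isLittleOhPoly_pow a⟩

/-- `x = r + ∑ αᵢ t ^ aᵢ` is the (unique) decomposition of `x`:
`0 < a₁ < ⋯ < a_k ≤ 1` and all `αᵢ ≠ 0`. -/
def IsDecomposition (x : FermatReal) (k : ℕ) (r : ℝ) (α : Fin k → ℝ) (a : Fin k → ℝ≥0) : Prop :=
  x = r + ∑ i, (α i : FermatReal) * tpow (a i) ∧
    StrictMono a ∧ (∀ i, 0 < a i ∧ a i ≤ 1) ∧ ∀ i, α i ≠ 0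

/-- The order `ω(x) = 1 / a₁`, read off the decomposition of `x`, when that has at least one
infinitesimal term. For a standard real the set is empty, and `ω(x) = 0`. -/
noncomputable def order (x : FermatReal) : ℝ :=
  sSup {w | ∃ (k : ℕ) (r : ℝ) (α : Fin (k + 1) → ℝ) (a : Fin (k + 1) → ℝ≥0),
    IsDecomposition x (k + 1) r α a ∧ w = 1 / (a 0 : ℝ)}

/-- `D_c`: infinitesimals of order `< c + 1`. -/
def D (c : ℝ) : Set FermatReal := {x | st x = 0 ∧ order x < c + 1}

/-- `I_k`: infinitesimals of order `≤ k`. -/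
def I (k : ℝ) : Set FermatReal := {x | st x = 0 ∧ order x ≤ k}

open Classical in
/-- `y = ι_k x`: the terms of order `≤ k` are deleted from the decomposition of `x`. -/
def IsIota (k : ℝ) (x y : FermatReal) : Prop :=
  ∃ (n : ℕ) (r : ℝ) (α : Fin n → ℝ) (a : Fin n → ℝ≥0), IsDecomposition x n r α a ∧
    y = r + ∑ i with k < 1 / (a i : ℝ), (α i : FermatReal) * tpow (a i)

/-- `x =_k y`: equality up to infinitesimals of order `k`, i.e. `ι_k x = ι_k y`. -/
def EqUpTo (k : ℝ) (x y : FermatReal) : Prop := ∃ z, IsIota k x z ∧ IsIota k y z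

/-- Some little-oh polynomial that represents `x`. -/
noncomputable def rep (x : FermatReal) : littleOhPoly :=
  Function.surjInv (f := mk) Ideal.Quotient.mk_surjective x

open Classical in
/-- The extension of `g` at the point `x`: the class of `t ↦ g (x_t)`. This does not depend on the
representatives of the coordinates `x i` if `g` is smooth in a neighbourhood of the standard part
of `x`; it is used only there. -/
noncomputable def ext {ι : Type} (g : (ι → ℝ) → ℝ) (x : ι → FermatReal) : FermatReal :=
  if h : (fun t : ℝ≥0 => g fun i => (rep (x i)).1 t) ∈ littleOhPoly then mk ⟨_, h⟩ else 0

/-- The extension of a function of one real variable. -/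
noncomputable def ext₁ (g : ℝ → ℝ) (x : FermatReal) : FermatReal :=
  ext (fun q : Fin 1 → ℝ => g (q 0)) fun _ => x

/-- Standard part of a point of the `n`-dimensional Fermat space. -/
noncomputable def stv {ι : Type} (x : ι → FermatReal) : ι → ℝ := fun i => st (x i)

/-- The subset `U × V` of `ℝ^d × ℝ^n`. -/
def box {d n : ℕ} (U : Set (Fin d → ℝ)) (V : Set (Fin n → ℝ)) : Set (Fin d ⊕ Fin n → ℝ) :=
  {q | q ∘ Sum.inl ∈ U ∧ q ∘ Sum.inr ∈ V}

/-- `f : X → (Fermat reals)^m` is non-standard smooth: near every `z₀ ∈ X` it is of the form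
`f z = g(p, z)` with a smooth `g : U × V → ℝ^m` and a Fermat parameter `p`, `st p ∈ U`. -/
def SmoothOn {n m : ℕ} (X : Set (Fin n → FermatReal))
    (f : (Fin n → FermatReal) → (Fin m → FermatReal)) : Prop :=
  ∀ z₀ ∈ X, ∃ (d : ℕ) (p : Fin d → FermatReal) (U : Set (Fin d → ℝ)) (V : Set (Fin n → ℝ))
    (g : (Fin d ⊕ Fin n → ℝ) → (Fin m → ℝ)),
    IsOpen U ∧ IsOpen V ∧ stv p ∈ U ∧ stv z₀ ∈ V ∧ ContDiffOn ℝ ∞ g (box U V) ∧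
    ∀ z ∈ X, stv z ∈ V → f z = fun i => ext (fun q => g q i) (Sum.elim p z)

/-- `v` is the partial derivative at `z₀`, with respect to the `j`-th variable, of the non-standard
smooth function `f : X → (Fermat reals)`: if `f z = g(p, z)` near `z₀`, then
`v = (∂g/∂z_j)(p, z₀)`. -/
def HasPartial {n : ℕ} (X : Set (Fin n → FermatReal)) (f : (Fin n → FermatReal) → FermatReal)
    (j : Fin n) (z₀ : Fin n → FermatReal) (v : FermatReal) : Prop :=
  ∃ (d : ℕ) (p : Fin d → FermatReal) (U : Set (Fin d → ℝ)) (V : Set (Fin n → ℝ))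
    (g : (Fin d ⊕ Fin n → ℝ) → ℝ),
    IsOpen U ∧ IsOpen V ∧ stv p ∈ U ∧ stv z₀ ∈ V ∧ ContDiffOn ℝ ∞ g (box U V) ∧
    (∀ z ∈ X, stv z ∈ V → f z = ext g (Sum.elim p z)) ∧
    v = ext (fun q => fderiv ℝ g q (Pi.single (Sum.inr j) 1)) (Sum.elim p z₀)

open Classical in
/-- The partial derivative `∂f/∂z_j` of `f : X → (Fermat reals)`. For a non-standard smooth `f` on
an interval or a strip `X` the value does not depend on the choice of the local form of `f`. -/
noncomputable def pd {n : ℕ} (X : Set (Fin n → FermatReal))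
    (f : (Fin n → FermatReal) → FermatReal) (j : Fin n) (z : Fin n → FermatReal) : FermatReal :=
  if h : ∃ v, HasPartial X f j z v then h.choose else 0

/-- The interval `[a, b]` of Fermat reals, as a subset of the one-dimensional Fermat space. -/
def seg (a b : ℝ) : Set (Fin 1 → FermatReal) := {z | (a : FermatReal) ≤ z 0 ∧ z 0 ≤ (b : FermatReal)}

/-- The strip `[a, b] × [0, +∞)` of Fermat reals; the coordinates are `x = z 0` and `t = z 1`. -/
def strip (a b : ℝ) : Set (Fin 2 → FermatReal) :=
  {z | (a : FermatReal) ≤ z 0 ∧ z 0 ≤ (b : FermatReal) ∧ 0 ≤ z 1}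

/-- The strip `(a, b) × [0, +∞)` of Fermat reals. -/
def openStrip (a b : ℝ) : Set (Fin 2 → FermatReal) :=
  {z | (a : FermatReal) < z 0 ∧ z 0 < (b : FermatReal) ∧ 0 ≤ z 1}

/-- `∫_a^b f(x) dx = L`: there is a non-standard smooth primitive `F` of `f` on `[a, b]` with
`F a = 0` and `F b = L`. -/
def HasIntegral (a b : ℝ) (f : FermatReal → FermatReal) (L : FermatReal) : Prop :=
  ∃ F : (Fin 1 → FermatReal) → FermatReal, SmoothOn (seg a b) (fun z (_ : Fin 1) => F z) ∧
    (∀ z ∈ seg a b, HasPartial (seg a b) F 0 z (f (z 0))) ∧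
    F ![(a : FermatReal)] = 0 ∧ F ![(b : FermatReal)] = L

/-- The velocity `∂γ/∂x` of a curve `γ : [a, b] × [0, +∞) → (Fermat reals)²`. -/
noncomputable def velocity (a b : ℝ) (γ : (Fin 2 → FermatReal) → (Fin 2 → FermatReal))
    (z : Fin 2 → FermatReal) : Fin 2 → FermatReal :=
  fun i => pd (strip a b) (fun w => γ w i) 0 z

/-- `τ` is the unit tangent vector of `x ↦ γ(x, t)` at `z = (x, t)`: `∂γ/∂x = s τ` with a strictly
positive invertible `s`, and `τ₁² + τ₂² = 1`. -/
def IsUnitTangent (a b : ℝ) (γ : (Fin 2 → FermatReal) → (Fin 2 → FermatReal))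
    (z τ : Fin 2 → FermatReal) : Prop :=
  (∃ s : FermatReal, 0 < s ∧ IsUnit s ∧ ∀ i, velocity a b γ z i = s * τ i) ∧
    τ 0 ^ 2 + τ 1 ^ 2 = 1

/-- `φ ∈ (-π, π]` is the angle between the `x` axis and the unit vector `τ`. -/
def IsAngle (τ : Fin 2 → FermatReal) (φ : FermatReal) : Prop :=
  ((-Real.pi : ℝ) : FermatReal) < φ ∧ φ ≤ (Real.pi : FermatReal) ∧
    τ 0 = ext₁ Real.cos φ ∧ τ 1 = ext₁ Real.sin φ

/-- `L` is the length of `γ(-, t)`: `L = ∫_a^b |∂γ/∂x (x, t)| dx`. -/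
def IsLength (a b : ℝ) (γ : (Fin 2 → FermatReal) → (Fin 2 → FermatReal)) (t L : FermatReal) : Prop :=
  HasIntegral a b
    (fun x => ext₁ Real.sqrt (velocity a b γ ![x, t] 0 ^ 2 + velocity a b γ ![x, t] 1 ^ 2)) L

end FermatReal

open FermatReal

/-! For `0 ≤ e ≤ 1` the Fermat reals with `x_t = O(t ^ e)` form an ideal, `growth e`. For `k ≥ 1`
one has `I k = growth (1 / k)`, and `=_k` is congruence modulo `growth (1 / k)` (`mem_I_iff`,
`eqUpTo_iff`). So part (i) is a computation modulo `growth (1 / 2)`, and part (ii) an estimate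
modulo the same ideal.

Since `∂γ₁/∂x = 1 + α`, the standard part of `cos φ` is positive and `∂γ₂/∂x = (1 + α) tan φ`; hence
`∂²γ₂/∂x² = (1 + α) φ_x / cos² φ`. Take `δ = ± t ^ r` with `1/2 < r ≤ 1` in Newton's law. As `δ² =
0`, the increment of the tension is `δ` times its derivative, and an element annihilated by all
these `δ` lies in `growth (1 / 2)`. Hence `ρ ∂²γ₂/∂t² - G₂ ρ ≡ ∂𝐓₂/∂x ≡ T cos φ · φ_x`. Cancelling
the units `T` and `φ_x`, the wave equation becomes `cos³ φ ≡ 1 + α ≡ 1`, that is `cos φ ≡ 1`.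
Because `cos φ - 1 = -2 sin² (φ / 2)`, this says `φ = O(t ^ (1 / 4))`. For the length, `φ ∈ I 4`
makes the square of `∂γ₂/∂x` an element of `growth (1 / 2)`, so the speed is congruent to `1`, and
the congruence is integrated.

The ring carries no topology here, so calculus is done through `ℝ`-linear functionals `ℓ` to `ℝ`. By
Taylor's formula the value of a smooth function at a Fermat point is a finite sum of real
derivatives times monomials in the infinitesimal parts. A real shift moves only the derivatives, so
`ℓ` of the value is an ordinary differentiable function (`hasDerivAt_dual_ext`). Functionals
separate points, and separate an ideal from any element outside it. This gives uniqueness of partial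
derivatives, differentiation of congruences (`HasPartial.sub_mul_mem`) and a mean value theorem
modulo an ideal (`sub_sub_sub_mem_of_hasPartial`). The integral exists because cutoffs glue finitely
many local forms into one, whose primitive depends smoothly on the parameters. -/

namespace FermatReal
open FermatReals

/-! ### Representatives, standard part and order -/

theorem mk_surjective : Function.Surjective mk := Ideal.Quotient.mk_surjective

theorem mk_eq_zero_iff {u : littleOhPoly} :
    mk u = 0 ↔ (u : ℝ≥0 → ℝ) =o[𝓝 0] (fun t : ℝ≥0 => (t : ℝ)) :=
  Ideal.Quotient.eq_zero_iff_mem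

theorem mk_eq_mk_iff {u v : littleOhPoly} :
    mk u = mk v ↔ (fun t => u.1 t - v.1 t) =o[𝓝 0] (fun t : ℝ≥0 => (t : ℝ)) := by
  rw [← sub_eq_zero, ← map_sub, mk_eq_zero_iff]
  rfl

theorem mk_smul (r : ℝ) (u : littleOhPoly) : mk (r • u) = r • mk u :=
  map_smul (Ideal.Quotient.mkₐ ℝ nullIdeal) r u

theorem st_mk (u : littleOhPoly) : st (mk u) = u.1 0 := rfl

@[simp] theorem st_coe (r : ℝ) : st (r : FermatReal) = r := rfl

@[simp] theorem mk_rep (x : FermatReal) : mk (rep x) = x :=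
  Function.surjInv_eq _ x

@[simp] theorem rep_zero (x : FermatReal) : (rep x).1 0 = st x := by
  rw [← st_mk, mk_rep]

theorem isLittleO_rpow {a b : ℝ} (hb : 0 ≤ b) (hab : b < a) :
    (fun t : ℝ≥0 => (t : ℝ) ^ a) =o[𝓝 0] (fun t : ℝ≥0 => (t : ℝ) ^ b) := by
  have h1 : Tendsto (fun t : ℝ≥0 => (t : ℝ) ^ (a - b)) (𝓝 0) (𝓝 0) := by
    have hc : Continuous fun t : ℝ≥0 => (t : ℝ) ^ (a - b) :=
      NNReal.continuous_coe.rpow_const fun _ => Or.inr (by linarith)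
    have := hc.tendsto 0
    rwa [NNReal.coe_zero, Real.zero_rpow (by linarith)] at this
  have h2 := (isBigO_refl (fun t : ℝ≥0 => (t : ℝ) ^ b) (𝓝 0)).mul_isLittleO
    ((isLittleO_one_iff ℝ).2 h1)
  refine h2.congr (fun t => ?_) (fun t => by simp)
  rw [← Real.rpow_add_of_nonneg t.coe_nonneg hb (by linarith)]
  congr 1; ring

theorem isBigO_rpow {a b : ℝ} (hb : 0 ≤ b) (hab : b ≤ a) :
    (fun t : ℝ≥0 => (t : ℝ) ^ a) =O[𝓝 0] (fun t : ℝ≥0 => (t : ℝ) ^ b) := by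
  rcases hab.eq_or_lt with rfl | h
  · exact isBigO_refl _ _
  · exact (isLittleO_rpow hb h).isBigO

theorem isBigO_rpow_of_isLittleO {u : ℝ≥0 → ℝ} {e : ℝ} (he : 0 ≤ e) (he1 : e ≤ 1)
    (h : u =o[𝓝 0] (fun t : ℝ≥0 => (t : ℝ))) : u =O[𝓝 0] (fun t : ℝ≥0 => (t : ℝ) ^ e) :=
  h.isBigO.trans ((isBigO_rpow he he1).congr_left fun t => by simp)

theorem tendsto_of_mem {u : ℝ≥0 → ℝ} (hu : u ∈ littleOhPoly) : Tendsto u (𝓝 0) (𝓝 (u 0)) := by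
  obtain ⟨k, r, α, a, h⟩ : IsLittleOhPoly u := hu
  have hc : Continuous fun t : ℝ≥0 => r + ∑ i, α i * (t : ℝ) ^ (a i : ℝ) := by
    refine continuous_const.add (continuous_finsetSum _ fun i _ => continuous_const.mul ?_)
    exact NNReal.continuous_coe.rpow_const fun _ => Or.inr (a i).2
  -- The filter `𝓝 0` contains the point `0`, so the `o(t)` remainder vanishes there.
  have h0 : u 0 - (r + ∑ i, α i * ((0 : ℝ≥0) : ℝ) ^ (a i : ℝ)) = 0 := by
    simpa using (h.def one_pos).self_of_nhds
  have h1 := h.trans_tendsto (by simpa using NNReal.continuous_coe.tendsto 0)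
  have h2 := h1.add (hc.tendsto 0)
  rw [zero_add, ← sub_eq_zero.1 h0] at h2
  exact h2.congr fun t => by ring

theorem le_iff {x y : FermatReal} :
    x ≤ y ↔ ∃ w : littleOhPoly, mk w = y - x ∧ ∀ᶠ t in 𝓝 (0 : ℝ≥0), 0 ≤ w.1 t := by
  constructor
  · rintro ⟨u, v, z, rfl, rfl, hz, h⟩
    refine ⟨v + z - u, by simp [hz], h.mono fun t ht => ?_⟩
    exact sub_nonneg.2 ht
  · rintro ⟨w, hw, h⟩
    refine ⟨rep x, rep x + w, 0, mk_rep x, by simp [hw], map_zero _, h.mono fun t ht => ?_⟩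
    have : (rep x).1 t ≤ (rep x).1 t + w.1 t + 0 := by linarith
    exact this

theorem st_le_st {x y : FermatReal} (h : x ≤ y) : st x ≤ st y := by
  obtain ⟨w, hw, h⟩ := le_iff.1 h
  have h0 := h.self_of_nhds
  rw [← st_mk, hw, map_sub] at h0
  linarith

theorem lt_of_st_lt {x y : FermatReal} (h : st x < st y) : x < y := by
  refine ⟨le_iff.2 ⟨rep (y - x), mk_rep _, ?_⟩, fun e => by simp [e] at h⟩
  refine ((tendsto_of_mem (rep (y - x)).2).eventually (lt_mem_nhds (a := 0) ?_)).mono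
    fun t ht => ht.le
  rw [rep_zero, map_sub]; linarith

theorem le_add_of_nonneg {x y δ : FermatReal} (h : x ≤ y) (hδ : 0 ≤ δ) : x ≤ y + δ := by
  obtain ⟨w, hw, h⟩ := le_iff.1 h
  obtain ⟨w', hw', h'⟩ := le_iff.1 hδ
  refine le_iff.2 ⟨w + w', by rw [map_add, hw, hw']; ring, ?_⟩
  filter_upwards [h, h'] with t h1 h2
  exact add_nonneg h1 h2

theorem sub_le_of_nonneg {x y δ : FermatReal} (h : x ≤ y) (hδ : 0 ≤ δ) : x - δ ≤ y := by
  obtain ⟨w, hw, h⟩ := le_iff.1 (le_add_of_nonneg h hδ)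
  exact le_iff.2 ⟨w, by rw [hw]; ring, h⟩

theorem le_refl' (x : FermatReal) : x ≤ x :=
  le_iff.2 ⟨0, by simp, Eventually.of_forall fun _ => le_rfl⟩

theorem zero_le_tpow (a : ℝ≥0) : 0 ≤ tpow a :=
  le_iff.2 ⟨_, (sub_zero _).symm, Eventually.of_forall fun t => Real.rpow_nonneg t.2 _⟩

theorem isUnit_iff {x : FermatReal} : IsUnit x → st x ≠ 0 := fun h => (h.map st).ne_zero

/-! ### The ideals `{x | x_t = O(t ^ e)}` -/

/-- The ideal of the Fermat reals with `x_t = O(t ^ e)`. -/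
noncomputable def growth (e : ℝ) : Ideal FermatReal where
  carrier := {x | ∃ u, mk u = x ∧ u.1 =O[𝓝 0] (fun t : ℝ≥0 => (t : ℝ) ^ e)}
  add_mem' := by
    rintro _ _ ⟨u, rfl, hu⟩ ⟨v, rfl, hv⟩
    exact ⟨u + v, map_add _ _ _, hu.add hv⟩
  zero_mem' := ⟨0, map_zero _, isBigO_zero _ _⟩
  smul_mem' := by
    rintro c _ ⟨u, rfl, hu⟩
    refine ⟨rep c * u, by simp, ?_⟩
    exact ((IsLittleOhPoly.isBigO_one (rep c).2).mul hu).congr_right fun t => by simp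

/-- Two representatives differ by `o(t)`, which is `O(t ^ e)` exactly because `e ≤ 1`; membership
can be tested on any of them. -/
theorem mk_mem_growth {e : ℝ} (he : 0 ≤ e) (he1 : e ≤ 1) {u : littleOhPoly} :
    mk u ∈ growth e ↔ u.1 =O[𝓝 0] (fun t : ℝ≥0 => (t : ℝ) ^ e) := by
  refine ⟨?_, fun h => ⟨u, rfl, h⟩⟩
  rintro ⟨v, hv, h⟩
  have h1 := isBigO_rpow_of_isLittleO he he1 (mk_eq_mk_iff.1 hv.symm)
  exact (h1.add h).congr_left fun t => by ring

theorem growth_anti {d e : ℝ} (hd : 0 ≤ d) (h : d ≤ e) : growth e ≤ growth d := by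
  rintro _ ⟨u, rfl, hu⟩
  exact ⟨u, rfl, hu.trans (isBigO_rpow hd h)⟩

theorem tpow_mem_growth {a : ℝ≥0} {e : ℝ} (he : 0 ≤ e) (h : e ≤ a) : tpow a ∈ growth e :=
  ⟨_, rfl, isBigO_rpow he h⟩

theorem coe_mul_mem_growth {x : FermatReal} {e : ℝ} (r : ℝ) (h : x ∈ growth e) :
    (r : FermatReal) * x ∈ growth e := (growth e).mul_mem_left _ h

theorem st_of_mem_growth {x : FermatReal} {e : ℝ} (he : 0 < e) (h : x ∈ growth e) : st x = 0 := by
  obtain ⟨u, rfl, hu⟩ := h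
  obtain ⟨C, hC⟩ := hu.bound
  have := hC.self_of_nhds
  simpa [Real.zero_rpow he.ne', st_mk] using this

/-- Bounds on `u` and on `u ^ 2` are equivalent for real functions, and `2 * e ≤ 1` keeps the bound
on the square visible modulo `o(t)`. With `e = 1 / 4` this is the passage between orders `2` and
`4`. -/
theorem sq_mem_growth_iff {x : FermatReal} {e : ℝ} (he : 0 ≤ e) (he1 : 2 * e ≤ 1) :
    x ^ 2 ∈ growth (2 * e) ↔ x ∈ growth e := by
  have key : ∀ t : ℝ≥0, ((t : ℝ) ^ e) ^ 2 = (t : ℝ) ^ (2 * e) := fun t => by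
    rw [← Real.rpow_natCast, ← Real.rpow_mul t.coe_nonneg]; congr 1; push_cast; ring
  obtain ⟨u, rfl⟩ := mk_surjective x
  rw [← map_pow, mk_mem_growth (by linarith) he1, mk_mem_growth he (by linarith)]
  refine ⟨fun h => ?_, fun h => ?_⟩
  · refine IsBigO.of_pow (n := 2) two_ne_zero (h.congr_right fun t => (key t).symm)
  · exact (h.pow 2).congr_right key

/-! ### Decompositions -/

/-- `∑ c_a t ^ a`. -/
noncomputable def powSum : (ℝ≥0 →₀ ℝ) →ₗ[ℝ] FermatReal := Finsupp.linearCombination ℝ tpow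

theorem exists_mk_eq_powSum (c : ℝ≥0 →₀ ℝ) : ∃ u : littleOhPoly, mk u = powSum c ∧
    ∀ t : ℝ≥0, u.1 t = ∑ a ∈ c.support, c a * (t : ℝ) ^ (a : ℝ) := by
  refine ⟨∑ a ∈ c.support, c a • ⟨_, isLittleOhPoly_pow a⟩, ?_, fun t => ?_⟩
  · rw [map_sum]
    simp only [mk_smul]
    rfl
  · simp

/-- The term of smallest exponent dominates the others. On `𝓝[>] 0` powers of `t` are nonzero, so
relations there may also be divided by them. -/
theorem not_isLittleO_of_min {c : ℝ≥0 →₀ ℝ} {a : ℝ≥0} (ha : a ∈ c.support)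
    (hmin : ∀ b ∈ c.support, a ≤ b) :
    ¬ (fun t : ℝ≥0 => ∑ b ∈ c.support, c b * (t : ℝ) ^ (b : ℝ)) =o[𝓝[>] 0]
      (fun t : ℝ≥0 => (t : ℝ) ^ (a : ℝ)) := by
  intro h
  have h1 : (fun t : ℝ≥0 => ∑ b ∈ c.support.erase a, c b * (t : ℝ) ^ (b : ℝ)) =o[𝓝[>] 0]
      (fun t : ℝ≥0 => (t : ℝ) ^ (a : ℝ)) := by
    refine IsLittleO.fun_sum fun b hb => IsLittleO.const_mul_left ?_ _
    have hab : a < b := lt_of_le_of_ne (hmin b (Finset.mem_of_mem_erase hb))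
      (Finset.ne_of_mem_erase hb).symm
    exact (isLittleO_rpow a.2 (by exact_mod_cast hab)).mono nhdsWithin_le_nhds
  have h2 := (h.sub h1).congr_left (f₂ := fun t : ℝ≥0 => c a * (t : ℝ) ^ (a : ℝ)) fun t => by
    rw [← Finset.add_sum_erase _ _ ha]; ring
  rw [isLittleO_const_mul_left_iff (Finsupp.mem_support_iff.1 ha)] at h2
  refine isLittleO_irrefl ?_ h2
  refine Eventually.frequently ?_
  filter_upwards [self_mem_nhdsWithin] with t ht
  exact (Real.rpow_pos_of_pos (by exact_mod_cast ht) _).ne'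

theorem exists_min_support {c : ℝ≥0 →₀ ℝ} (hc : c ≠ 0) :
    ∃ a ∈ c.support, ∀ b ∈ c.support, a ≤ b :=
  c.support.exists_min_image id (Finsupp.support_nonempty_iff.2 hc)

/-- If the smallest exponent were below `e`, the whole sum would be negligible against its own
leading term. Uniqueness of the order and of truncations is deduced from this. -/
theorem powSum_mem_growth {c : ℝ≥0 →₀ ℝ} {e : ℝ} (he : 0 ≤ e) (he1 : e ≤ 1) :
    powSum c ∈ growth e ↔ ∀ a ∈ c.support, e ≤ a := by
  constructor
  · intro h
    obtain ⟨u, hu, hut⟩ := exists_mk_eq_powSum c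
    rw [← hu, mk_mem_growth he he1] at h
    intro b hb
    have hc : c ≠ 0 := by rintro rfl; simp at hb
    obtain ⟨a, ha, hmin⟩ := exists_min_support hc
    refine le_trans ?_ (NNReal.coe_le_coe.2 (hmin b hb))
    by_contra! hlt
    refine not_isLittleO_of_min ha hmin ?_
    exact ((h.trans_isLittleO (isLittleO_rpow a.2 hlt)).mono nhdsWithin_le_nhds).congr_left hut
  · intro h
    refine Submodule.sum_mem ((growth e).restrictScalars ℝ) fun a ha => ?_
    exact Submodule.smul_mem _ _ (tpow_mem_growth he (h a ha))

theorem tpow_eq_zero {a : ℝ≥0} (h : 1 < a) : tpow a = 0 :=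
  mk_eq_zero_iff.2 ((isLittleO_rpow zero_le_one (by exact_mod_cast h)).congr_right
    fun t => by simp)

theorem tpow_zero : tpow 0 = 1 := by
  show mk _ = mk 1
  congr 1
  ext t
  simp

theorem exists_eq_powSum (x : FermatReal) : ∃ c : ℝ≥0 →₀ ℝ, (∀ a ∈ c.support, a ≤ 1) ∧
    x = powSum c := by
  obtain ⟨u, rfl⟩ := mk_surjective x
  obtain ⟨y, hy, h⟩ := (isLittleOhPoly_iff _).1 u.2
  obtain ⟨c, rfl⟩ := (Finsupp.mem_span_range_iff_exists_finsupp).1 hy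
  refine ⟨c.filter (· ≤ 1), fun a ha => ?_, ?_⟩
  · by_contra h'
    exact Finsupp.mem_support_iff.1 ha (Finsupp.filter_apply_neg (· ≤ 1) c h')
  · have h1 : powSum (c.filter fun a => ¬ a ≤ 1) = 0 := by
      refine Finset.sum_eq_zero fun a ha => ?_
      have : 1 < a := by
        by_contra h'
        exact Finsupp.mem_support_iff.1 ha
          (Finsupp.filter_apply_neg (fun a => ¬ a ≤ 1) c (not_not.2 (not_lt.1 h')))
      show (c.filter fun a => ¬ a ≤ 1) a • tpow a = 0
      rw [tpow_eq_zero this, smul_zero]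
    have h2 : powSum c = powSum (c.filter (· ≤ 1)) := by
      conv_lhs => rw [← Finsupp.filter_add_filter_not c (· ≤ 1), map_add, h1, add_zero]
    rw [← h2]
    obtain ⟨v, hv, hvt⟩ := exists_mk_eq_powSum c
    rw [← hv, mk_eq_mk_iff]
    refine h.congr_left fun t => ?_
    rw [hvt]
    simp [Finsupp.sum]

theorem coe_mul_eq_smul (r : ℝ) (x : FermatReal) : (r : FermatReal) * x = r • x :=
  (Algebra.smul_def r x).symm

theorem exists_isDecomposition (x : FermatReal) : ∃ (k : ℕ) (r : ℝ) (α : Fin k → ℝ)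
    (a : Fin k → ℝ≥0), IsDecomposition x k r α a := by
  obtain ⟨c, hc, rfl⟩ := exists_eq_powSum x
  -- The exponent `0` carries the standard part; the remaining exponents are listed in increasing
  -- order.
  set A := c.support.erase 0 with hA
  have hmem : ∀ i, A.orderEmbOfFin rfl i ∈ A := fun i => Finset.orderEmbOfFin_mem _ _ _
  refine ⟨A.card, c 0, fun i => c (A.orderEmbOfFin rfl i), A.orderEmbOfFin rfl, ?_,
    (A.orderEmbOfFin rfl).strictMono, fun i => ⟨?_, ?_⟩, fun i => ?_⟩
  · have h1 : ∑ i, (c (A.orderEmbOfFin rfl i) : FermatReal) * tpow (A.orderEmbOfFin rfl i)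
        = ∑ a ∈ A, c a • tpow a := by
      rw [← Finset.sum_coe_sort A (fun a => c a • tpow a)]
      simp only [coe_mul_eq_smul]
      exact Equiv.sum_comp (A.orderIsoOfFin rfl).toEquiv (fun a : A => c a • tpow (a : ℝ≥0))
    rw [h1, hA]
    by_cases h0 : (0 : ℝ≥0) ∈ c.support
    · show ∑ a ∈ c.support, c a • tpow a = _
      rw [← Finset.add_sum_erase _ _ h0, tpow_zero, Algebra.smul_def, mul_one]
    · rw [Finset.erase_eq_of_notMem h0, Finsupp.notMem_support_iff.1 h0]
      show ∑ a ∈ c.support, c a • tpow a = _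
      simp
  · exact pos_iff_ne_zero.2 (Finset.ne_of_mem_erase (hmem i))
  · exact hc _ (Finset.mem_of_mem_erase (hmem i))
  · exact Finsupp.mem_support_iff.1 (Finset.mem_of_mem_erase (hmem i))

theorem sum_eq_powSum {k : ℕ} (s : Finset (Fin k)) (α : Fin k → ℝ) (a : Fin k → ℝ≥0) :
    ∑ i ∈ s, (α i : FermatReal) * tpow (a i) = powSum (∑ i ∈ s, Finsupp.single (a i) (α i)) := by
  simp [powSum, coe_mul_eq_smul]

theorem sum_single_apply {k : ℕ} {α : Fin k → ℝ} {a : Fin k → ℝ≥0} (ha : StrictMono a)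
    (i : Fin k) : (∑ j, Finsupp.single (a j) (α j)) (a i) = α i := by
  rw [Finsupp.finsetSum_apply, Finset.sum_eq_single i]
  · simp
  · intro j _ hj
    exact Finsupp.single_eq_of_ne (fun h => hj (ha.injective h.symm))
  · simp

theorem mem_support_sum_single {k : ℕ} {s : Finset (Fin k)} {α : Fin k → ℝ} {a : Fin k → ℝ≥0}
    {b : ℝ≥0} (hb : b ∈ (∑ j ∈ s, Finsupp.single (a j) (α j)).support) : ∃ i ∈ s, b = a i := by
  obtain ⟨i, hi, h⟩ := Finset.mem_biUnion.1 (Finsupp.support_finsetSum hb)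
  exact ⟨i, hi, Finset.mem_singleton.1 (Finsupp.support_single_subset h)⟩

namespace IsDecomposition

variable {x : FermatReal} {k : ℕ} {r : ℝ} {α : Fin k → ℝ} {a : Fin k → ℝ≥0}

theorem st_eq (h : IsDecomposition x k r α a) : st x = r := by
  rw [h.1, map_add, map_sum, st_coe, Finset.sum_eq_zero, add_zero]
  intro i _
  rw [map_mul, st_of_mem_growth (h.2.2.1 i).1 (tpow_mem_growth (a i).2 le_rfl), mul_zero]

theorem sub_mem_growth_iff (h : IsDecomposition x k r α a) {e : ℝ} (he : 0 ≤ e) (he1 : e ≤ 1) :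
    x - (r : FermatReal) ∈ growth e ↔ ∀ i, e ≤ a i := by
  have : x - (r : FermatReal) = powSum (∑ i, Finsupp.single (a i) (α i)) := by
    rw [← sum_eq_powSum, h.1]; ring
  rw [this, powSum_mem_growth he he1]
  refine ⟨fun H i => H _ ?_, fun H b hb => ?_⟩
  · rw [Finsupp.mem_support_iff, sum_single_apply h.2.1]
    exact h.2.2.2 i
  · obtain ⟨i, -, rfl⟩ := mem_support_sum_single hb
    exact H i

end IsDecomposition

theorem IsDecomposition.ne_coe {x : FermatReal} {k : ℕ} {r : ℝ} {α : Fin (k + 1) → ℝ}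
    {a : Fin (k + 1) → ℝ≥0} (h : IsDecomposition x (k + 1) r α a) (s : ℝ) :
    x ≠ (s : FermatReal) := by
  rintro rfl
  have hs : s = r := h.st_eq
  subst hs
  have h1 := h.1
  rw [left_eq_add, sum_eq_powSum] at h1
  obtain ⟨u, hu, hut⟩ := exists_mk_eq_powSum (∑ i, Finsupp.single (a i) (α i))
  rw [h1, mk_eq_zero_iff] at hu
  have h0 : a 0 ∈ (∑ i, Finsupp.single (a i) (α i)).support := by
    rw [Finsupp.mem_support_iff, sum_single_apply h.2.1]
    exact h.2.2.2 0
  refine not_isLittleO_of_min h0 (fun b hb => ?_) ((IsLittleO.congr_left ?_ hut).mono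
    nhdsWithin_le_nhds)
  · obtain ⟨i, -, rfl⟩ := mem_support_sum_single hb
    exact h.2.1.monotone (Fin.zero_le _)
  · refine hu.trans_isBigO ((isBigO_rpow (a 0).2 ?_).congr_left fun t => Real.rpow_one _)
    exact_mod_cast (h.2.2.1 0).2

theorem order_coe (r : ℝ) : order (r : FermatReal) = 0 := by
  refine (congrArg sSup (Set.eq_empty_of_forall_notMem ?_)).trans Real.sSup_empty
  rintro w ⟨k, s, α, a, h, -⟩
  exact h.ne_coe r rfl

/-- The first exponent is the largest `e ≤ 1` with `x - st x ∈ growth e`, so all decompositions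
share it and the supremum is over a single value. -/
theorem IsDecomposition.order_eq {x : FermatReal} {k : ℕ} {r : ℝ} {α : Fin (k + 1) → ℝ}
    {a : Fin (k + 1) → ℝ≥0} (h : IsDecomposition x (k + 1) r α a) : order x = 1 / (a 0 : ℝ) := by
  have key : ∀ {k k' r r' α α' a a'}, IsDecomposition x (k + 1) r α a →
      IsDecomposition x (k' + 1) r' α' a' → (a 0 : ℝ) ≤ a' 0 := by
    intro k k' r r' α α' a a' h h'
    have h1 := (h.sub_mem_growth_iff (a 0).2 (by exact_mod_cast (h.2.2.1 0).2)).2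
      fun i => NNReal.coe_le_coe.2 (h.2.1.monotone (Fin.zero_le i))
    rw [← h.st_eq, h'.st_eq] at h1
    exact (h'.sub_mem_growth_iff (a 0).2 (by exact_mod_cast (h.2.2.1 0).2)).1 h1 0
  rw [order, show {w : ℝ | _} = {1 / (a 0 : ℝ)} from ?_, csSup_singleton]
  ext w
  constructor
  · rintro ⟨k', r', α', a', h', rfl⟩
    rw [Set.mem_singleton_iff, le_antisymm (key h h') (key h' h)]
  · rintro rfl
    exact ⟨k, r, α, a, h, rfl⟩

theorem mem_I_iff {k : ℝ} (hk : 1 ≤ k) {x : FermatReal} : x ∈ I k ↔ x ∈ growth (1 / k) := by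
  have hk0 : 0 < k := by linarith
  have hk1 : 1 / k ≤ 1 := by rw [div_le_one hk0]; exact hk
  obtain ⟨n, r, α, a, h⟩ := exists_isDecomposition x
  have key : st x = 0 → (order x ≤ k ↔ x ∈ growth (1 / k)) := by
    intro h0
    rw [h.st_eq] at h0
    subst h0
    have h2 := h.sub_mem_growth_iff (e := 1 / k) (by positivity) hk1
    rw [map_zero, sub_zero] at h2
    rw [h2]
    rcases n with _ | n
    · have : x = ((0 : ℝ) : FermatReal) := by simpa using h.1
      rw [this, order_coe]
      simp [hk0.le]
    · have ha : (0 : ℝ) < a 0 := (h.2.2.1 0).1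
      rw [h.order_eq, one_div_le ha hk0]
      exact ⟨fun H i => H.trans (NNReal.coe_le_coe.2 (h.2.1.monotone (Fin.zero_le i))),
        fun H => H 0⟩
  refine ⟨fun hx => (key hx.1).1 hx.2, fun hx => ?_⟩
  have h0 := st_of_mem_growth (by positivity) hx
  exact ⟨h0, (key h0).2 hx⟩

theorem coe_eq_powSum (r : ℝ) : (r : FermatReal) = powSum (Finsupp.single 0 r) := by
  simp [powSum, tpow_zero, Algebra.smul_def]

theorem IsDecomposition.exists_iota {x : FermatReal} {n : ℕ} {r : ℝ} {α : Fin n → ℝ}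
    {a : Fin n → ℝ≥0} (h : IsDecomposition x n r α a) {k : ℝ} (hk : 1 ≤ k) :
    ∃ c : ℝ≥0 →₀ ℝ, IsIota k x (powSum c) ∧ x - powSum c ∈ growth (1 / k) ∧
      ∀ b ∈ c.support, (b : ℝ) < 1 / k := by
  classical
  have hk0 : 0 < k := by linarith
  refine ⟨Finsupp.single 0 r + ∑ i with k < 1 / (a i : ℝ), Finsupp.single (a i) (α i),
    ⟨n, r, α, a, h, ?_⟩, ?_, fun b hb => ?_⟩
  · rw [map_add, ← sum_eq_powSum, ← coe_eq_powSum]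
  · rw [map_add, ← sum_eq_powSum, ← coe_eq_powSum, h.1,
      ← Finset.sum_filter_add_sum_filter_not Finset.univ (fun i => k < 1 / (a i : ℝ))]
    rw [add_sub_add_left_eq_sub, add_sub_cancel_left]
    refine Submodule.sum_mem _ fun i hi => coe_mul_mem_growth _ (tpow_mem_growth (by positivity) ?_)
    have hi := not_lt.1 (Finset.mem_filter.1 hi).2
    exact (one_div_le (NNReal.coe_pos.2 (h.2.2.1 i).1) hk0).1 hi
  · rcases Finset.mem_union.1 (Finsupp.support_add hb) with hb | hb
    · rw [Finset.mem_singleton.1 (Finsupp.support_single_subset hb)]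
      simpa using hk0
    · obtain ⟨i, hi, rfl⟩ := mem_support_sum_single hb
      exact (lt_one_div hk0 (h.2.2.1 i).1).1 (Finset.mem_filter.1 hi).2

theorem IsIota.sub_mem_growth {k : ℝ} (hk : 1 ≤ k) {x y : FermatReal} (h : IsIota k x y) :
    x - y ∈ growth (1 / k) := by
  have hk0 : 0 < k := by linarith
  obtain ⟨n, r, α, a, h, rfl⟩ := h
  rw [h.1, ← Finset.sum_filter_add_sum_filter_not Finset.univ (fun i => k < 1 / (a i : ℝ)),
    add_sub_add_left_eq_sub]
  have : ∀ u v w : FermatReal, v = w → u ∈ growth (1 / k) → v + u - w ∈ growth (1 / k) := by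
    rintro u v _ rfl hu
    rwa [add_sub_cancel_left]
  refine this _ _ _ (by congr!) (Submodule.sum_mem _ fun i hi =>
    coe_mul_mem_growth _ (tpow_mem_growth (by positivity) ?_))
  have hi := not_lt.1 (Finset.mem_filter.1 hi).2
  exact (one_div_le (NNReal.coe_pos.2 (h.2.2.1 i).1) hk0).1 hi

/-- Truncation changes an element only within the ideal. Conversely, two truncations involve only
exponents below `1 / k`, and a nonzero combination of such powers is outside the ideal. -/
theorem eqUpTo_iff {k : ℝ} (hk : 1 ≤ k) {x y : FermatReal} :
    EqUpTo k x y ↔ x - y ∈ growth (1 / k) := by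
  have hk0 : 0 < k := by linarith
  have hk1 : 1 / k ≤ 1 := by rw [div_le_one hk0]; exact hk
  constructor
  · rintro ⟨z, hx, hy⟩
    have := Ideal.sub_mem _ (hx.sub_mem_growth hk) (hy.sub_mem_growth hk)
    rwa [sub_sub_sub_cancel_right] at this
  · intro h
    obtain ⟨n, r, α, a, hx⟩ := exists_isDecomposition x
    obtain ⟨m, s, β, b, hy⟩ := exists_isDecomposition y
    obtain ⟨c, hc1, hc2, hc3⟩ := hx.exists_iota hk
    obtain ⟨d, hd1, hd2, hd3⟩ := hy.exists_iota hk
    have h1 : powSum (c - d) ∈ growth (1 / k) := by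
      have := Ideal.add_mem _ (Ideal.sub_mem _ h hc2) hd2
      rw [map_sub]
      convert this using 1
      ring
    rw [powSum_mem_growth (by positivity) hk1] at h1
    have h2 : c - d = 0 := by
      by_contra hne
      obtain ⟨e, he, -⟩ := exists_min_support hne
      rcases Finset.mem_union.1 (Finsupp.support_sub he) with h' | h'
      · exact absurd (h1 e he) (not_le.2 (hc3 e h'))
      · exact absurd (h1 e he) (not_le.2 (hd3 e h'))
    rw [sub_eq_zero] at h2
    exact ⟨powSum c, hc1, h2 ▸ hd1⟩

theorem coe_mul_tpow_mem_D {a : ℝ≥0} (ha : 1 / 2 < (a : ℝ)) (ha1 : a ≤ 1) {r : ℝ} (hr : r ≠ 0) :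
    (r : FermatReal) * tpow a ∈ D 1 := by
  have ha0 : (0 : ℝ) < a := by linarith
  have hd : IsDecomposition ((r : FermatReal) * tpow a) (0 + 1) 0 (fun _ => r) (fun _ => a) :=
    ⟨by simp, fun i j hij => by omega, fun _ => ⟨ha0, ha1⟩, fun _ => hr⟩
  refine ⟨hd.st_eq, ?_⟩
  rw [hd.order_eq, div_lt_iff₀ ha0]
  linarith

/-- An element that is annihilated by all `t ^ a`, `1 / 2 < a ≤ 1`, has order at most `2`. -/
theorem mem_growth_half_of_tpow_mul {y : FermatReal}
    (h : ∀ a : ℝ≥0, 1 / 2 < (a : ℝ) → a ≤ 1 → tpow a * y = 0) : y ∈ growth (1 / 2) := by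
  obtain ⟨c, -, rfl⟩ := exists_eq_powSum y
  by_cases hc : c = 0
  · subst hc
    rw [map_zero]
    exact Ideal.zero_mem _
  obtain ⟨a, ha, hmin⟩ := exists_min_support hc
  rw [powSum_mem_growth (by norm_num) (by norm_num)]
  refine fun b hb => le_trans ?_ (NNReal.coe_le_coe.2 (hmin b hb))
  by_contra! hlt
  have ha1 : a ≤ 1 := by
    rw [← NNReal.coe_le_coe]
    push_cast
    linarith
  have hco : ((1 - a : ℝ≥0) : ℝ) = 1 - a := by rw [NNReal.coe_sub ha1]; simp
  -- If the leading exponent `a` were below `1 / 2`, multiplying by `t ^ (1 - a)` would turn the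
  -- leading term into a nonzero multiple of `t`, which is not `o(t)`.
  have h1 := h (1 - a) (by rw [hco]; linarith) tsub_le_self
  obtain ⟨u, hu, hut⟩ := exists_mk_eq_powSum c
  rw [← hu, tpow, ← map_mul, mk_eq_zero_iff] at h1
  refine not_isLittleO_of_min ha hmin ?_
  have h2 := (isBigO_refl (fun t : ℝ≥0 => ((t : ℝ) ^ (((1 - a : ℝ≥0)) : ℝ))⁻¹)
    (𝓝[>] 0)).mul_isLittleO (h1.mono nhdsWithin_le_nhds)
  refine h2.congr' ?_ ?_
  · filter_upwards [self_mem_nhdsWithin] with t ht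
    have : (0 : ℝ) < t := by exact_mod_cast ht
    rw [← hut]
    exact inv_mul_cancel_left₀ (Real.rpow_pos_of_pos this _).ne' _
  · filter_upwards [self_mem_nhdsWithin] with t ht
    have : (0 : ℝ) < t := by exact_mod_cast ht
    rw [hco, ← Real.rpow_neg this.le]
    nth_rw 2 [← Real.rpow_one (t : ℝ)]
    rw [← Real.rpow_add this]
    congr 1
    ring

/-- A real vector space is separated by its algebraic dual; this lets real analysis prove identities
between Fermat reals. -/
theorem eq_of_dual {x y : FermatReal} (h : ∀ ℓ : FermatReal →ₗ[ℝ] ℝ, ℓ x = ℓ y) : x = y := by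
  rw [← sub_eq_zero, ← Module.forall_dual_apply_eq_zero_iff ℝ]
  intro ℓ
  rw [map_sub, h, sub_self]

end FermatReal

/-! ### Taylor's formula -/

section Taylor

open scoped Nat

theorem taylor_isBigO {E : Type*} [NormedAddCommGroup E] [NormedSpace ℝ E] {g : E → ℝ} {x : E}
    {N : ℕ} (hg : ContDiffAt ℝ (N + 1) g x) :
    (fun y => g (x + y) - ∑ m ∈ Finset.range (N + 1),
      (m ! : ℝ)⁻¹ • iteratedFDeriv ℝ m g x (fun _ => y)) =O[𝓝 0] (fun y => ‖y‖ ^ (N + 1)) := by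
  have h1 : ∀ᶠ z in 𝓝 x, ContDiffAt ℝ (N + 1) g z :=
    hg.eventually (by exact_mod_cast WithTop.coe_ne_top)
  have h2 : ContinuousAt (iteratedFDeriv ℝ (N + 1) g) x :=
    (hg.iteratedFDeriv_right (i := N + 1) (m := 0) (by simp)).continuousAt
  have h3 : ∀ᶠ z in 𝓝 x, ‖iteratedFDeriv ℝ (N + 1) g z‖ < ‖iteratedFDeriv ℝ (N + 1) g x‖ + 1 :=
    h2.norm.eventually (gt_mem_nhds (lt_add_one _))
  obtain ⟨ε, hε, h4⟩ := Metric.eventually_nhds_iff_ball.1 (h1.and h3)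
  set M := ‖iteratedFDeriv ℝ (N + 1) g x‖ + 1
  refine IsBigO.of_bound M ?_
  filter_upwards [Metric.ball_mem_nhds (0 : E) hε] with y hy
  have hmem : ∀ s ∈ Set.Icc (0 : ℝ) 1, x + s • y ∈ Metric.ball x ε := by
    intro s hs
    rw [mem_ball_zero_iff] at hy
    rw [mem_ball_iff_norm, add_sub_cancel_left, norm_smul, Real.norm_eq_abs, abs_of_nonneg hs.1]
    exact (mul_le_of_le_one_left (norm_nonneg y) hs.2).trans_lt hy
  rw [map_add_eq_sum_add_integral_iteratedFDeriv fun s hs => (h4 _ (hmem s hs)).1,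
    add_sub_cancel_left, norm_smul, norm_pow, norm_norm]
  have h5 : ‖∫ t in (0 : ℝ)..1, (1 - t) ^ N • iteratedFDeriv ℝ (N + 1) g (x + t • y) fun _ => y‖
      ≤ M * ‖y‖ ^ (N + 1) * |1 - 0| := by
    refine intervalIntegral.norm_integral_le_of_norm_le_const fun s hs => ?_
    rw [Set.uIoc_of_le zero_le_one] at hs
    rw [norm_smul]
    have h6 : ‖(1 - s) ^ N‖ ≤ 1 := by
      rw [norm_pow, Real.norm_eq_abs, abs_of_nonneg (by linarith [hs.2])]
      exact pow_le_one₀ (by linarith [hs.2]) (by linarith [hs.1])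
    have h7 : ‖iteratedFDeriv ℝ (N + 1) g (x + s • y) fun _ => y‖ ≤ M * ‖y‖ ^ (N + 1) := by
      refine (ContinuousMultilinearMap.le_opNorm _ _).trans ?_
      rw [Finset.prod_const, Finset.card_univ, Fintype.card_fin]
      gcongr
      exact (h4 _ (hmem s ⟨hs.1.le, hs.2⟩)).2.le
    calc _ ≤ 1 * (M * ‖y‖ ^ (N + 1)) := by gcongr
      _ = _ := one_mul _
  have h6 : ‖(N ! : ℝ)⁻¹‖ ≤ 1 := by
    rw [norm_inv, Real.norm_natCast]
    exact inv_le_one_of_one_le₀ (by exact_mod_cast Nat.one_le_iff_ne_zero.2 (Nat.factorial_ne_zero N))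
  calc _ ≤ 1 * (M * ‖y‖ ^ (N + 1) * |1 - 0|) := by gcongr
    _ = _ := by simp

/-- Splits a Taylor term into real coefficients and products of coordinates, so that the coordinates
can be replaced by Fermat infinitesimals. -/
theorem ContinuousMultilinearMap.apply_const_eq_sum {ι : Type*} [Fintype ι] [DecidableEq ι] {m : ℕ}
    (c : ContinuousMultilinearMap ℝ (fun _ : Fin m => ι → ℝ) ℝ) (v : ι → ℝ) :
    c (fun _ => v) = ∑ r : Fin m → ι, c (fun k => Pi.single (r k) 1) * ∏ k, v (r k) := by
  have hv : v = ∑ i, v i • Pi.single (M := fun _ => ℝ) i 1 := by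
    rw [← Finset.univ_sum_single v]
    simp [← Pi.single_smul]
  conv_lhs => rw [hv]
  rw [ContinuousMultilinearMap.map_sum]
  refine Finset.sum_congr rfl fun r _ => ?_
  rw [ContinuousMultilinearMap.map_smul_univ, smul_eq_mul, mul_comm]

end Taylor

namespace FermatReal
open FermatReals
open scoped Nat

variable {ι κ : Type} [Fintype ι] [Fintype κ]

theorem exists_sub_st_mem_growth (x : FermatReal) :
    ∃ e : ℝ, 0 < e ∧ e ≤ 1 ∧ x - (st x : FermatReal) ∈ growth e := by
  obtain ⟨n, r, α, a, h⟩ := exists_isDecomposition x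
  rw [h.st_eq]
  rcases n with _ | n
  · exact ⟨1, one_pos, le_rfl, (h.sub_mem_growth_iff zero_le_one le_rfl).2 fun i => i.elim0⟩
  · have h1 : (a 0 : ℝ) ≤ 1 := by exact_mod_cast (h.2.2.1 0).2
    exact ⟨a 0, (h.2.2.1 0).1, h1, (h.sub_mem_growth_iff (a 0).2 h1).2
      fun i => NNReal.coe_le_coe.2 (h.2.1.monotone (Fin.zero_le i))⟩

/-- With one exponent `e` for all coordinates, a Taylor polynomial of degree `N` is exact in the
ring as soon as `(N + 1) * e > 1`. -/
theorem exists_forall_sub_st_mem_growth (x : ι → FermatReal) :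
    ∃ e : ℝ, 0 < e ∧ e ≤ 1 ∧ ∀ i, x i - (st (x i) : FermatReal) ∈ growth e := by
  choose e he he1 hx using fun i => exists_sub_st_mem_growth (x i)
  have h1 : ∀ᶠ ε in 𝓝[>] (0 : ℝ), ∀ i, ε ≤ e i := eventually_all.2 fun i =>
    mem_nhdsWithin_of_mem_nhds ((gt_mem_nhds (he i)).mono fun _ h => le_of_lt h)
  have h2 : ∀ᶠ ε in 𝓝[>] (0 : ℝ), ε ≤ 1 :=
    mem_nhdsWithin_of_mem_nhds ((gt_mem_nhds one_pos).mono fun _ h => le_of_lt h)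
  obtain ⟨ε, ⟨h, h'⟩, hε⟩ := ((h1.and h2).and self_mem_nhdsWithin).exists
  exact ⟨ε, hε, h', fun i => growth_anti (le_of_lt hε) (h i) (hx i)⟩

/-- The product of the infinitesimal parts of the coordinates `x_{r k}`. -/
noncomputable def monomial (x : ι → FermatReal) {m : ℕ} (r : Fin m → ι) : FermatReal :=
  ∏ k, (x (r k) - (st (x (r k)) : FermatReal))

/-- Taylor's formula: the value of a smooth function at a Fermat point. -/
theorem exists_mk_eq_taylor [DecidableEq ι] {x : ι → FermatReal} {e : ℝ} (he : 0 < e) (he1 : e ≤ 1)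
    (hx : ∀ i, x i - (st (x i) : FermatReal) ∈ growth e) {N : ℕ} (hN : 1 < (N + 1) * e)
    {u : ι → littleOhPoly} (hu : ∀ i, mk (u i) = x i) {g : (ι → ℝ) → ℝ}
    (hg : ContDiffAt ℝ ∞ g (stv x)) :
    ∃ h : (fun t : ℝ≥0 => g fun i => (u i).1 t) ∈ littleOhPoly,
      mk ⟨_, h⟩ = ∑ m ∈ Finset.range (N + 1), (m ! : ℝ)⁻¹ • ∑ r : Fin m → ι,
        iteratedFDeriv ℝ m g (stv x) (fun k => Pi.single (r k) 1) • monomial x r := by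
  set y : ι → littleOhPoly := fun i => u i - algebraMap ℝ littleOhPoly (st (x i)) with hy
  have hmky : ∀ i, mk (y i) = x i - (st (x i) : FermatReal) := fun i => by
    rw [hy, map_sub, hu]; rfl
  have hyO : ∀ i, (y i).1 =O[𝓝 0] (fun t : ℝ≥0 => (t : ℝ) ^ e) := fun i => by
    rw [← mk_mem_growth he.le he1, hmky]; exact hx i
  set η : ℝ≥0 → ι → ℝ := fun t i => (y i).1 t with hη
  have hηO : η =O[𝓝 0] (fun t : ℝ≥0 => (t : ℝ) ^ e) := isBigO_pi.2 hyO
  have hη0 : Tendsto η (𝓝 0) (𝓝 0) := by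
    refine hηO.trans_tendsto ?_
    have hc : Continuous fun t : ℝ≥0 => (t : ℝ) ^ e :=
      NNReal.continuous_coe.rpow_const fun _ => Or.inr he.le
    have := hc.tendsto 0
    rwa [NNReal.coe_zero, Real.zero_rpow he.ne'] at this
  set w : littleOhPoly := ∑ m ∈ Finset.range (N + 1), (m ! : ℝ)⁻¹ • ∑ r : Fin m → ι,
    iteratedFDeriv ℝ m g (stv x) (fun k => Pi.single (r k) 1) • ∏ k, y (r k) with hw
  have hwt : ∀ t, w.1 t = ∑ m ∈ Finset.range (N + 1),
      (m ! : ℝ)⁻¹ • iteratedFDeriv ℝ m g (stv x) (fun _ => η t) := by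
    intro t
    simp only [ContinuousMultilinearMap.apply_const_eq_sum, hw, hη]
    simp
  have hmkw : mk w = ∑ m ∈ Finset.range (N + 1), (m ! : ℝ)⁻¹ • ∑ r : Fin m → ι,
      iteratedFDeriv ℝ m g (stv x) (fun k => Pi.single (r k) 1) • monomial x r := by
    rw [hw]
    simp only [map_sum, mk_smul, map_prod, hmky, monomial]
  have hrem : (fun t : ℝ≥0 => (g fun i => (u i).1 t) - w.1 t) =o[𝓝 0]
      (fun t : ℝ≥0 => (t : ℝ)) := by
    have hg' : ContDiffAt ℝ (N + 1) g (stv x) := hg.of_le (by exact_mod_cast le_top)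
    have h1 := (taylor_isBigO hg').comp_tendsto hη0
    have h2 : (fun t : ℝ≥0 => ‖η t‖ ^ (N + 1)) =O[𝓝 0]
        (fun t : ℝ≥0 => (t : ℝ) ^ ((N + 1) * e)) := by
      refine (hηO.norm_left.pow (N + 1)).congr_right fun t => ?_
      rw [← Real.rpow_natCast, ← Real.rpow_mul t.coe_nonneg]
      congr 1; push_cast; ring
    -- The remainder is `O(t ^ ((N + 1) * e))` with exponent above `1`, hence zero in the ring.
    have h3 := (h1.trans h2).trans_isLittleO (isLittleO_rpow zero_le_one hN)
    refine h3.congr (fun t => ?_) (fun t => Real.rpow_one _)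
    rw [hwt]
    simp only [Function.comp]
    congr 2
    ext i
    simp [hη, hy, stv]
  have hmem : (fun t : ℝ≥0 => g fun i => (u i).1 t) ∈ littleOhPoly := by
    obtain ⟨v, hv, hwv⟩ := (isLittleOhPoly_iff _).1 w.2
    refine (isLittleOhPoly_iff _).2 ⟨v, hv, (hrem.add hwv).congr_left fun t => ?_⟩
    simp
  exact ⟨hmem, by rw [← hmkw, mk_eq_mk_iff]; exact hrem⟩

theorem exists_nat_one_lt {e : ℝ} (he : 0 < e) : ∃ N : ℕ, 1 < (N + 1) * e := by
  obtain ⟨N, hN⟩ := exists_nat_gt (1 / e)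
  refine ⟨N, ?_⟩
  rw [div_lt_iff₀ he] at hN
  nlinarith

/-! ### Smooth extensions: independence of representatives and algebraic rules -/

section ext

variable {x : ι → FermatReal} {g h : (ι → ℝ) → ℝ}

/-- The Taylor expression involves only the classes `x i`, so any representatives give the same
value as the chosen ones. -/
theorem exists_ext_eq_mk (hg : ContDiffAt ℝ ∞ g (stv x)) {u : ι → littleOhPoly}
    (hu : ∀ i, mk (u i) = x i) :
    ∃ h : (fun t : ℝ≥0 => g fun i => (u i).1 t) ∈ littleOhPoly, ext g x = mk ⟨_, h⟩ := by
  classical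
  obtain ⟨e, he, he1, hx⟩ := exists_forall_sub_st_mem_growth x
  obtain ⟨N, hN⟩ := exists_nat_one_lt he
  obtain ⟨h1, h2⟩ := exists_mk_eq_taylor he he1 hx hN hu hg
  obtain ⟨h3, h4⟩ := exists_mk_eq_taylor he he1 hx hN (fun i => mk_rep (x i)) hg
  exact ⟨h1, by rw [ext, dif_pos h3, h2, h4]⟩

theorem ext_eq_taylor [DecidableEq ι] {e : ℝ} (he : 0 < e) (he1 : e ≤ 1)
    (hx : ∀ i, x i - (st (x i) : FermatReal) ∈ growth e) {N : ℕ} (hN : 1 < (N + 1) * e)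
    (hg : ContDiffAt ℝ ∞ g (stv x)) :
    ext g x = ∑ m ∈ Finset.range (N + 1), (m ! : ℝ)⁻¹ • ∑ r : Fin m → ι,
        iteratedFDeriv ℝ m g (stv x) (fun k => Pi.single (r k) 1) • monomial x r := by
  obtain ⟨h3, h4⟩ := exists_mk_eq_taylor he he1 hx hN (fun i => mk_rep (x i)) hg
  rw [ext, dif_pos h3, h4]

theorem st_ext (hg : ContDiffAt ℝ ∞ g (stv x)) : st (ext g x) = g (stv x) := by
  obtain ⟨h1, h2⟩ := exists_ext_eq_mk hg (fun i => mk_rep (x i))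
  rw [h2, st_mk]
  simp only [rep_zero]
  rfl

theorem ext_congr (hgh : g =ᶠ[𝓝 (stv x)] h) (hg : ContDiffAt ℝ ∞ g (stv x)) :
    ext g x = ext h x := by
  obtain ⟨h1, h2⟩ := exists_ext_eq_mk hg (fun i => mk_rep (x i))
  obtain ⟨h3, h4⟩ := exists_ext_eq_mk (hg.congr_of_eventuallyEq hgh.symm) (fun i => mk_rep (x i))
  rw [h2, h4, mk_eq_mk_iff]
  have ht : Tendsto (fun (t : ℝ≥0) i => (rep (x i)).1 t) (𝓝 0) (𝓝 (stv x)) := by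
    refine tendsto_pi_nhds.2 fun i => ?_
    have := tendsto_of_mem (rep (x i)).2
    rwa [rep_zero] at this
  refine (isLittleO_zero (fun t : ℝ≥0 => (t : ℝ)) (𝓝 (0 : ℝ≥0))).congr' ?_ EventuallyEq.rfl
  filter_upwards [ht.eventually hgh] with t h5
  exact (sub_eq_zero.2 h5).symm

theorem ext_comp {G : κ → (ι → ℝ) → ℝ} {F : (κ → ℝ) → ℝ} (hG : ∀ k, ContDiffAt ℝ ∞ (G k) (stv x))
    (hF : ContDiffAt ℝ ∞ F fun k => G k (stv x)) :
    ext F (fun k => ext (G k) x) = ext (fun q => F fun k => G k q) x := by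
  choose h1 h2 using fun k => exists_ext_eq_mk (hG k) (fun i => mk_rep (x i))
  have hst : stv (fun k => ext (G k) x) = fun k => G k (stv x) := funext fun k => st_ext (hG k)
  obtain ⟨h3, h4⟩ := exists_ext_eq_mk (hst.symm ▸ hF : ContDiffAt ℝ ∞ F (stv fun k => ext (G k) x))
    (fun k => (h2 k).symm)
  have h5 : ContDiffAt ℝ ∞ (fun q => F fun k => G k q) (stv x) :=
    ContDiffAt.comp (stv x) hF (contDiffAt_pi.2 hG)
  obtain ⟨h6, h7⟩ := exists_ext_eq_mk h5 (fun i => mk_rep (x i))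
  rw [h4, h7]

theorem ext_coord (i : ι) : ext (fun q => q i) x = x i := by
  obtain ⟨h1, h2⟩ := exists_ext_eq_mk (x := x) (g := fun q => q i) (by fun_prop)
    (fun i => mk_rep (x i))
  rw [h2]
  exact mk_rep _

theorem ext_const (r : ℝ) : ext (fun _ => r) x = (r : FermatReal) := by
  obtain ⟨h1, h2⟩ := exists_ext_eq_mk (x := x) (g := fun _ => r) contDiffAt_const
    (fun i => mk_rep (x i))
  rw [h2]
  rfl

theorem ext_add (hg : ContDiffAt ℝ ∞ g (stv x)) (hh : ContDiffAt ℝ ∞ h (stv x)) :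
    ext (fun q => g q + h q) x = ext g x + ext h x := by
  obtain ⟨h1, h2⟩ := exists_ext_eq_mk hg (fun i => mk_rep (x i))
  obtain ⟨h3, h4⟩ := exists_ext_eq_mk hh (fun i => mk_rep (x i))
  obtain ⟨h5, h6⟩ := exists_ext_eq_mk (hg.add hh) (fun i => mk_rep (x i))
  rw [h2, h4, ← map_add]
  exact h6

theorem ext_mul (hg : ContDiffAt ℝ ∞ g (stv x)) (hh : ContDiffAt ℝ ∞ h (stv x)) :
    ext (fun q => g q * h q) x = ext g x * ext h x := by
  obtain ⟨h1, h2⟩ := exists_ext_eq_mk hg (fun i => mk_rep (x i))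
  obtain ⟨h3, h4⟩ := exists_ext_eq_mk hh (fun i => mk_rep (x i))
  obtain ⟨h5, h6⟩ := exists_ext_eq_mk (hg.mul hh) (fun i => mk_rep (x i))
  rw [h2, h4, ← map_mul]
  exact h6

theorem ext_sub (hg : ContDiffAt ℝ ∞ g (stv x)) (hh : ContDiffAt ℝ ∞ h (stv x)) :
    ext (fun q => g q - h q) x = ext g x - ext h x := by
  obtain ⟨h1, h2⟩ := exists_ext_eq_mk hg (fun i => mk_rep (x i))
  obtain ⟨h3, h4⟩ := exists_ext_eq_mk hh (fun i => mk_rep (x i))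
  obtain ⟨h5, h6⟩ := exists_ext_eq_mk (hg.sub hh) (fun i => mk_rep (x i))
  rw [h2, h4, ← map_sub]
  exact h6

end ext

/-! ### Derivatives -/

/-- The point `z` with its `j`-th coordinate shifted by `s`. -/
noncomputable def shift {ι : Type} [DecidableEq ι] (z : ι → FermatReal) (j : ι) (s : FermatReal) :
    ι → FermatReal := Function.update z j (z j + s)

theorem stv_shift {ν : Type} [DecidableEq ν] (z : ν → FermatReal) (j : ν) (s : FermatReal) :
    stv (shift z j s) = stv z + st s • Pi.single j 1 := by
  ext i
  by_cases h : i = j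
  · subst h; simp [stv, shift]
  · simp [stv, shift, h]

/-- Symmetry of the second derivative, applied to one direction of `v` at a time. It identifies the
derivative of a Taylor coefficient of `g` with the corresponding coefficient of `∂g`. -/
theorem iteratedFDeriv_fderiv_apply {E : Type*} [NormedAddCommGroup E] [NormedSpace ℝ E] {m : ℕ}
    {g : E → ℝ} {x w : E} (hg : ContDiffAt ℝ ∞ g x) (v : Fin m → E) :
    fderiv ℝ (fun y => iteratedFDeriv ℝ m g y v) x w
      = iteratedFDeriv ℝ m (fun y => fderiv ℝ g y w) x v := by
  -- The induction uses finite smoothness, which passes from a point to its neighbourhood;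
  -- smoothness of order `∞` at a point need not.
  have key : ∀ {m : ℕ} {g : E → ℝ} {x w : E} (v : Fin m → E), ContDiffAt ℝ (m + 2) g x →
      fderiv ℝ (fun y => iteratedFDeriv ℝ m g y v) x w
        = iteratedFDeriv ℝ m (fun y => fderiv ℝ g y w) x v := by
    intro m
    induction m with
    | zero => intro g x w v _; simp
    | succ m ih =>
      intro g x w v hg
      have hsucc : ∀ {f : E → ℝ} {y : E}, ContDiffAt ℝ (m + 1) f y →
          iteratedFDeriv ℝ (m + 1) f y v
            = iteratedFDeriv ℝ m (fun z => fderiv ℝ f z (v (Fin.last m))) y (Fin.init v) := by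
        intro f y hf
        rw [iteratedFDeriv_succ_apply_right]
        have h1 : ContDiffAt ℝ m (fderiv ℝ f) y := hf.fderiv_right (by norm_cast)
        have := ContinuousLinearMap.iteratedFDeriv_comp_left
          (ContinuousLinearMap.apply ℝ ℝ (v (Fin.last m))) h1 (i := m) le_rfl
        exact (congrArg (fun c => c (Fin.init v)) this).symm
      have hne : ((m + 1 + 2 : ℕ) : WithTop ℕ∞) ≠ ∞ :=
        ne_of_lt (WithTop.coe_lt_coe.2 (WithTop.coe_lt_top _))
      have hev : ∀ᶠ y in 𝓝 x, ContDiffAt ℝ ((m + 1 + 2 : ℕ) : WithTop ℕ∞) g y :=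
        ContDiffAt.eventually (by exact_mod_cast hg) hne
      have hfd : ∀ {y : E}, ContDiffAt ℝ ((m + 1 + 2 : ℕ) : WithTop ℕ∞) g y → ∀ w,
          ContDiffAt ℝ ((m + 2 : ℕ) : WithTop ℕ∞) (fun z => fderiv ℝ g z w) y := fun hy w =>
        (hy.fderiv_right (m := ((m + 2 : ℕ) : WithTop ℕ∞)) (by norm_cast)).clm_apply
          contDiffAt_const
      have h1 : (fun y => iteratedFDeriv ℝ (m + 1) g y v) =ᶠ[𝓝 x]
          fun y => iteratedFDeriv ℝ m (fun z => fderiv ℝ g z (v (Fin.last m))) y (Fin.init v) :=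
        hev.mono fun y hy => hsucc (hy.of_le (by norm_cast; omega))
      rw [h1.fderiv_eq, ih (Fin.init v) (by exact_mod_cast hfd hev.self_of_nhds _),
        hsucc ((hfd hev.self_of_nhds _).of_le (by norm_cast; omega))]
      have h2 : (fun y => fderiv ℝ (fun z => fderiv ℝ g z (v (Fin.last m))) y w) =ᶠ[𝓝 x]
          fun y => fderiv ℝ (fun z => fderiv ℝ g z w) y (v (Fin.last m)) := by
        refine hev.mono fun y hy => ?_
        have hd : DifferentiableAt ℝ (fderiv ℝ g) y :=
          (hy.fderiv_right (m := 1) (by norm_cast; omega)).differentiableAt one_ne_zero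
        have hs : IsSymmSndFDerivAt ℝ g y :=
          hy.isSymmSndFDerivAt (by
            rw [minSmoothness_of_isRCLikeNormedField]; norm_cast; omega)
        show fderiv ℝ (fun z => (fderiv ℝ g z) (v (Fin.last m))) y w
          = fderiv ℝ (fun z => (fderiv ℝ g z) w) y (v (Fin.last m))
        rw [fderiv_clm_apply hd (differentiableAt_const _),
          fderiv_clm_apply hd (differentiableAt_const _)]
        simpa using hs w (v (Fin.last m))
      rw [(h2.iteratedFDeriv ℝ m).self_of_nhds]
  exact key v (hg.of_le (WithTop.coe_le_coe.2 (le_top : ((m + 2 : ℕ) : ℕ∞) ≤ ⊤)))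

theorem monomial_shift {ν : Type} [DecidableEq ν] (z : ν → FermatReal) (j : ν) (s : ℝ) {m : ℕ}
    (r : Fin m → ν) : monomial (shift z j (s : FermatReal)) r = monomial z r := by
  refine Finset.prod_congr rfl fun k _ => ?_
  by_cases h : r k = j
  · simp [shift, h]
  · simp [shift, h]

theorem sub_st_shift {ν : Type} [DecidableEq ν] (z : ν → FermatReal) (j : ν) (s : ℝ) (i : ν) :
    shift z j (s : FermatReal) i - (st (shift z j (s : FermatReal) i) : FermatReal)
      = z i - (st (z i) : FermatReal) := by
  by_cases h : i = j
  · subst h; simp [shift]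
  · simp [shift, h]

/-- Real linear functionals of `s ↦ g (x + s e_j)` may be differentiated. -/
theorem hasDerivAt_dual_ext [DecidableEq ι] (ℓ : FermatReal →ₗ[ℝ] ℝ) {x : ι → FermatReal}
    {g : (ι → ℝ) → ℝ} (hg : ∀ᶠ q in 𝓝 (stv x), ContDiffAt ℝ ∞ g q) (j : ι) :
    HasDerivAt (fun s : ℝ => ℓ (ext g (shift x j (s : FermatReal))))
      (ℓ (ext (fun q => fderiv ℝ g q (Pi.single j 1)) x)) 0 := by
  obtain ⟨e, he, he1, hx⟩ := exists_forall_sub_st_mem_growth x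
  obtain ⟨N, hN⟩ := exists_nat_one_lt he
  have hg0 := hg.self_of_nhds
  have hline : HasDerivAt (fun s : ℝ => stv x + s • (Pi.single j 1 : ι → ℝ)) (Pi.single j 1) 0 := by
    simpa using ((hasDerivAt_id (0 : ℝ)).smul_const (Pi.single j 1 : ι → ℝ)).const_add (stv x)
  have hl0 : stv x + (0 : ℝ) • (Pi.single j 1 : ι → ℝ) = stv x := by simp
  have hg' : ContDiffAt ℝ ∞ (fun q => fderiv ℝ g q (Pi.single j 1)) (stv x) :=
    (hg0.fderiv_right (m := ∞) (by norm_cast)).clm_apply contDiffAt_const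
  -- A real shift moves the base point of the derivatives and leaves the infinitesimal parts alone.
  -- Thus the numbers `ℓ (monomial x r)` are constants, and one degree `N` serves for all small `s`.
  have h1 : (fun s : ℝ => ℓ (ext g (shift x j (s : FermatReal)))) =ᶠ[𝓝 0] fun s : ℝ =>
      ∑ m ∈ Finset.range (N + 1), (m ! : ℝ)⁻¹ • ∑ r : Fin m → ι,
        iteratedFDeriv ℝ m g (stv x + s • (Pi.single j 1 : ι → ℝ)) (fun k => Pi.single (r k) 1)
          * ℓ (monomial x r) := by
    have hc : Tendsto (fun s : ℝ => stv x + s • (Pi.single j 1 : ι → ℝ)) (𝓝 0) (𝓝 (stv x)) := by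
      have := hline.continuousAt.tendsto
      rwa [hl0] at this
    filter_upwards [hc.eventually hg] with s hs
    rw [ext_eq_taylor (x := shift x j (s : FermatReal)) he he1
      (fun i => by rw [sub_st_shift]; exact hx i) hN (by rw [stv_shift, st_coe]; exact hs)]
    simp only [map_sum, map_smul, monomial_shift, stv_shift, st_coe, smul_eq_mul]
  refine HasDerivAt.congr_of_eventuallyEq ?_ h1
  rw [ext_eq_taylor he he1 hx hN hg']
  simp only [map_sum, map_smul, smul_eq_mul]
  refine HasDerivAt.fun_sum fun m _ => HasDerivAt.const_mul _ (HasDerivAt.fun_sum fun r _ => ?_)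
  rw [← iteratedFDeriv_fderiv_apply hg0]
  have hd : DifferentiableAt ℝ (fun y => iteratedFDeriv ℝ m g y (fun k => Pi.single (r k) 1))
      (stv x + (0 : ℝ) • (Pi.single j 1 : ι → ℝ)) := by
    rw [hl0]
    exact (hg0.differentiableAt_iteratedFDeriv (by exact_mod_cast WithTop.coe_lt_top m)
      ).continuousMultilinear_apply_const _
  have := (hd.hasFDerivAt.comp_hasDerivAt (0 : ℝ) hline).mul_const (ℓ (monomial x r))
  rw [hl0] at this
  exact this

end FermatReal

namespace FermatReal
open FermatReals

/-! ### Local forms -/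

theorem stv_elim {κ ι : Type} (p : κ → FermatReal) (z : ι → FermatReal) :
    stv (Sum.elim p z) = Sum.elim (stv p) (stv z) := by
  ext i; cases i <;> rfl

/-- `f z = g(p, z)` for all `z ∈ X` near `z₀`, with `g` smooth near the standard part of
`(p, z₀)`. -/
def IsLocalForm {n : ℕ} {κ : Type} [Fintype κ] (X : Set (Fin n → FermatReal))
    (f : (Fin n → FermatReal) → FermatReal) (z₀ : Fin n → FermatReal) (p : κ → FermatReal)
    (g : (κ ⊕ Fin n → ℝ) → ℝ) : Prop :=
  (∀ᶠ q in 𝓝 (stv (Sum.elim p z₀)), ContDiffAt ℝ ∞ g q) ∧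
    ∀ᶠ v in 𝓝 (stv z₀), ∀ z ∈ X, stv z = v → f z = ext g (Sum.elim p z)

theorem exists_box_subset {d n : ℕ} {a : Fin d → ℝ} {b : Fin n → ℝ} {s : Set (Fin d ⊕ Fin n → ℝ)}
    (hs : s ∈ 𝓝 (Sum.elim a b)) : ∃ U V, IsOpen U ∧ IsOpen V ∧ a ∈ U ∧ b ∈ V ∧ box U V ⊆ s := by
  have hc : Continuous fun q : (Fin d → ℝ) × (Fin n → ℝ) => Sum.elim q.1 q.2 := by
    refine continuous_pi fun i => ?_
    cases i <;> simp only [Sum.elim_inl, Sum.elim_inr] <;> fun_prop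
  obtain ⟨U, V, hU, ha, hV, hb, h⟩ := mem_nhds_prod_iff'.1 ((hc.tendsto (a, b)) hs)
  refine ⟨U, V, hU, hV, ha, hb, fun q hq => ?_⟩
  have : (q ∘ Sum.inl, q ∘ Sum.inr) ∈ U ×ˢ V := hq
  have := h this
  rwa [Set.mem_preimage, Sum.elim_comp_inl_inr] at this

theorem isOpen_box {d n : ℕ} {U : Set (Fin d → ℝ)} {V : Set (Fin n → ℝ)} (hU : IsOpen U)
    (hV : IsOpen V) : IsOpen (box U V) := by
  have h1 : Continuous fun q : Fin d ⊕ Fin n → ℝ => q ∘ Sum.inl := by fun_prop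
  have h2 : Continuous fun q : Fin d ⊕ Fin n → ℝ => q ∘ Sum.inr := by fun_prop
  exact (hU.preimage h1).inter (hV.preimage h2)

section

variable {n : ℕ} {X : Set (Fin n → FermatReal)} {f : (Fin n → FermatReal) → FermatReal}
  {z₀ : Fin n → FermatReal} {κ : Type} [Fintype κ] {p : κ → FermatReal} {g : (κ ⊕ Fin n → ℝ) → ℝ}

theorem isLocalForm_of_box {d : ℕ} {p : Fin d → FermatReal} {U : Set (Fin d → ℝ)}
    {V : Set (Fin n → ℝ)} {g : (Fin d ⊕ Fin n → ℝ) → ℝ} (hU : IsOpen U) (hV : IsOpen V)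
    (hp : stv p ∈ U) (hz : stv z₀ ∈ V) (hg : ContDiffOn ℝ ∞ g (box U V))
    (hf : ∀ z ∈ X, stv z ∈ V → f z = ext g (Sum.elim p z)) : IsLocalForm X f z₀ p g := by
  refine ⟨?_, eventually_iff_exists_mem.2 ⟨V, hV.mem_nhds hz, ?_⟩⟩
  · rw [stv_elim]
    filter_upwards [(isOpen_box hU hV).mem_nhds
      (show Sum.elim (stv p) (stv z₀) ∈ box U V from ⟨hp, hz⟩)] with q hq
    exact hg.contDiffAt ((isOpen_box hU hV).mem_nhds hq)
  · rintro v hv z hzX rfl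
    exact hf z hzX hv

theorem IsLocalForm.exists_box {d : ℕ} {p : Fin d → FermatReal} {g : (Fin d ⊕ Fin n → ℝ) → ℝ}
    (h : IsLocalForm X f z₀ p g) : ∃ U V, IsOpen U ∧ IsOpen V ∧ stv p ∈ U ∧ stv z₀ ∈ V ∧
      ContDiffOn ℝ ∞ g (box U V) ∧ ∀ z ∈ X, stv z ∈ V → f z = ext g (Sum.elim p z) := by
  obtain ⟨h1, h2⟩ := h
  rw [stv_elim] at h1
  obtain ⟨U, V, hU, hV, hp, hz, h⟩ := exists_box_subset h1
  obtain ⟨W, hW, hWo, hzW⟩ := eventually_nhds_iff.1 h2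
  refine ⟨U, V ∩ W, hU, hV.inter hWo, hp, ⟨hz, hzW⟩, fun q hq => ?_, fun z hzX hz => ?_⟩
  · have h3 : ContDiffAt ℝ ∞ g q := h ⟨hq.1, hq.2.1⟩
    exact h3.contDiffWithinAt
  · exact hW _ hz.2 z hzX rfl

theorem hasPartial_iff {j : Fin n} {v : FermatReal} : HasPartial X f j z₀ v ↔
    ∃ (d : ℕ) (p : Fin d → FermatReal) (g : (Fin d ⊕ Fin n → ℝ) → ℝ), IsLocalForm X f z₀ p g ∧
      v = ext (fun q => fderiv ℝ g q (Pi.single (Sum.inr j) 1)) (Sum.elim p z₀) := by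
  constructor
  · rintro ⟨d, p, U, V, g, hU, hV, hp, hz, hg, hf, hv⟩
    exact ⟨d, p, g, isLocalForm_of_box hU hV hp hz hg hf, hv⟩
  · rintro ⟨d, p, g, h, hv⟩
    obtain ⟨U, V, hU, hV, hp, hz, hg, hf⟩ := h.exists_box
    exact ⟨d, p, U, V, g, hU, hV, hp, hz, hg, hf, hv⟩

theorem SmoothOn.exists_isLocalForm {m : ℕ} {f : (Fin n → FermatReal) → (Fin m → FermatReal)}
    (hf : SmoothOn X f) {z₀ : Fin n → FermatReal} (hz : z₀ ∈ X) :
    ∃ (d : ℕ) (p : Fin d → FermatReal) (g : Fin m → (Fin d ⊕ Fin n → ℝ) → ℝ),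
      ∀ i, IsLocalForm X (fun z => f z i) z₀ p (g i) := by
  obtain ⟨d, p, U, V, g, hU, hV, hp, hz, hg, hf⟩ := hf z₀ hz
  refine ⟨d, p, fun i q => g q i, fun i => isLocalForm_of_box hU hV hp hz ?_ fun z hzX hz => ?_⟩
  · exact contDiffOn_pi.1 hg i
  · rw [hf z hzX hz]

/-- Renaming of the parameters. -/
theorem IsLocalForm.reindex {κ' : Type} [Fintype κ'] [DecidableEq κ] [DecidableEq κ']
    (e : κ ≃ κ') (h : IsLocalForm X f z₀ p g) :
    ∃ g' : (κ' ⊕ Fin n → ℝ) → ℝ, IsLocalForm X f z₀ (p ∘ e.symm) g' ∧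
      ∀ j, ext (fun q => fderiv ℝ g' q (Pi.single (Sum.inr j) 1)) (Sum.elim (p ∘ e.symm) z₀)
        = ext (fun q => fderiv ℝ g q (Pi.single (Sum.inr j) 1)) (Sum.elim p z₀) := by
  set σ : κ ⊕ Fin n ≃ κ' ⊕ Fin n := Equiv.sumCongr e (Equiv.refl _) with hσ
  set A : (κ' ⊕ Fin n → ℝ) ≃L[ℝ] (κ ⊕ Fin n → ℝ) :=
    (LinearEquiv.funCongrLeft ℝ ℝ σ).toContinuousLinearEquiv with hA
  have hAq : ∀ q, A q = q ∘ σ := fun q => rfl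
  have hx : ∀ z, Sum.elim (p ∘ e.symm) z ∘ σ = Sum.elim p z := fun z => by
    ext i; cases i <;> simp [hσ]
  refine ⟨fun q => g (A q), ⟨?_, h.2.mono fun v hv z hzX hzv => ?_⟩, fun j => ?_⟩
  · have h1 : A (stv (Sum.elim (p ∘ e.symm) z₀)) = stv (Sum.elim p z₀) := by
      rw [← hx]; rfl
    have h2 : Tendsto A (𝓝 (stv (Sum.elim (p ∘ e.symm) z₀))) (𝓝 (stv (Sum.elim p z₀))) := by
      rw [← h1]; exact A.continuous.tendsto _
    filter_upwards [h2.eventually h.1] with q hq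
    exact ContDiffAt.comp q hq A.contDiff.contDiffAt
  · rw [hv z hzX hzv, ← hx]
    rfl
  · have h1 : ∀ q, fderiv ℝ (fun q => g (A q)) q (Pi.single (Sum.inr j) 1)
        = fderiv ℝ g (A q) (Pi.single (Sum.inr j) 1) := by
      intro q
      have : (fun q => g (A q)) = g ∘ A := rfl
      rw [this, A.comp_right_fderiv]
      show fderiv ℝ g (A q) (A _) = _
      congr 1
      ext i
      rw [hAq, Function.comp]
      have : Sum.inr j = σ (Sum.inr j) := rfl
      rw [this]
      simp [Pi.single_apply, σ.injective.eq_iff, -Equiv.sumCongr_apply]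
    simp only [h1]
    rw [← hx]
    rfl

theorem IsLocalForm.hasPartial [DecidableEq κ] (h : IsLocalForm X f z₀ p g) (j : Fin n) :
    HasPartial X f j z₀
      (ext (fun q => fderiv ℝ g q (Pi.single (Sum.inr j) 1)) (Sum.elim p z₀)) := by
  obtain ⟨g', h1, h2⟩ := h.reindex (Fintype.equivFin κ)
  exact hasPartial_iff.2 ⟨_, _, g', h1, (h2 j).symm⟩

theorem smoothOn_of_isLocalForm
    (h : ∀ z₀ ∈ X, ∃ (κ : Type) (_ : Fintype κ) (p : κ → FermatReal) (g : (κ ⊕ Fin n → ℝ) → ℝ),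
      IsLocalForm X f z₀ p g) : SmoothOn X (fun z (_ : Fin 1) => f z) := by
  classical
  intro z₀ hz₀
  obtain ⟨κ, _, p, g, hg⟩ := h z₀ hz₀
  obtain ⟨g', h1, -⟩ := hg.reindex (Fintype.equivFin κ)
  obtain ⟨U, V, hU, hV, hp, hz, hg, hf⟩ := h1.exists_box
  refine ⟨_, _, U, V, fun q _ => g' q, hU, hV, hp, hz, contDiffOn_pi.2 fun _ => hg, ?_⟩
  exact fun z hzX hzV => funext fun _ => hf z hzX hzV

theorem eventually_stv_elim {ν : Type} (p : ν → FermatReal) {P : (ν ⊕ Fin n → ℝ) → Prop}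
    (h : ∀ᶠ q in 𝓝 (stv (Sum.elim p z₀)), P q) :
    ∀ᶠ v in 𝓝 (stv z₀), ∀ z, stv z = v → P (stv (Sum.elim p z)) := by
  have hc : Continuous fun v : Fin n → ℝ => Sum.elim (stv p) v := by
    refine continuous_pi fun i => ?_
    cases i <;> simp only [Sum.elim_inl, Sum.elim_inr] <;> fun_prop
  rw [stv_elim] at h
  refine ((hc.tendsto (stv z₀)).eventually h).mono ?_
  rintro v hv z rfl
  rwa [stv_elim]

theorem IsLocalForm.eventually (h : IsLocalForm X f z₀ p g) :
    ∀ᶠ v in 𝓝 (stv z₀), ∀ z, stv z = v → IsLocalForm X f z p g := by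
  filter_upwards [eventually_stv_elim p h.1.eventually_nhds, h.2.eventually_nhds] with v h1 h2 z hz
  subst hz
  exact ⟨h1 z rfl, h2⟩

theorem IsLocalForm.eq (h : IsLocalForm X f z₀ p g) (hz : z₀ ∈ X) :
    f z₀ = ext g (Sum.elim p z₀) := h.2.self_of_nhds z₀ hz rfl

theorem IsLocalForm.contDiffAt (h : IsLocalForm X f z₀ p g) :
    ContDiffAt ℝ ∞ g (stv (Sum.elim p z₀)) := h.1.self_of_nhds

theorem IsLocalForm.comp {μ : Type} [Fintype μ] {f' : μ → (Fin n → FermatReal) → FermatReal}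
    {g' : μ → (κ ⊕ Fin n → ℝ) → ℝ} (h : ∀ k, IsLocalForm X (f' k) z₀ p (g' k))
    {F : (μ → ℝ) → ℝ} (hF : ∀ᶠ y in 𝓝 (fun k => g' k (stv (Sum.elim p z₀))), ContDiffAt ℝ ∞ F y) :
    IsLocalForm X (fun z => ext F fun k => f' k z) z₀ p (fun q => F fun k => g' k q) := by
  have hc : Tendsto (fun q k => g' k q) (𝓝 (stv (Sum.elim p z₀)))
      (𝓝 (fun k => g' k (stv (Sum.elim p z₀)))) :=
    tendsto_pi_nhds.2 fun k => (h k).contDiffAt.continuousAt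
  have h1 : ∀ᶠ q in 𝓝 (stv (Sum.elim p z₀)), ∀ k, ContDiffAt ℝ ∞ (g' k) q :=
    eventually_all.2 fun k => (h k).1
  have h2 := h1.and (hc.eventually hF)
  refine ⟨h2.mono fun q hq => ContDiffAt.comp q hq.2 (contDiffAt_pi.2 hq.1), ?_⟩
  filter_upwards [eventually_stv_elim p h2, eventually_all.2 fun k => (h k).2]
    with v h3 h4 z hzX hzv
  simp only [fun k => h4 k z hzX hzv]
  exact ext_comp (h3 z hzv).1 (h3 z hzv).2

theorem IsLocalForm.congr {f' : (Fin n → FermatReal) → FermatReal} (h : IsLocalForm X f z₀ p g)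
    (hf : ∀ z ∈ X, f' z = f z) : IsLocalForm X f' z₀ p g :=
  ⟨h.1, h.2.mono fun _ hv z hzX hz => (hf z hzX).trans (hv z hzX hz)⟩

theorem shift_elim {ν ι : Type} [DecidableEq ν] [DecidableEq ι] (p : ν → FermatReal)
    (z : ι → FermatReal) (j : ι) (s : FermatReal) :
    shift (Sum.elim p z) (Sum.inr j) s = Sum.elim p (shift z j s) := by
  ext i
  rcases i with i | i
  · simp [shift]
  · by_cases h : i = j
    · subst h; simp [shift]
    · simp [shift, h]

theorem shift_zero {ι : Type} [DecidableEq ι] (z : ι → FermatReal) (j : ι) :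
    shift z j ((0 : ℝ) : FermatReal) = z := by
  simp [shift]

/-- The local form describes `f` only on `X`, so only real displacements that remain in `X` count;
at an end of the interval they are one-sided. -/
theorem IsLocalForm.hasDerivWithinAt [DecidableEq κ] (h : IsLocalForm X f z₀ p g) (hz : z₀ ∈ X)
    (j : Fin n) (ℓ : FermatReal →ₗ[ℝ] ℝ) :
    HasDerivWithinAt (fun s : ℝ => ℓ (f (shift z₀ j (s : FermatReal))))
      (ℓ (ext (fun q => fderiv ℝ g q (Pi.single (Sum.inr j) 1)) (Sum.elim p z₀)))
      {s : ℝ | shift z₀ j (s : FermatReal) ∈ X} 0 := by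
  have h1 := (hasDerivAt_dual_ext ℓ h.1 (Sum.inr j)).hasDerivWithinAt
    (s := {s : ℝ | shift z₀ j (s : FermatReal) ∈ X})
  simp only [shift_elim] at h1
  refine h1.congr_of_eventuallyEq ?_ ?_
  · have hc : Tendsto (fun s : ℝ => stv (shift z₀ j (s : FermatReal))) (𝓝 0) (𝓝 (stv z₀)) := by
      simp only [stv_shift, st_coe]
      have hc : Continuous fun s : ℝ => stv z₀ + s • (Pi.single j 1 : Fin n → ℝ) := by fun_prop
      simpa using hc.tendsto 0
    filter_upwards [self_mem_nhdsWithin, nhdsWithin_le_nhds (hc.eventually h.2)] with s hs h2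
    rw [h2 _ hs rfl]
  · rw [shift_zero, h.eq hz]

theorem HasPartial.hasDerivWithinAt {j : Fin n} {v : FermatReal} (h : HasPartial X f j z₀ v)
    (hz : z₀ ∈ X) (ℓ : FermatReal →ₗ[ℝ] ℝ) :
    HasDerivWithinAt (fun s : ℝ => ℓ (f (shift z₀ j (s : FermatReal)))) (ℓ v)
      {s : ℝ | shift z₀ j (s : FermatReal) ∈ X} 0 := by
  obtain ⟨d, p, g, hg, rfl⟩ := hasPartial_iff.1 h
  exact hg.hasDerivWithinAt hz j ℓ

/-- For each `ℓ`, both `ℓ v` and `ℓ w` are the derivative of the same real function, whichever local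
forms were used. -/
theorem HasPartial.unique {j : Fin n} {v w : FermatReal} (hv : HasPartial X f j z₀ v)
    (hw : HasPartial X f j z₀ w) (hz : z₀ ∈ X)
    (hX : UniqueDiffWithinAt ℝ {s : ℝ | shift z₀ j (s : FermatReal) ∈ X} 0) : v = w :=
  eq_of_dual fun ℓ => hX.eq_deriv _ (hv.hasDerivWithinAt hz ℓ) (hw.hasDerivWithinAt hz ℓ)

theorem HasPartial.pd_eq {j : Fin n} {v : FermatReal} (hv : HasPartial X f j z₀ v)
    (hz : z₀ ∈ X) (hX : UniqueDiffWithinAt ℝ {s : ℝ | shift z₀ j (s : FermatReal) ∈ X} 0) :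
    pd X f j z₀ = v := by
  have h : ∃ v, HasPartial X f j z₀ v := ⟨v, hv⟩
  rw [pd, dif_pos h]
  exact h.choose_spec.unique hv hz hX

theorem IsLocalForm.pd_eq [DecidableEq κ] {j : Fin n} (h : IsLocalForm X f z₀ p g)
    (hz : z₀ ∈ X) (hX : UniqueDiffWithinAt ℝ {s : ℝ | shift z₀ j (s : FermatReal) ∈ X} 0) :
    pd X f j z₀ = ext (fun q => fderiv ℝ g q (Pi.single (Sum.inr j) 1)) (Sum.elim p z₀) :=
  (h.hasPartial j).pd_eq hz hX

theorem contDiffAt_fderiv_apply {E : Type*} [NormedAddCommGroup E] [NormedSpace ℝ E] {g : E → ℝ}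
    {x : E} (h : ContDiffAt ℝ ∞ g x) (w : E) : ContDiffAt ℝ ∞ (fun q => fderiv ℝ g q w) x :=
  (h.fderiv_right (m := ∞) (by norm_cast)).clm_apply contDiffAt_const

/-- The partial derivative keeps the same parameter and is again locally smooth, so differentiation
can be iterated. -/
theorem IsLocalForm.pd [DecidableEq κ] {j : Fin n} (h : IsLocalForm X f z₀ p g)
    (hX : ∀ z ∈ X, UniqueDiffWithinAt ℝ {s : ℝ | shift z j (s : FermatReal) ∈ X} 0) :
    IsLocalForm X (pd X f j) z₀ p (fun q => fderiv ℝ g q (Pi.single (Sum.inr j) 1)) :=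
  ⟨h.1.mono fun _ hq => contDiffAt_fderiv_apply hq _,
    h.eventually.mono fun _ hv z hzX hz => (hv z hz).pd_eq hzX (hX z hzX)⟩

/-! ### Functions of one variable -/

theorem ext₁_ext {ι : Type} [Fintype ι] {x : ι → FermatReal} {g : (ι → ℝ) → ℝ} {h : ℝ → ℝ}
    (hg : ContDiffAt ℝ ∞ g (stv x)) (hh : ContDiffAt ℝ ∞ h (g (stv x))) :
    ext₁ h (ext g x) = ext (fun q => h (g q)) x :=
  ext_comp (κ := Fin 1) (G := fun _ => g) (F := fun q => h (q 0)) (fun _ => hg)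
    (ContDiffAt.comp (g := h) (f := fun q : Fin 1 → ℝ => q 0) _ hh (by fun_prop))

theorem ext₁_def {h : ℝ → ℝ} (x : FermatReal) :
    ext₁ h x = ext (fun q : Fin 1 → ℝ => h (q 0)) fun _ => x := rfl

theorem contDiffAt_eval {h : ℝ → ℝ} {x : FermatReal} (hh : ContDiffAt ℝ ∞ h (st x)) :
    ContDiffAt ℝ ∞ (fun q : Fin 1 → ℝ => h (q 0)) (stv fun _ => x) :=
  ContDiffAt.comp (g := h) (f := fun q : Fin 1 → ℝ => q 0) _ hh (by fun_prop)

theorem st_ext₁ {h : ℝ → ℝ} {x : FermatReal} (hh : ContDiffAt ℝ ∞ h (st x)) :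
    st (ext₁ h x) = h (st x) := st_ext (contDiffAt_eval hh)

theorem ext₁_ext₁ {h k : ℝ → ℝ} {x : FermatReal} (hh : ContDiffAt ℝ ∞ h (st x))
    (hk : ContDiffAt ℝ ∞ k (h (st x))) : ext₁ k (ext₁ h x) = ext₁ (fun s => k (h s)) x :=
  ext₁_ext (contDiffAt_eval hh) hk

theorem ext₁_congr {h k : ℝ → ℝ} {x : FermatReal} (hhk : h =ᶠ[𝓝 (st x)] k)
    (hh : ContDiffAt ℝ ∞ h (st x)) : ext₁ h x = ext₁ k x :=
  ext_congr (((continuous_apply (0 : Fin 1)).tendsto (stv fun _ => x)).eventually hhk)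
    (contDiffAt_eval hh)

theorem ext₁_id (x : FermatReal) : ext₁ (fun s => s) x = x := ext_coord (0 : Fin 1)

theorem ext₁_mul {h k : ℝ → ℝ} {x : FermatReal} (hh : ContDiffAt ℝ ∞ h (st x))
    (hk : ContDiffAt ℝ ∞ k (st x)) : ext₁ (fun s => h s * k s) x = ext₁ h x * ext₁ k x :=
  ext_mul (contDiffAt_eval hh) (contDiffAt_eval hk)

theorem ext₁_add {h k : ℝ → ℝ} {x : FermatReal} (hh : ContDiffAt ℝ ∞ h (st x))
    (hk : ContDiffAt ℝ ∞ k (st x)) : ext₁ (fun s => h s + k s) x = ext₁ h x + ext₁ k x :=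
  ext_add (contDiffAt_eval hh) (contDiffAt_eval hk)

theorem ext₁_const (r : ℝ) (x : FermatReal) : ext₁ (fun _ => r) x = (r : FermatReal) := ext_const r

/-- The inverse is the extension of `s ↦ s⁻¹`, smooth near `st x`. -/
theorem isUnit_of_st_ne_zero {x : FermatReal} (h : st x ≠ 0) : IsUnit x := by
  have h1 : ContDiffAt ℝ ∞ (fun s : ℝ => s⁻¹) (st x) := contDiffAt_inv ℝ h
  refine IsUnit.of_mul_eq_one (ext₁ (fun s => s⁻¹) x) ?_
  conv_lhs => enter [1]; rw [← ext₁_id x]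
  rw [← ext₁_mul contDiff_fun_id.contDiffAt h1, ← map_one (algebraMap ℝ FermatReal), ← ext₁_const 1 x]
  refine ext₁_congr ?_ (contDiffAt_id.mul h1)
  filter_upwards [isOpen_ne.mem_nhds h] with s hs
  exact mul_inv_cancel₀ hs

/-- The chain rule. -/
theorem HasPartial.ext₁ {j : Fin n} {v : FermatReal} (hf : HasPartial X f j z₀ v) (hz : z₀ ∈ X)
    {h : ℝ → ℝ} (hh : ∀ᶠ s in 𝓝 (st (f z₀)), ContDiffAt ℝ ∞ h s) :
    HasPartial X (fun z => ext₁ h (f z)) j z₀ (FermatReal.ext₁ (deriv h) (f z₀) * v) := by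
  obtain ⟨d, p, g, hg, rfl⟩ := hasPartial_iff.1 hf
  have hst : st (f z₀) = g (stv (Sum.elim p z₀)) := by rw [hg.eq hz, st_ext hg.contDiffAt]
  rw [hst] at hh
  have hF : ∀ᶠ y in 𝓝 (fun _ : Fin 1 => g (stv (Sum.elim p z₀))),
      ContDiffAt ℝ ∞ (fun q : Fin 1 → ℝ => h (q 0)) y := by
    filter_upwards [((continuous_apply (0 : Fin 1)).tendsto
      (fun _ : Fin 1 => g (stv (Sum.elim p z₀)))).eventually hh] with y hy
    exact ContDiffAt.comp (g := h) (f := fun q : Fin 1 → ℝ => q 0) _ hy (by fun_prop)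
  have h1 : IsLocalForm X (fun z => FermatReal.ext₁ h (f z)) z₀ p (fun q => h (g q)) :=
    IsLocalForm.comp (μ := Fin 1) (f' := fun _ => f) (g' := fun _ => g) (fun _ => hg) hF
  have h2 := h1.hasPartial j
  have hd : ContDiffAt ℝ ∞ (deriv h) (g (stv (Sum.elim p z₀))) := by
    exact contDiffAt_fderiv_apply hh.self_of_nhds 1
  have hd' : ContDiffAt ℝ ∞ (fun q => deriv h (g q)) (stv (Sum.elim p z₀)) :=
    ContDiffAt.comp (g := deriv h) (f := g) _ hd hg.contDiffAt
  convert h2 using 1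
  rw [hg.eq hz, ext₁_ext hg.contDiffAt hd, ← ext_mul hd' (contDiffAt_fderiv_apply hg.contDiffAt _)]
  refine ext_congr ?_ (hd'.mul (contDiffAt_fderiv_apply hg.contDiffAt _))
  filter_upwards [hg.1, hg.contDiffAt.continuousAt.eventually hh] with q h3 h4
  have h5 := (h4.differentiableAt (by simp)).hasDerivAt.comp_hasFDerivAt q
    (h3.differentiableAt (by simp)).hasFDerivAt
  have h6 : fderiv ℝ (fun q => h (g q)) q = deriv h (g q) • fderiv ℝ g q := h5.fderiv
  rw [h6]
  rfl

end

end FermatReal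

/-! ### Exact first-order increments along infinitesimals of square zero -/

/-- The derivative is Lipschitz near `x`, and the mean value inequality on segments gives a
quadratic remainder. The constant is uniform in the base point, which matters because the
representative of a Fermat point moves with `t`. -/
theorem exists_eventually_sub_fderiv_le {E : Type*} [NormedAddCommGroup E] [NormedSpace ℝ E]
    {g : E → ℝ} {x : E} (hg : ContDiffAt ℝ 2 g x) :
    ∃ K : ℝ, ∀ᶠ q : E × E in 𝓝 (x, 0),
      ‖g (q.1 + q.2) - g q.1 - fderiv ℝ g q.1 q.2‖ ≤ K * ‖q.2‖ ^ 2 := by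
  obtain ⟨K, t, ht, hK⟩ := (hg.fderiv_right (m := 1) (by norm_num)).exists_lipschitzOnWith
  have h1 : ∀ᶠ y in 𝓝 x, ContDiffAt ℝ 2 g y := hg.eventually (by simp)
  obtain ⟨ε, hε, h⟩ := Metric.eventually_nhds_iff_ball.1 (h1.and ht)
  refine ⟨K, ?_⟩
  have hc : Continuous fun q : E × E => q.1 + q.2 := by fun_prop
  have h2 : ∀ᶠ q : E × E in 𝓝 (x, 0), q.1 + q.2 ∈ Metric.ball x ε :=
    (hc.tendsto (x, 0)).eventually (Metric.isOpen_ball.mem_nhds (by simpa using hε))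
  have h3 : ∀ᶠ q : E × E in 𝓝 (x, 0), q.1 ∈ Metric.ball x ε :=
    (continuous_fst.tendsto (x, (0 : E))).eventually
      (Metric.isOpen_ball.mem_nhds (by simpa using hε))
  filter_upwards [h2, h3] with ⟨q, v⟩ hqv hq
  have hseg : segment ℝ q (q + v) ⊆ Metric.ball x ε :=
    (convex_ball x ε).segment_subset hq hqv
  have h4 := (convex_segment q (q + v)).norm_image_sub_le_of_norm_fderiv_le' (𝕜 := ℝ) (f := g)
    (C := K * ‖v‖) (φ := fderiv ℝ g q)
    (fun y hy => (h y (hseg hy)).1.differentiableAt (by simp))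
    (fun y hy => ?_) (left_mem_segment ℝ _ _) (right_mem_segment ℝ _ _)
  · simp only [add_sub_cancel_left] at h4
    exact h4.trans (by rw [pow_two, mul_assoc])
  · have h5 := hK.dist_le_mul y (h y (hseg hy)).2 q (h q hq).2
    rw [dist_eq_norm, dist_eq_norm] at h5
    refine h5.trans (mul_le_mul_of_nonneg_left ?_ K.2)
    have := norm_sub_le_of_mem_segment hy
    simpa using this

namespace FermatReal
open FermatReals

/-- The remainder is `O(δ²) = O(t ^ (2 * e))`, and `2 * e > 1` makes it zero in the ring. -/
theorem ext_shift_of_mem_growth {ι : Type} [Fintype ι] [DecidableEq ι] {x : ι → FermatReal}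
    {g : (ι → ℝ) → ℝ} (hg : ContDiffAt ℝ ∞ g (stv x)) (j : ι) {δ : FermatReal} {e : ℝ}
    (he : 1 / 2 < e) (hδ : δ ∈ growth e) :
    ext g (shift x j δ) = ext g x + δ * ext (fun q => fderiv ℝ g q (Pi.single j 1)) x := by
  obtain ⟨w, rfl, hw⟩ := hδ
  have hst : st (mk w) = 0 := st_of_mem_growth (by linarith) ⟨w, rfl, hw⟩
  set u : ι → littleOhPoly := fun i => rep (x i) with hu
  set u' : ι → littleOhPoly := Function.update u j (u j + w) with hu'
  have hmk' : ∀ i, mk (u' i) = shift x j (mk w) i := fun i => by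
    by_cases h : i = j
    · subst h; simp [hu', hu, shift]
    · simp [hu', hu, shift, h]
  have hst' : stv (shift x j (mk w)) = stv x := by rw [stv_shift, hst]; simp
  obtain ⟨h1, h2⟩ := exists_ext_eq_mk (hst'.symm ▸ hg) hmk'
  obtain ⟨h3, h4⟩ := exists_ext_eq_mk hg (fun i => mk_rep (x i))
  obtain ⟨h5, h6⟩ := exists_ext_eq_mk (contDiffAt_fderiv_apply hg (Pi.single j 1))
    (fun i => mk_rep (x i))
  rw [h2, h4, h6, ← map_mul, ← map_add, mk_eq_mk_iff]
  obtain ⟨K, hK⟩ := exists_eventually_sub_fderiv_le (hg.of_le (WithTop.coe_le_coe.2 (le_top : (2 : ℕ∞) ≤ ⊤)))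
  have hw0 : Tendsto w.1 (𝓝 0) (𝓝 0) := by
    have := tendsto_of_mem w.2
    rwa [← st_mk, hst] at this
  have ht : Tendsto (fun t : ℝ≥0 => ((fun i => (u i).1 t), w.1 t • (Pi.single j 1 : ι → ℝ)))
      (𝓝 0) (𝓝 (stv x, 0)) := by
    refine Tendsto.prodMk_nhds (tendsto_pi_nhds.2 fun i => ?_) ?_
    · have := tendsto_of_mem (rep (x i)).2
      rwa [rep_zero] at this
    · simpa using hw0.smul_const (Pi.single j 1 : ι → ℝ)
  have hO : (fun t : ℝ≥0 => g (fun i => (u' i).1 t) - ((g fun i => (u i).1 t)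
      + w.1 t * fderiv ℝ g (fun i => (u i).1 t) (Pi.single j 1))) =O[𝓝 0]
      (fun t : ℝ≥0 => (w.1 t) ^ 2) := by
    refine IsBigO.of_bound (K * ‖(Pi.single j 1 : ι → ℝ)‖ ^ 2) ?_
    filter_upwards [ht.eventually hK] with t ht
    have e1 : (fun i => (u' i).1 t) = (fun i => (u i).1 t) + w.1 t • (Pi.single j 1 : ι → ℝ) := by
      ext i
      by_cases h : i = j
      · subst h; simp [hu']
      · simp [hu', h]
    rw [e1, ← sub_sub]
    rw [map_smul, smul_eq_mul, norm_smul] at ht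
    refine ht.trans (le_of_eq ?_)
    rw [norm_pow]
    ring
  have hO2 : (fun t : ℝ≥0 => (w.1 t) ^ 2) =O[𝓝 0] (fun t : ℝ≥0 => (t : ℝ) ^ (2 * e)) := by
    refine (hw.pow 2).congr_right fun t => ?_
    rw [← Real.rpow_natCast, ← Real.rpow_mul t.coe_nonneg]
    congr 1; push_cast; ring
  exact ((hO.trans hO2).trans_isLittleO (isLittleO_rpow zero_le_one (by linarith))).congr_right
    fun t => Real.rpow_one _

/-- Differentiability at `0` together with `h 0 = 0` gives `h (y_t) = O(y_t)`. -/
theorem ext₁_mem_growth {y : FermatReal} {e : ℝ} (he : 0 < e) (hy : y ∈ growth e) {h : ℝ → ℝ}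
    (hh : ContDiffAt ℝ ∞ h 0) (h0 : h 0 = 0) : ext₁ h y ∈ growth e := by
  have hst : st y = 0 := st_of_mem_growth he hy
  obtain ⟨u, rfl, hu⟩ := hy
  obtain ⟨h1, h2⟩ := exists_ext_eq_mk (contDiffAt_eval (hst.symm ▸ hh)) (u := fun _ => u)
    (fun _ => rfl)
  rw [ext₁_def, h2]
  refine ⟨_, rfl, IsBigO.trans ?_ hu⟩
  have h3 := (hh.differentiableAt (by simp)).hasFDerivAt.isBigO_sub
  have h4 : Tendsto u.1 (𝓝 0) (𝓝 0) := by
    have := tendsto_of_mem u.2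
    rwa [← st_mk, hst] at this
  refine (h3.comp_tendsto h4).congr (fun t => ?_) (fun t => ?_) <;> simp [h0]

/-! ### Differentiation of relations modulo an ideal -/

section

variable {n : ℕ} {X : Set (Fin n → FermatReal)} {f f' : (Fin n → FermatReal) → FermatReal}
  {z : Fin n → FermatReal} {j : Fin n} {v v' : FermatReal}

/-- Relations between functions modulo an ideal may be differentiated. -/
theorem HasPartial.sub_mul_mem (h : HasPartial X f j z v) (h' : HasPartial X f' j z v')
    (K : Ideal FermatReal) (c d : FermatReal) {Y : Set (Fin n → FermatReal)} (hYX : Y ⊆ X)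
    (hz : z ∈ Y) (hY : UniqueDiffWithinAt ℝ {s : ℝ | shift z j (s : FermatReal) ∈ Y} 0)
    (hK : ∀ s : ℝ, shift z j (s : FermatReal) ∈ Y →
      f (shift z j (s : FermatReal)) - c * f' (shift z j (s : FermatReal)) - d ∈ K) :
    v - c * v' ∈ K := by
  by_contra hv
  -- A functional that kills `K` but not `v - c * v'`. Since `ℓ (c * ·)` is again a functional, the
  -- relation becomes one between real functions and can be differentiated.
  obtain ⟨ℓ, h1, h2⟩ := Submodule.exists_le_ker_of_notMem (p := K.restrictScalars ℝ) hv
  refine h1 ?_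
  have hsub : {s : ℝ | shift z j (s : FermatReal) ∈ Y} ⊆
      {s : ℝ | shift z j (s : FermatReal) ∈ X} := fun s hs => hYX hs
  have h3 := (h.hasDerivWithinAt (hYX hz) ℓ).mono hsub
  have h4 := (h'.hasDerivWithinAt (hYX hz) (ℓ ∘ₗ LinearMap.mulLeft ℝ c)).mono hsub
  have h5 := h3.sub h4
  have h6 : HasDerivWithinAt (fun _ : ℝ => ℓ d) 0 {s : ℝ | shift z j (s : FermatReal) ∈ Y} 0 :=
    hasDerivWithinAt_const _ _ _
  have h7 : ∀ s : ℝ, shift z j (s : FermatReal) ∈ Y → ℓ d =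
      ℓ (f (shift z j (s : FermatReal)))
        - (ℓ ∘ₗ LinearMap.mulLeft ℝ c) (f' (shift z j (s : FermatReal))) := by
    intro s hs
    have : ℓ _ = 0 := h2 (hK s hs)
    rw [map_sub, map_sub, sub_eq_zero] at this
    exact this.symm
  have h8 := hY.eq_deriv _ h5 (h6.congr_of_mem (fun s hs => (h7 s hs).symm)
    (by show shift z j _ ∈ Y; rw [shift_zero]; exact hz))
  rw [map_sub]
  exact h8

theorem HasPartial.eq_mul (h : HasPartial X f j z v) (h' : HasPartial X f' j z v')
    (c d : FermatReal) (hz : z ∈ X)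
    (hX : UniqueDiffWithinAt ℝ {s : ℝ | shift z j (s : FermatReal) ∈ X} 0)
    (hK : ∀ s : ℝ, shift z j (s : FermatReal) ∈ X →
      f (shift z j (s : FermatReal)) = c * f' (shift z j (s : FermatReal)) + d) :
    v = c * v' := by
  have := h.sub_mul_mem h' ⊥ c d subset_rfl hz hX fun s hs => by
    rw [Ideal.mem_bot, hK s hs]; ring
  exact sub_eq_zero.1 this

theorem hasPartial_coord (X : Set (Fin n → FermatReal)) (z : Fin n → FermatReal) (j : Fin n) :
    HasPartial X (fun z => z j) j z 1 := by
  have h1 : IsLocalForm X (fun z => z j) z (Fin.elim0 : Fin 0 → FermatReal)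
      (fun q => q (Sum.inr j)) := by
    refine ⟨Eventually.of_forall fun q => by fun_prop, Eventually.of_forall fun v z _ _ => ?_⟩
    exact (ext_coord (x := Sum.elim Fin.elim0 z) (Sum.inr j)).symm
  have h2 := h1.hasPartial j
  have h3 : ∀ q : Fin 0 ⊕ Fin n → ℝ, fderiv ℝ (fun q : Fin 0 ⊕ Fin n → ℝ => q (Sum.inr j)) q
      (Pi.single (Sum.inr j) 1) = 1 := fun q => by
    have : fderiv ℝ (fun q : Fin 0 ⊕ Fin n → ℝ => q (Sum.inr j)) q
        = ContinuousLinearMap.proj (R := ℝ) (φ := fun _ => ℝ) (Sum.inr j) :=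
      (ContinuousLinearMap.proj (R := ℝ) (φ := fun _ : Fin 0 ⊕ Fin n => ℝ) (Sum.inr j)).fderiv
    rw [this]
    simp
  simp only [h3, ext_const, map_one] at h2
  exact h2

end

/-! ### Strips -/

section strip

variable {a b : ℝ} {z : Fin 2 → FermatReal}

theorem coe_nonneg {s : ℝ} (h : 0 ≤ s) : (0 : FermatReal) ≤ (s : FermatReal) := by
  rcases h.eq_or_lt with rfl | h
  · rw [map_zero]; exact le_refl' 0
  · exact (lt_of_st_lt (by simpa using h)).1

@[simp] theorem shift_apply_same {ι : Type} [DecidableEq ι] (z : ι → FermatReal) (j : ι)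
    (s : FermatReal) : shift z j s j = z j + s := by simp [shift]

@[simp] theorem shift_zero_apply_one (z : Fin 2 → FermatReal) (s : FermatReal) :
    shift z 0 s 1 = z 1 := by simp [shift]

theorem shift_eq_vec (z : Fin 2 → FermatReal) (s : FermatReal) : shift z 0 s = ![z 0 + s, z 1] := by
  ext i; fin_cases i <;> simp [shift]

/-- From any point of `[a, b]` one can move either to the right or to the left. -/
theorem exists_shift_mem (hab : a < b) {x : FermatReal} (hx : (a : FermatReal) ≤ x)
    (hx' : x ≤ (b : FermatReal)) :
    ∃ c d : ℝ, c < d ∧ 0 ∈ Set.Icc c d ∧ ∀ s ∈ Set.Icc c d, s ≠ 0 →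
      a < st x + s ∧ st x + s < b := by
  have h1 : a ≤ st x := st_le_st hx
  have h2 : st x ≤ b := st_le_st hx'
  rcases h2.lt_or_eq with h | h
  · refine ⟨0, (b - st x) / 2, by linarith, ⟨le_rfl, by linarith⟩, fun s hs hs0 => ?_⟩
    have := lt_of_le_of_ne hs.1 hs0.symm
    exact ⟨by linarith, by linarith [hs.2]⟩
  · refine ⟨-((b - a) / 2), 0, by linarith, ⟨by linarith, le_rfl⟩, fun s hs hs0 => ?_⟩
    have := lt_of_le_of_ne hs.2 hs0
    exact ⟨by linarith [hs.1], by linarith⟩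

theorem openStrip_subset_strip : openStrip a b ⊆ strip a b := fun _ h => ⟨h.1.1, h.2.1.1, h.2.2⟩

theorem shift_mem_openStrip (hz : 0 ≤ z 1) {s : ℝ} (h1 : a < st (z 0) + s)
    (h2 : st (z 0) + s < b) : shift z 0 (s : FermatReal) ∈ openStrip a b := by
  refine ⟨lt_of_st_lt ?_, lt_of_st_lt ?_, by simpa using hz⟩ <;> simpa

/-- The open strip also contains points infinitely close to its ends. There the admissible real
displacements may be one-sided, but they still fill an interval of positive length. -/
theorem uniqueDiffWithinAt_openStrip (hab : a < b) (hz : z ∈ openStrip a b) :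
    UniqueDiffWithinAt ℝ {s : ℝ | shift z 0 (s : FermatReal) ∈ openStrip a b} 0 := by
  obtain ⟨c, d, hcd, h0, h⟩ := exists_shift_mem hab hz.1.1 hz.2.1.1
  refine ((uniqueDiffOn_Icc hcd) 0 h0).mono fun s hs => ?_
  rcases eq_or_ne s 0 with rfl | hs0
  · show shift z 0 _ ∈ openStrip a b
    rwa [shift_zero]
  · exact shift_mem_openStrip hz.2.2 (h s hs hs0).1 (h s hs hs0).2

theorem uniqueDiffWithinAt_strip (hab : a < b) (hz : z ∈ strip a b) :
    UniqueDiffWithinAt ℝ {s : ℝ | shift z 0 (s : FermatReal) ∈ strip a b} 0 := by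
  obtain ⟨c, d, hcd, h0, h⟩ := exists_shift_mem hab hz.1 hz.2.1
  refine ((uniqueDiffOn_Icc hcd) 0 h0).mono fun s hs => ?_
  rcases eq_or_ne s 0 with rfl | hs0
  · show shift z 0 _ ∈ strip a b
    rwa [shift_zero]
  · exact openStrip_subset_strip (shift_mem_openStrip hz.2.2 (h s hs hs0).1 (h s hs hs0).2)

/-- One of the displacements `± t ^ r` stays in the strip. -/
theorem exists_shift_tpow_mem_strip (hab : a < b) (hz : z ∈ strip a b) {r : ℝ≥0} (hr : 0 < r) :
    ∃ ε : ℝ, ε ≠ 0 ∧ shift z 0 ((ε : FermatReal) * tpow r) ∈ strip a b := by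
  have hst : st (tpow r) = 0 := st_of_mem_growth (e := r) hr (tpow_mem_growth r.2 le_rfl)
  rcases (st_le_st hz.2.1).lt_or_eq with h | h
  · refine ⟨1, one_ne_zero, ?_, ?_, by simpa using hz.2.2⟩
    · rw [shift_apply_same, map_one, one_mul]
      exact le_add_of_nonneg hz.1 (zero_le_tpow r)
    · refine (lt_of_st_lt ?_).1
      simpa [hst] using h
  · refine ⟨-1, by norm_num, ?_, ?_, by simpa using hz.2.2⟩
    · refine (lt_of_st_lt ?_).1
      rw [st_coe] at h
      simpa [hst, h] using hab
    · rw [shift_apply_same, map_neg, map_one, neg_one_mul, ← sub_eq_add_neg]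
      exact sub_le_of_nonneg hz.2.1 (zero_le_tpow r)

end strip

end FermatReal

namespace FermatReal
open FermatReals

/-! ### Trigonometric functions -/

theorem contDiffAt_cos {s : ℝ} : ContDiffAt ℝ ∞ Real.cos s := Real.contDiff_cos.contDiffAt

theorem contDiffAt_sin {s : ℝ} : ContDiffAt ℝ ∞ Real.sin s := Real.contDiff_sin.contDiffAt

theorem ext₁_cos_sq_add_sin_sq (x : FermatReal) :
    ext₁ Real.cos x ^ 2 + ext₁ Real.sin x ^ 2 = 1 := by
  rw [sq, sq, ← ext₁_mul contDiffAt_cos contDiffAt_cos, ← ext₁_mul contDiffAt_sin contDiffAt_sin,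
    ← ext₁_add (contDiffAt_cos.mul contDiffAt_cos) (contDiffAt_sin.mul contDiffAt_sin)]
  have : (fun s => Real.cos s * Real.cos s + Real.sin s * Real.sin s) = fun _ => (1 : ℝ) := by
    ext s; rw [← sq, ← sq, Real.cos_sq_add_sin_sq]
  rw [this, ext₁_const, map_one]

theorem cos_pos_of_mem {s : ℝ} (hs : s ∈ Set.Ioo (-(Real.pi / 2)) (Real.pi / 2)) :
    0 < Real.cos s := Real.cos_pos_of_mem_Ioo hs

theorem ext₁_tan_mul_cos {x : FermatReal} (hx : Real.cos (st x) ≠ 0) :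
    ext₁ Real.tan x * ext₁ Real.cos x = ext₁ Real.sin x := by
  have h := Real.contDiffAt_tan (n := ∞).2 hx
  rw [← ext₁_mul h contDiffAt_cos]
  refine ext₁_congr ?_ (h.mul contDiffAt_cos)
  filter_upwards [Real.continuous_cos.continuousAt.eventually (isOpen_ne.mem_nhds hx)] with s hs
  exact Real.tan_mul_cos hs

theorem ext₁_cos_sq_mul_deriv_tan {x : FermatReal} (hx : Real.cos (st x) ≠ 0) :
    ext₁ Real.cos x ^ 2 * ext₁ (deriv Real.tan) x = 1 := by
  have h := contDiffAt_fderiv_apply (Real.contDiffAt_tan.2 hx) 1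
  rw [sq, ← ext₁_mul contDiffAt_cos contDiffAt_cos]
  have h2 : ContDiffAt ℝ ∞ (deriv Real.tan) (st x) := h
  rw [← ext₁_mul (contDiffAt_cos.mul contDiffAt_cos) h2]
  rw [← map_one (algebraMap ℝ FermatReal), ← ext₁_const 1 x]
  refine ext₁_congr ?_ ((contDiffAt_cos.mul contDiffAt_cos).mul h2)
  filter_upwards [Real.continuous_cos.continuousAt.eventually (isOpen_ne.mem_nhds hx)] with s hs
  have hs : Real.cos s ≠ 0 := hs
  rw [Real.deriv_tan]
  field_simp

theorem ext₁_arctan_tan {x : FermatReal}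
    (hx : st x ∈ Set.Ioo (-(Real.pi / 2)) (Real.pi / 2)) :
    ext₁ Real.arctan (ext₁ Real.tan x) = x := by
  have h := Real.contDiffAt_tan (n := ∞).2 (cos_pos_of_mem hx).ne'
  rw [ext₁_ext₁ h Real.contDiff_arctan.contDiffAt]
  conv_rhs => rw [← ext₁_id x]
  refine ext₁_congr ?_ (Real.contDiff_arctan.contDiffAt.comp (st x) h)
  filter_upwards [isOpen_Ioo.mem_nhds hx] with s hs
  exact Real.arctan_tan hs.1 hs.2

/-- The angle between the `x` axis and a vector with positive first coordinate. -/
noncomputable def angle (v : Fin 2 → FermatReal) : FermatReal :=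
  ext (fun q => Real.arctan (q 1 / q 0)) v

theorem contDiffAt_arctan_div {q : Fin 2 → ℝ} (hq : q 0 ≠ 0) :
    ContDiffAt ℝ ∞ (fun q : Fin 2 → ℝ => Real.arctan (q 1 / q 0)) q := by
  have h : ContDiffAt ℝ ∞ (fun q : Fin 2 → ℝ => q 1 / q 0) q :=
    ContDiffAt.div (by fun_prop) (by fun_prop) hq
  exact Real.contDiff_arctan.contDiffAt.comp q h

/-! ### Unit tangents and their angles -/

section vector

variable {v τ : Fin 2 → FermatReal} {φ : FermatReal}

theorem st_angle_mem (hv : st (v 0) ≠ 0) :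
    st (angle v) ∈ Set.Ioo (-(Real.pi / 2)) (Real.pi / 2) := by
  rw [angle, st_ext (contDiffAt_arctan_div (q := stv v) hv)]
  exact Real.arctan_mem_Ioo _

theorem eq_mul_tan_angle (hv : st (v 0) ≠ 0) : v 1 = v 0 * ext₁ Real.tan (angle v) := by
  have h1 := contDiffAt_arctan_div (q := stv v) hv
  have h2 : ContDiffAt ℝ ∞ Real.tan (Real.arctan (stv v 1 / stv v 0)) :=
    Real.contDiffAt_tan.2 (Real.cos_arctan_pos _).ne'
  have h3 : ContDiffAt ℝ ∞ (fun q : Fin 2 → ℝ => Real.tan (Real.arctan (q 1 / q 0))) (stv v) :=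
    ContDiffAt.comp (g := Real.tan) (stv v) h2 h1
  rw [angle, ext₁_ext h1 h2]
  conv_lhs => rw [← ext_coord (x := v) 1]
  conv_rhs => enter [1]; rw [← ext_coord (x := v) 0]
  rw [← ext_mul (by fun_prop) h3]
  refine ext_congr ?_ (by fun_prop)
  have hc : ContinuousAt (fun q : Fin 2 → ℝ => q 0) (stv v) := continuousAt_apply 0 _
  filter_upwards [hc.eventually (isOpen_ne.mem_nhds hv)] with q hq
  have hq : q 0 ≠ 0 := hq
  rw [Real.tan_arctan]
  field_simp

theorem eq_angle (hv : st (v 0) ≠ 0) (hφ : st φ ∈ Set.Ioo (-(Real.pi / 2)) (Real.pi / 2))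
    (h : v 1 = v 0 * ext₁ Real.tan φ) : φ = angle v := by
  rw [eq_mul_tan_angle hv] at h
  have h1 := (isUnit_of_st_ne_zero hv).mul_left_cancel h
  rw [← ext₁_arctan_tan hφ, ← h1, ext₁_arctan_tan (st_angle_mem hv)]

/-- `v = s τ` with `s > 0` invertible, and `τ` is a unit vector. -/
def IsDirection (v τ : Fin 2 → FermatReal) : Prop :=
  (∃ s : FermatReal, 0 < s ∧ IsUnit s ∧ ∀ i, v i = s * τ i) ∧ τ 0 ^ 2 + τ 1 ^ 2 = 1

theorem st_pos_of_isUnit {s : FermatReal} (h : 0 < s) (hs : IsUnit s) : 0 < st s := by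
  have h1 := st_le_st h.1
  rw [map_zero] at h1
  exact lt_of_le_of_ne h1 (isUnit_iff hs).symm

/-- Both scales have square `v 0 ^ 2 + v 1 ^ 2`. Their sum has positive standard part, so it is a
unit and can be cancelled from `(s - r) * (s + r) = 0` despite the nilpotents. -/
theorem IsDirection.unique {σ : Fin 2 → FermatReal} (h : IsDirection v τ) (h' : IsDirection v σ) :
    τ = σ := by
  obtain ⟨⟨s, hs, hsu, hsv⟩, h1⟩ := h
  obtain ⟨⟨r, hr, hru, hrv⟩, h2⟩ := h'
  have h3 : (s - r) * (s + r) = 0 := by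
    have e1 : s ^ 2 = v 0 ^ 2 + v 1 ^ 2 := by
      rw [hsv, hsv, mul_pow, mul_pow, ← mul_add, h1, mul_one]
    have e2 : r ^ 2 = v 0 ^ 2 + v 1 ^ 2 := by
      rw [hrv, hrv, mul_pow, mul_pow, ← mul_add, h2, mul_one]
    linear_combination e1 - e2
  have h4 : IsUnit (s + r) := isUnit_of_st_ne_zero (by
    rw [map_add]
    exact (add_pos (st_pos_of_isUnit hs hsu) (st_pos_of_isUnit hr hru)).ne')
  have h5 : s = r := sub_eq_zero.1 (h4.mul_left_eq_zero.1 h3)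
  subst h5
  ext i
  exact hsu.mul_left_cancel ((hsv i).symm.trans (hrv i))

theorem isDirection_cos_sin (hv : 0 < st (v 0)) :
    IsDirection v ![ext₁ Real.cos (angle v), ext₁ Real.sin (angle v)] := by
  have h1 := st_angle_mem hv.ne'
  have hc := cos_pos_of_mem h1
  have h2 : st (ext₁ Real.cos (angle v)) = Real.cos (st (angle v)) := st_ext₁ contDiffAt_cos
  have h3 : IsUnit (ext₁ Real.cos (angle v)) := isUnit_of_st_ne_zero (by rw [h2]; exact hc.ne')
  -- `c` is the inverse of `cos (angle v)`, and `v 0 * c` is the length of `v`.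
  obtain ⟨c, hcu⟩ := h3.exists_left_inv
  have h4 : st c * Real.cos (st (angle v)) = 1 := by
    rw [← h2, ← map_mul, hcu, map_one]
  have h5 : 0 < st c := by
    by_contra! h
    nlinarith
  have h6 : 0 < st (v 0 * c) := by rw [map_mul]; positivity
  refine ⟨⟨v 0 * c, lt_of_st_lt (by rwa [map_zero]), isUnit_of_st_ne_zero h6.ne', fun i => ?_⟩,
    ext₁_cos_sq_add_sin_sq _⟩
  fin_cases i
  · show v 0 = v 0 * c * ext₁ Real.cos (angle v)
    rw [mul_assoc, hcu, mul_one]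
  · show v 1 = v 0 * c * ext₁ Real.sin (angle v)
    rw [← ext₁_tan_mul_cos hc.ne', eq_mul_tan_angle hv.ne']
    linear_combination (-(v 0) * ext₁ Real.tan (angle v)) * hcu

/-- Positivity of the first component forces `cos (st φ) > 0`, which narrows `[-π, π]` to the open
interval on which the tangent determines the angle. -/
theorem IsDirection.angle_spec (h : IsDirection v τ) (hv : 0 < st (v 0)) (hφ : IsAngle τ φ) :
    st φ ∈ Set.Ioo (-(Real.pi / 2)) (Real.pi / 2) ∧ v 1 = v 0 * ext₁ Real.tan φ := by
  obtain ⟨⟨s, hs, hsu, hsv⟩, h1⟩ := h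
  obtain ⟨hπ, hπ', hcos, hsin⟩ := hφ
  have hc : 0 < Real.cos (st φ) := by
    have e1 := hsv 0
    have e2 : st (ext₁ Real.cos φ) = Real.cos (st φ) := st_ext₁ contDiffAt_cos
    rw [hcos] at e1
    rw [e1, map_mul, e2] at hv
    exact pos_of_mul_pos_right hv (st_pos_of_isUnit hs hsu).le
  have h2 : -Real.pi ≤ st φ := by simpa using st_le_st hπ.1
  have h3 : st φ ≤ Real.pi := by simpa using st_le_st hπ'
  refine ⟨⟨?_, ?_⟩, ?_⟩
  · by_contra! h
    have := Real.cos_nonpos_of_pi_div_two_le_of_le (x := -st φ) (by linarith) (by linarith)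
    rw [Real.cos_neg] at this
    linarith
  · by_contra! h
    have := Real.cos_nonpos_of_pi_div_two_le_of_le (x := st φ) h (by linarith)
    linarith
  · rw [hsv, hsv, hcos, hsin, ← ext₁_tan_mul_cos hc.ne']
    ring

theorem IsDirection.existsUnique_angle (h : IsDirection v τ) (hv : 0 < st (v 0)) :
    ∃! φ, IsAngle τ φ := by
  have h1 := st_angle_mem hv.ne'
  refine ⟨angle v, ?_, fun φ hφ => ?_⟩
  · rw [h.unique (isDirection_cos_sin hv)]
    have hpi := Real.pi_pos
    refine ⟨lt_of_st_lt ?_, (lt_of_st_lt ?_).1, rfl, rfl⟩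
    · rw [st_coe]; linarith [h1.1]
    · rw [st_coe]; linarith [h1.2]
  · obtain ⟨h2, h3⟩ := h.angle_spec hv hφ
    exact eq_angle hv.ne' h2 h3

end vector

end FermatReal

/-! ### Primitives of smooth functions with parameters -/

section

open MeasureTheory
open scoped Convolution

/-- Convolution with the Heaviside function `θ` is integration from `-∞`. The common compact support
`K` gives joint smoothness in the parameter and the variable. -/
theorem exists_contDiffOn_primitive {P : Type*} [NormedAddCommGroup P] [NormedSpace ℝ P]
    {U : Set P} (hU : IsOpen U) {h : P → ℝ → ℝ}
    (hh : ContDiffOn ℝ ∞ (Function.uncurry h) (U ×ˢ Set.univ)) {K : Set ℝ} (hK : IsCompact K)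
    (hsupp : ∀ p ∈ U, ∀ x ∉ K, h p x = 0) :
    ∃ H : P → ℝ → ℝ, ContDiffOn ℝ ∞ (Function.uncurry H) (U ×ˢ Set.univ) ∧
      ∀ p ∈ U, ∀ x, HasDerivAt (H p) (h p x) x := by
  set θ : ℝ → ℝ := (Set.Ioi 0).indicator 1 with hθ
  have hloc : LocallyIntegrable θ volume :=
    (locallyIntegrable_const (1 : ℝ)).indicator measurableSet_Ioi
  refine ⟨fun p x => (θ ⋆[ContinuousLinearMap.mul ℝ ℝ, volume] h p) x,
    contDiffOn_convolution_right_with_param (n := ⊤) _ hU hK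
      (fun p x hp hx => hsupp p hp x hx) hloc hh, fun p hp x => ?_⟩
  have hcont : Continuous (h p) := by
    have h1 : Continuous fun x : ℝ => (p, x) := by fun_prop
    exact hh.continuousOn.comp_continuous h1 fun x => ⟨hp, trivial⟩
  have hint : Integrable (h p) := hcont.integrable_of_hasCompactSupport
    (HasCompactSupport.intro hK fun x hx => hsupp p hp x hx)
  have h1 : ∀ x, (θ ⋆[ContinuousLinearMap.mul ℝ ℝ, volume] h p) x
      = (∫ y in Set.Iic 0, h p y) + ∫ y in (0 : ℝ)..x, h p y := by
    intro x
    rw [convolution_eq_swap, ← intervalIntegral.integral_Iic_sub_Iic hint.integrableOn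
      hint.integrableOn, add_sub_cancel, integral_Iic_eq_integral_Iio,
      ← integral_indicator measurableSet_Iio]
    congr 1
    ext y
    by_cases hy : y < x
    · simp [hθ, hy]
    · simp [hθ, hy]
  refine HasDerivAt.congr_of_eventuallyEq ?_ (Eventually.of_forall h1)
  exact (intervalIntegral.integral_hasDerivAt_right (hcont.intervalIntegrable _ _)
    (hcont.stronglyMeasurableAtFilter _ _) hcont.continuousAt).const_add _

end

namespace FermatReal
open FermatReals

/-! ### Standard points of the interval and the mean value theorem -/

theorem vec_eq (z : Fin 1 → FermatReal) : ![z 0] = z := by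
  ext i; fin_cases i; rfl

theorem coe_le_coe {r s : ℝ} (h : r ≤ s) : (r : FermatReal) ≤ (s : FermatReal) := by
  have := le_add_of_nonneg (le_refl' (r : FermatReal)) (coe_nonneg (sub_nonneg.2 h))
  rwa [← map_add, add_sub_cancel] at this

theorem vec_mem_seg {a b s : ℝ} (hs : s ∈ Set.Icc a b) : ![(s : FermatReal)] ∈ seg a b :=
  ⟨coe_le_coe hs.1, coe_le_coe hs.2⟩

theorem HasPartial.hasDerivWithinAt_Icc {a b s : ℝ} (hs : s ∈ Set.Icc a b)
    {F : (Fin 1 → FermatReal) → FermatReal} {v : FermatReal}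
    (h : HasPartial (seg a b) F 0 ![(s : FermatReal)] v) (ℓ : FermatReal →ₗ[ℝ] ℝ) :
    HasDerivWithinAt (fun r : ℝ => ℓ (F ![(r : FermatReal)])) (ℓ v) (Set.Icc a b) s := by
  have h1 := h.hasDerivWithinAt (vec_mem_seg hs) ℓ
  have hshift : ∀ r : ℝ, shift ![(s : FermatReal)] 0 (r : FermatReal)
      = ![((s + r : ℝ) : FermatReal)] := fun r => by
    ext i; fin_cases i; simp [shift]
  simp only [hshift] at h1
  have h2 : HasDerivWithinAt (fun r : ℝ => r - s) 1 (Set.Icc a b) s :=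
    (hasDerivWithinAt_id s _).sub_const s
  have h3 := HasDerivWithinAt.comp_of_eq s h1 h2 (fun r hr => ?_) (sub_self s).symm
  · simpa [Function.comp_def] using h3
  · show ![((s + (r - s) : ℝ) : FermatReal)] ∈ seg a b
    rw [add_sub_cancel]
    exact vec_mem_seg hr

/-- The mean value theorem modulo an ideal. -/
theorem sub_sub_sub_mem_of_hasPartial {a b : ℝ} (hab : a < b)
    {F F' : (Fin 1 → FermatReal) → FermatReal} {v v' : FermatReal → FermatReal}
    (h : ∀ z ∈ seg a b, HasPartial (seg a b) F 0 z (v (z 0)))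
    (h' : ∀ z ∈ seg a b, HasPartial (seg a b) F' 0 z (v' (z 0))) (K : Ideal FermatReal)
    (hK : ∀ s ∈ Set.Ioo a b, v (s : FermatReal) - v' (s : FermatReal) ∈ K) :
    (F ![(b : FermatReal)] - F' ![(b : FermatReal)])
      - (F ![(a : FermatReal)] - F' ![(a : FermatReal)]) ∈ K := by
  by_contra hv
  obtain ⟨ℓ, h1, h2⟩ := Submodule.exists_le_ker_of_notMem (p := K.restrictScalars ℝ) hv
  refine h1 ?_
  have hd : ∀ s ∈ Set.Icc a b, HasDerivWithinAt
      (fun r : ℝ => ℓ (F ![(r : FermatReal)]) - ℓ (F' ![(r : FermatReal)]))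
      (ℓ (v (s : FermatReal)) - ℓ (v' (s : FermatReal))) (Set.Icc a b) s := fun s hs =>
    ((h _ (vec_mem_seg hs)).hasDerivWithinAt_Icc hs ℓ).sub
      ((h' _ (vec_mem_seg hs)).hasDerivWithinAt_Icc hs ℓ)
  -- The real mean value theorem for `ℓ (F - F')`; its derivative vanishes at standard points
  -- because `ℓ` kills `K`.
  obtain ⟨c, hc, hslope⟩ := exists_hasDerivAt_eq_slope _ _ hab
    (fun s hs => (hd s hs).continuousWithinAt)
    (fun s hs => (hd s (Set.Ioo_subset_Icc_self hs)).hasDerivAt (Icc_mem_nhds hs.1 hs.2))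
  have h3 : ℓ (v (c : FermatReal) - v' (c : FermatReal)) = 0 := h2 (hK c hc)
  rw [map_sub] at h3
  rw [h3, eq_comm, div_eq_zero_iff] at hslope
  simp only [map_sub]
  exact hslope.resolve_right (sub_ne_zero.2 hab.ne')

/-! ### Primitives on an interval -/

/-- `q ↦ h (q₁, …, q_k) (q_{k+1})`. -/
def uncurrySum {κ : Type} (h : (κ → ℝ) → ℝ → ℝ) (q : κ ⊕ Fin 1 → ℝ) : ℝ :=
  h (q ∘ Sum.inl) (q (Sum.inr 0))

theorem contDiffAt_uncurrySum {κ : Type} [Fintype κ] {h : (κ → ℝ) → ℝ → ℝ} {q : κ ⊕ Fin 1 → ℝ}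
    (hh : ContDiffAt ℝ ∞ (Function.uncurry h) (q ∘ Sum.inl, q (Sum.inr 0))) :
    ContDiffAt ℝ ∞ (uncurrySum h) q := by
  have h1 : ContDiffAt ℝ ∞ (fun q : κ ⊕ Fin 1 → ℝ => (q ∘ Sum.inl, q (Sum.inr 0))) q := by
    refine ContDiffAt.prodMk (contDiffAt_pi.2 fun i => ?_) (by fun_prop)
    exact contDiffAt_apply ℝ ℝ (Sum.inl i) q
  exact ContDiffAt.comp (g := Function.uncurry h)
    (f := fun q : κ ⊕ Fin 1 → ℝ => (q ∘ Sum.inl, q (Sum.inr 0))) q hh h1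

/-- `χ f` has a smooth form `h(p, -)` on the whole interval, where `χ` is a cutoff function that is
`1` near `S`. -/
def HasCutoffForm (a b : ℝ) (f : (Fin 1 → FermatReal) → FermatReal) (S : Set ℝ) : Prop :=
  ∃ χ : ℝ → ℝ, ContDiff ℝ ∞ χ ∧ (∀ s ∈ S, χ =ᶠ[𝓝 s] fun _ => 1) ∧
    ∃ (κ : Type) (_ : Fintype κ) (p : κ → FermatReal) (U : Set (κ → ℝ)) (h : (κ → ℝ) → ℝ → ℝ),
      IsOpen U ∧ stv p ∈ U ∧ ContDiffOn ℝ ∞ (Function.uncurry h) (U ×ˢ Set.univ) ∧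
      ∀ z ∈ seg a b, ext₁ χ (z 0) * f z = ext (uncurrySum h) (Sum.elim p z)

variable {a b : ℝ} {f : (Fin 1 → FermatReal) → FermatReal}

theorem hasCutoffForm_empty : HasCutoffForm a b f ∅ := by
  refine ⟨fun _ => 0, contDiff_const, by simp, Fin 0, inferInstance, Fin.elim0, Set.univ,
    fun _ _ => 0, isOpen_univ, trivial, contDiffOn_const, fun z _ => ?_⟩
  rw [ext₁_const, map_zero, zero_mul]
  exact (((ext_const (x := Sum.elim Fin.elim0 z) 0)).trans (map_zero _)).symm

theorem HasCutoffForm.mono {S S' : Set ℝ} (hS : S ⊆ S') (h : HasCutoffForm a b f S') :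
    HasCutoffForm a b f S := by
  obtain ⟨χ, hχ, h1, h⟩ := h
  exact ⟨χ, hχ, fun s hs => h1 s (hS hs), h⟩

theorem contDiffAt_of_contDiffOn_prod {P : Type*} [NormedAddCommGroup P] [NormedSpace ℝ P]
    {U : Set P} (hU : IsOpen U) {h : P × ℝ → ℝ} (hh : ContDiffOn ℝ ∞ h (U ×ˢ Set.univ)) {p : P}
    (hp : p ∈ U) (x : ℝ) : ContDiffAt ℝ ∞ h (p, x) :=
  hh.contDiffAt ((hU.prod isOpen_univ).mem_nhds ⟨hp, trivial⟩)

/-- The cutoff `χ + (1 - χ) * χ'` is `1` wherever `χ` or `χ'` is, and the two lists of parameters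
are concatenated. -/
theorem HasCutoffForm.union {S S' : Set ℝ} (h : HasCutoffForm a b f S)
    (h' : HasCutoffForm a b f S') : HasCutoffForm a b f (S ∪ S') := by
  obtain ⟨χ, hχ, hS, κ, _, p, U, g, hU, hp, hg, hf⟩ := h
  obtain ⟨χ', hχ', hS', κ', _, p', U', g', hU', hp', hg', hf'⟩ := h'
  have hc1 : Continuous fun q : κ ⊕ κ' → ℝ => q ∘ Sum.inl := by fun_prop
  have hc2 : Continuous fun q : κ ⊕ κ' → ℝ => q ∘ Sum.inr := by fun_prop
  have hd1 : ContDiff ℝ ∞ fun q : (κ ⊕ κ' → ℝ) × ℝ => (q.1 ∘ Sum.inl, q.2) :=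
    (contDiff_pi.2 fun i => (contDiff_apply ℝ ℝ (Sum.inl i)).comp contDiff_fst).prodMk contDiff_snd
  have hd2 : ContDiff ℝ ∞ fun q : (κ ⊕ κ' → ℝ) × ℝ => (q.1 ∘ Sum.inr, q.2) :=
    (contDiff_pi.2 fun i => (contDiff_apply ℝ ℝ (Sum.inr i)).comp contDiff_fst).prodMk contDiff_snd
  refine ⟨fun s => χ s + (1 - χ s) * χ' s, hχ.add ((contDiff_const.sub hχ).mul hχ'), ?_,
    κ ⊕ κ', inferInstance, Sum.elim p p',
    {q | q ∘ Sum.inl ∈ U ∧ q ∘ Sum.inr ∈ U'},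
    fun q x => g (q ∘ Sum.inl) x + (1 - χ x) * g' (q ∘ Sum.inr) x,
    (hU.preimage hc1).inter (hU'.preimage hc2), ⟨hp, hp'⟩, ?_, fun z hz => ?_⟩
  · rintro s (hs | hs)
    · filter_upwards [hS s hs] with r hr
      rw [hr]; ring
    · filter_upwards [hS' s hs] with r hr
      rw [hr]; ring
  · refine ContDiffOn.add (hg.comp hd1.contDiffOn fun q hq => ⟨hq.1.1, trivial⟩) ?_
    refine ContDiffOn.mul ?_ (hg'.comp hd2.contDiffOn fun q hq => ⟨hq.1.2, trivial⟩)
    exact (contDiff_const.sub (hχ.comp contDiff_snd)).contDiffOn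
  · set x : (κ ⊕ κ') ⊕ Fin 1 → FermatReal := Sum.elim (Sum.elim p p') z with hx
    set σ : κ ⊕ Fin 1 → (κ ⊕ κ') ⊕ Fin 1 := Sum.elim (fun i => Sum.inl (Sum.inl i)) Sum.inr
    set σ' : κ' ⊕ Fin 1 → (κ ⊕ κ') ⊕ Fin 1 := Sum.elim (fun i => Sum.inl (Sum.inr i)) Sum.inr
    have hxσ : Sum.elim p z = fun i => x (σ i) := by ext i; cases i <;> rfl
    have hxσ' : Sum.elim p' z = fun i => x (σ' i) := by ext i; cases i <;> rfl
    have e1 : ext (uncurrySum g) (Sum.elim p z) = ext (fun q => uncurrySum g (q ∘ σ)) x := by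
      rw [hxσ]; rfl
    have e2 : ext (uncurrySum g') (Sum.elim p' z) = ext (fun q => uncurrySum g' (q ∘ σ')) x := by
      rw [hxσ']; rfl
    have e3 : ext₁ (fun s => 1 - χ s) (z 0) = ext (fun q => 1 - χ (q (Sum.inr 0))) x := rfl
    have s1 : ContDiffAt ℝ ∞ (fun q => uncurrySum g (q ∘ σ)) (stv x) := by
      have : ContDiffAt ℝ ∞ (uncurrySum g) (stv x ∘ σ) :=
        contDiffAt_uncurrySum (contDiffAt_of_contDiffOn_prod hU hg hp _)
      exact ContDiffAt.comp (g := uncurrySum g) (f := fun q : (κ ⊕ κ') ⊕ Fin 1 → ℝ => q ∘ σ) _ this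
        (contDiffAt_pi.2 fun i => contDiffAt_apply ℝ ℝ _ _)
    have s2 : ContDiffAt ℝ ∞ (fun q => uncurrySum g' (q ∘ σ')) (stv x) := by
      have : ContDiffAt ℝ ∞ (uncurrySum g') (stv x ∘ σ') :=
        contDiffAt_uncurrySum (contDiffAt_of_contDiffOn_prod hU' hg' hp' _)
      exact ContDiffAt.comp (g := uncurrySum g') (f := fun q : (κ ⊕ κ') ⊕ Fin 1 → ℝ => q ∘ σ') _
        this (contDiffAt_pi.2 fun i => contDiffAt_apply ℝ ℝ _ _)
    have s3 : ContDiffAt ℝ ∞ (fun q => 1 - χ (q (Sum.inr 0))) (stv x) :=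
      contDiffAt_const.sub (hχ.contDiffAt.comp _ (contDiffAt_apply ℝ ℝ _ _))
    have e4 : ext₁ (fun s => 1 - χ s) (z 0) = 1 - ext₁ χ (z 0) := by
      rw [← map_one (algebraMap ℝ FermatReal), ← ext₁_const 1 (z 0)]
      exact ext_sub contDiffAt_const (contDiffAt_eval hχ.contDiffAt)
    rw [ext₁_add hχ.contDiffAt (contDiffAt_const.sub hχ.contDiffAt |>.mul hχ'.contDiffAt),
      ext₁_mul (contDiffAt_const.sub hχ.contDiffAt) hχ'.contDiffAt, add_mul, mul_assoc, hf z hz,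
      hf' z hz, e1, e2, e3, ← ext_mul s3 s2, ← ext_add s1 (s3.mul s2)]
    rfl

/-- A bump function supported where the local form is valid lets the product be extended by zero to
the whole line. -/
theorem hasCutoffForm_of_isLocalForm {s : ℝ} {κ : Type} [Fintype κ] {p : κ → FermatReal}
    {g : (κ ⊕ Fin 1 → ℝ) → ℝ} (h : IsLocalForm (seg a b) f ![(s : FermatReal)] p g) :
    ∃ t ∈ 𝓝 s, HasCutoffForm a b f t := by
  have hc : Continuous fun q : (κ → ℝ) × ℝ => Sum.elim q.1 (fun _ : Fin 1 => q.2) := by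
    refine continuous_pi fun i => ?_
    cases i <;> simp only [Sum.elim_inl, Sum.elim_inr] <;> fun_prop
  have hc' : Continuous fun (y : ℝ) (_ : Fin 1) => y := by fun_prop
  have hst : stv ![(s : FermatReal)] = fun _ => s := by ext i; fin_cases i; simp [stv]
  obtain ⟨h1, h2⟩ := h
  rw [stv_elim, hst] at h1
  rw [hst] at h2
  have h1' := (hc.tendsto (stv p, s)).eventually h1
  have h2' := (hc'.tendsto s).eventually h2
  obtain ⟨ε, hε, h3⟩ := Metric.eventually_nhds_iff_ball.1 h2'
  rw [nhds_prod_eq, eventually_prod_iff] at h1'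
  obtain ⟨P, hP, Q, hQ, h4⟩ := h1'
  obtain ⟨U, hUP, hU, hpU⟩ := eventually_nhds_iff.1 hP
  obtain ⟨ε', hε', h5⟩ := Metric.eventually_nhds_iff_ball.1 hQ
  set r := min ε ε' with hr
  have hr0 : 0 < r := lt_min hε hε'
  -- Equal to `1` on the ball of radius `r / 4`; its support, of radius `r / 2`, stays inside the
  -- ball of radius `r` of validity.
  let χ : ContDiffBump s := ⟨r / 4, r / 2, by positivity, by linarith⟩
  have hχ0 : ∀ y ∉ Metric.ball s r, (χ : ℝ → ℝ) =ᶠ[𝓝 y] fun _ => 0 := by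
    intro y hy
    have : y ∉ tsupport χ := by
      rw [χ.tsupport_eq]
      intro h
      exact hy (Metric.closedBall_subset_ball (show r / 2 < r by linarith) h)
    exact notMem_tsupport_iff_eventuallyEq.1 this
  refine ⟨Metric.ball s (r / 4), Metric.ball_mem_nhds s (by positivity), χ, χ.contDiff, ?_,
    κ, inferInstance, p, U, fun q y => χ y * g (Sum.elim q fun _ => y), hU, hpU, ?_, ?_⟩
  · intro y hy
    filter_upwards [Metric.isOpen_ball.mem_nhds hy] with w hw
    exact χ.one_of_mem_closedBall (Metric.ball_subset_closedBall hw)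
  · rintro ⟨q, y⟩ ⟨hq, -⟩
    refine ContDiffAt.contDiffWithinAt ?_
    by_cases hy : y ∈ Metric.ball s r
    · have h6 : ContDiffAt ℝ ∞ g (Sum.elim q fun _ => y) :=
        h4 (hUP q hq) (h5 y (Metric.ball_subset_ball (min_le_right _ _) hy))
      have h7 : ContDiffAt ℝ ∞ (fun w : (κ → ℝ) × ℝ => Sum.elim w.1 (fun _ : Fin 1 => w.2)) (q, y) := by
        refine contDiffAt_pi.2 fun i => ?_
        rcases i with i | i
        · exact ((contDiff_apply ℝ ℝ i).comp contDiff_fst).contDiffAt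
        · exact contDiffAt_snd
      exact ((χ.contDiff (n := ⊤)).comp contDiff_snd).contDiffAt.mul (ContDiffAt.comp (q, y) h6 h7)
    · have h8 : (Function.uncurry fun (q : κ → ℝ) (y : ℝ) => χ y * g (Sum.elim q fun _ => y))
          =ᶠ[𝓝 (q, y)] fun _ => 0 := by
        filter_upwards [(continuous_snd.tendsto (q, y)).eventually (hχ0 y hy)] with w hw
        show χ w.2 * _ = 0
        rw [hw, zero_mul]
      exact contDiffAt_const.congr_of_eventuallyEq h8
  · intro z hz
    have hzs : stv z = fun _ => st (z 0) := by ext i; fin_cases i; rfl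
    have hχs : ContDiffAt ℝ ∞ (fun q : κ ⊕ Fin 1 → ℝ => χ (q (Sum.inr 0))) (stv (Sum.elim p z)) :=
      (χ.contDiff (n := ⊤)).contDiffAt.comp _ (contDiffAt_apply ℝ ℝ _ _)
    have hun : uncurrySum (fun q y => χ y * g (Sum.elim q fun _ => y))
        = fun q : κ ⊕ Fin 1 → ℝ => χ (q (Sum.inr 0)) * g q := by
      ext q
      show _ * g _ = _
      congr 2
      ext i
      rcases i with i | i
      · rfl
      · fin_cases i; rfl
    rw [hun]
    by_cases hy : st (z 0) ∈ Metric.ball s r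
    · have h6 : ContDiffAt ℝ ∞ g (stv (Sum.elim p z)) := by
        rw [stv_elim, hzs]
        exact h4 (hUP _ hpU) (h5 _ (Metric.ball_subset_ball (min_le_right _ _) hy))
      rw [ext_mul hχs h6, ← h3 _ (Metric.ball_subset_ball (min_le_left _ _) hy) z hz hzs]
      rfl
    · have h7 : ext₁ χ (z 0) = 0 := by
        rw [ext₁_congr (hχ0 _ hy) χ.contDiff.contDiffAt, ext₁_const, map_zero]
      rw [h7, zero_mul]
      have h8 : (fun _ : κ ⊕ Fin 1 → ℝ => (0 : ℝ)) =ᶠ[𝓝 (stv (Sum.elim p z))]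
          fun q => χ (q (Sum.inr 0)) * g q := by
        have hc : Tendsto (fun q : κ ⊕ Fin 1 → ℝ => q (Sum.inr 0)) (𝓝 (stv (Sum.elim p z)))
          (𝓝 (st (z 0))) := (continuous_apply (Sum.inr (0 : Fin 1))).tendsto _
        filter_upwards [hc.eventually (hχ0 _ hy)] with q hq
        rw [hq, zero_mul]
      rw [← ext_congr h8 contDiffAt_const, ext_const, map_zero]

/-- Local forms at different points may use unrelated parameters; compactness needs only finitely
many, so the combined parameter space stays finite-dimensional. -/
theorem hasCutoffForm_Icc (hf : ∀ z ∈ seg a b, ∃ (κ : Type) (_ : Fintype κ) (p : κ → FermatReal)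
    (g : (κ ⊕ Fin 1 → ℝ) → ℝ), IsLocalForm (seg a b) f z p g) :
    HasCutoffForm a b f (Set.Icc a b) := by
  refine isCompact_Icc.induction_on hasCutoffForm_empty (fun _ _ h => HasCutoffForm.mono h)
    (fun _ _ => HasCutoffForm.union) fun s hs => ?_
  obtain ⟨κ, _, p, g, h⟩ := hf _ (vec_mem_seg hs)
  obtain ⟨t, ht, h'⟩ := hasCutoffForm_of_isLocalForm h
  exact ⟨t, mem_nhdsWithin_of_mem_nhds ht, h'⟩

theorem st_mem_Icc {z : Fin 1 → FermatReal} (hz : z ∈ seg a b) : st (z 0) ∈ Set.Icc a b :=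
  ⟨by simpa using st_le_st hz.1, by simpa using st_le_st hz.2⟩

/-- Existence of the integral. -/
theorem exists_hasIntegral (hab : a < b) {f : FermatReal → FermatReal}
    (hf : ∀ z ∈ seg a b, ∃ (κ : Type) (_ : Fintype κ) (p : κ → FermatReal)
      (g : (κ ⊕ Fin 1 → ℝ) → ℝ), IsLocalForm (seg a b) (fun z => f (z 0)) z p g) :
    ∃ L, HasIntegral a b f L := by
  classical
  obtain ⟨χ, hχ, hχ1, κ, _, p, U, h, hU, hp, hh, hfh⟩ := hasCutoffForm_Icc hf
  -- A second cutoff gives `h` compact support in `x`. The radius `b - a` exceeds the half-length,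
  -- so `ψ` is `1` near each point of `[a, b]`.
  let ψ : ContDiffBump ((a + b) / 2) := ⟨b - a, 2 * (b - a), by linarith, by linarith⟩
  have hψ1 : ∀ s ∈ Set.Icc a b, (ψ : ℝ → ℝ) =ᶠ[𝓝 s] fun _ => 1 := by
    intro s hs
    have : s ∈ Metric.ball ((a + b) / 2) (b - a) := by
      rw [Metric.mem_ball, Real.dist_eq, abs_lt]
      constructor <;> linarith [hs.1, hs.2]
    filter_upwards [Metric.isOpen_ball.mem_nhds this] with w hw
    exact ψ.one_of_mem_closedBall (Metric.ball_subset_closedBall hw)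
  obtain ⟨H, hH, hHd⟩ := exists_contDiffOn_primitive hU (h := fun q x => ψ x * h q x)
    (((ψ.contDiff (n := ⊤)).comp contDiff_snd).contDiffOn.mul hh)
    (isCompact_closedBall ((a + b) / 2) (2 * (b - a)))
    (fun q _ x hx => by
      rw [ψ.zero_of_le_dist (le_of_lt (not_le.1 hx)), zero_mul])
  set H₀ : (κ → ℝ) → ℝ → ℝ := fun q x => H q x - H q a with hH₀
  have hH₀s : ∀ q ∈ U, ∀ x, ContDiffAt ℝ ∞ (Function.uncurry H₀) (q, x) := fun q hq x => by
    refine (contDiffAt_of_contDiffOn_prod hU hH hq x).sub ?_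
    exact ContDiffAt.comp (g := Function.uncurry H) (f := fun w : (κ → ℝ) × ℝ => (w.1, a)) (q, x)
      (contDiffAt_of_contDiffOn_prod hU hH hq a) (contDiffAt_fst.prodMk contDiffAt_const)
  have hopen : ∀ z : Fin 1 → FermatReal, ∀ᶠ q in 𝓝 (stv (Sum.elim p z)), q ∘ Sum.inl ∈ U := by
    intro z
    have hc : Continuous fun q : κ ⊕ Fin 1 → ℝ => q ∘ Sum.inl := by fun_prop
    exact (hc.tendsto _).eventually (hU.mem_nhds hp)
  have hform : ∀ z ∈ seg a b, IsLocalForm (seg a b)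
      (fun z => ext (uncurrySum H₀) (Sum.elim p z)) z p (uncurrySum H₀) := fun z _ =>
    ⟨(hopen z).mono fun q hq => contDiffAt_uncurrySum (hH₀s _ hq _),
      Eventually.of_forall fun _ _ _ _ => rfl⟩
  refine ⟨_, fun z => ext (uncurrySum H₀) (Sum.elim p z),
    smoothOn_of_isLocalForm fun z hz => ⟨κ, inferInstance, p, _, hform z hz⟩, fun z hz => ?_,
    ?_, rfl⟩
  · convert (hform z hz).hasPartial 0 using 1
    have hz0 := st_mem_Icc hz
    have e1 : ext₁ χ (z 0) = 1 := by
      rw [ext₁_congr (hχ1 _ hz0) hχ.contDiffAt, ext₁_const, map_one]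
    have hs : ContDiffAt ℝ ∞ (uncurrySum h) (stv (Sum.elim p z)) :=
      contDiffAt_uncurrySum (contDiffAt_of_contDiffOn_prod hU hh hp _)
    have e2 := hfh z hz
    rw [e1, one_mul] at e2
    refine e2.trans ?_
    refine ext_congr ?_ hs
    have hc : Tendsto (fun q : κ ⊕ Fin 1 → ℝ => q (Sum.inr 0)) (𝓝 (stv (Sum.elim p z)))
      (𝓝 (st (z 0))) := (continuous_apply (Sum.inr (0 : Fin 1))).tendsto _
    filter_upwards [hopen z, hc.eventually (hψ1 _ hz0)] with q hq hq1
    have hd : HasFDerivAt (uncurrySum H₀) (fderiv ℝ (uncurrySum H₀) q) q :=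
      ((contDiffAt_uncurrySum (hH₀s _ hq _)).differentiableAt (by simp)).hasFDerivAt
    -- The partial derivative in the last variable is read as a derivative along a line, to be
    -- compared with the derivative of `H`.
    have hl := (hd.hasLineDerivAt (Pi.single (Sum.inr 0) 1))
    have e3 : (fun s : ℝ => uncurrySum H₀ (q + s • Pi.single (Sum.inr 0) 1))
        = fun s => H (q ∘ Sum.inl) (q (Sum.inr 0) + s) - H (q ∘ Sum.inl) a := by
      ext s
      have e4 : (q + s • (Pi.single (Sum.inr 0) 1 : κ ⊕ Fin 1 → ℝ)) ∘ Sum.inl = q ∘ Sum.inl := by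
        ext i; simp
      have e5 : (q + s • (Pi.single (Sum.inr 0) 1 : κ ⊕ Fin 1 → ℝ)) (Sum.inr 0)
          = q (Sum.inr 0) + s := by simp
      show H _ _ - H _ _ = _
      rw [e4, e5]
    unfold HasLineDerivAt at hl
    rw [e3] at hl
    have h6 := (hHd _ hq (q (Sum.inr 0) + 0)).comp_const_add (q (Sum.inr 0)) 0
    have h7 := hl.unique (h6.sub_const _)
    rw [h7]
    show uncurrySum h q = ψ _ * _
    rw [add_zero, hq1, one_mul]
    rfl
  -- With the variable frozen at `a`, the normalised primitive is identically zero as a function of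
  -- the parameters alone.
  · have e1 : Sum.elim p ![(a : FermatReal)] = fun k => ext
        ((Sum.elim (fun i q => q i) fun _ _ => a : κ ⊕ Fin 1 → (κ → ℝ) → ℝ) k) p := by
      ext k
      rcases k with k | k
      · exact (ext_coord k).symm
      · fin_cases k
        exact (ext_const a).symm
    show ext _ (Sum.elim p ![(a : FermatReal)]) = 0
    rw [e1, ext_comp]
    · have : (fun q : κ → ℝ => uncurrySum H₀ fun k =>
          (Sum.elim (fun i q => q i) fun _ _ => a : κ ⊕ Fin 1 → (κ → ℝ) → ℝ) k q)
          = fun _ => 0 := by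
        ext q
        exact sub_self _
      rw [this, ext_const, map_zero]
    · intro k
      rcases k with k | k
      · exact contDiffAt_apply ℝ ℝ _ _
      · exact contDiffAt_const
    · exact contDiffAt_uncurrySum (hH₀s _ hp _)

theorem HasIntegral.unique (hab : a < b) {f : FermatReal → FermatReal} {L L' : FermatReal}
    (h : HasIntegral a b f L) (h' : HasIntegral a b f L') : L' = L := by
  obtain ⟨F, -, hF, hFa, rfl⟩ := h
  obtain ⟨F', -, hF', hFa', rfl⟩ := h'
  have := sub_sub_sub_mem_of_hasPartial hab hF' hF ⊥ fun s _ => by simp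
  rw [hFa, hFa', Ideal.mem_bot, sub_self, sub_zero, sub_eq_zero] at this
  exact this

/-- The primitive is compared with the coordinate `x`, a primitive of `1`. -/
theorem HasIntegral.sub_mem (hab : a < b) {f : FermatReal → FermatReal} {L : FermatReal}
    (h : HasIntegral a b f L) (K : Ideal FermatReal)
    (hK : ∀ s ∈ Set.Ioo a b, f (s : FermatReal) - 1 ∈ K) :
    L - ((b - a : ℝ) : FermatReal) ∈ K := by
  obtain ⟨F, -, hF, hFa, rfl⟩ := h
  have := sub_sub_sub_mem_of_hasPartial hab hF (F' := fun z => z 0) (v' := fun _ => 1)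
    (fun z _ => hasPartial_coord _ z 0) K hK
  rw [hFa] at this
  convert this using 1
  simp
  ring

end FermatReal

namespace FermatReal
open FermatReals

/-! ### Curves that are affine in the first coordinate -/

/-- The frozen Fermat time `t` becomes one more parameter, so a slice of a smooth function is smooth
even at nonstandard times. -/
theorem IsLocalForm.slice {a b : ℝ} {κ : Type} [Fintype κ] {f : (Fin 2 → FermatReal) → FermatReal}
    {p : κ → FermatReal} {g : (κ ⊕ Fin 2 → ℝ) → ℝ} {x t : FermatReal} (ht : 0 ≤ t)
    (h : IsLocalForm (strip a b) f ![x, t] p g) :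
    ∃ g' : ((κ ⊕ Unit) ⊕ Fin 1 → ℝ) → ℝ,
      IsLocalForm (seg a b) (fun z => f ![z 0, t]) ![x] (Sum.elim p fun _ => t) g' := by
  set σ : κ ⊕ Fin 2 → (κ ⊕ Unit) ⊕ Fin 1 :=
    Sum.elim (fun k => Sum.inl (Sum.inl k)) ![Sum.inr 0, Sum.inl (Sum.inr ())] with hσ
  have hx : ∀ z : Fin 1 → FermatReal, Sum.elim p ![z 0, t]
      = fun i => Sum.elim (Sum.elim p fun _ => t) z (σ i) := fun z => by
    ext i
    rcases i with i | i
    · rfl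
    · fin_cases i <;> rfl
  refine ⟨fun q => g fun i => q (σ i), ?_, ?_⟩
  · have hc : Continuous fun (q : (κ ⊕ Unit) ⊕ Fin 1 → ℝ) i => q (σ i) := by fun_prop
    have h1 := h.1
    have h2 := hx ![x]
    rw [Matrix.cons_val_zero] at h2
    rw [h2] at h1
    filter_upwards [(hc.tendsto (stv (Sum.elim (Sum.elim p fun _ => t) ![x]))).eventually h1]
      with q hq
    exact ContDiffAt.comp q hq (contDiffAt_pi.2 fun i => contDiffAt_apply ℝ ℝ _ _)
  · have hc : Tendsto (fun v : Fin 1 → ℝ => (![v 0, st t] : Fin 2 → ℝ)) (𝓝 (stv ![x]))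
        (𝓝 (stv ![x, t])) := by
      have hc : Continuous fun v : Fin 1 → ℝ => (![v 0, st t] : Fin 2 → ℝ) := by
        refine continuous_pi fun i => ?_
        fin_cases i
        · exact continuous_apply 0
        · exact continuous_const
      convert hc.tendsto (stv ![x]) using 2
      ext i
      fin_cases i <;> rfl
    filter_upwards [hc.eventually h.2] with v hv z hz hzv
    rw [hv ![z 0, t] ⟨hz.1, hz.2, ht⟩ (by subst hzv; ext i; fin_cases i <;> rfl), hx]
    rfl

section curve

variable {a b : ℝ} {γ : (Fin 2 → FermatReal) → (Fin 2 → FermatReal)} {α β : FermatReal → FermatReal}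
  {z : Fin 2 → FermatReal}

theorem exists_isLocalForm_velocity (hab : a < b) (hγ : SmoothOn (strip a b) γ)
    (hz : z ∈ strip a b) : ∃ (d : ℕ) (p : Fin d → FermatReal) (g : Fin 2 → (Fin d ⊕ Fin 2 → ℝ) → ℝ),
      ∀ i, IsLocalForm (strip a b) (fun w => velocity a b γ w i) z p (g i) := by
  obtain ⟨d, p, g, h⟩ := hγ.exists_isLocalForm hz
  exact ⟨d, p, _, fun i => (h i).pd fun z hz => uniqueDiffWithinAt_strip hab hz⟩

/-- A displacement in `x` keeps `t` fixed, so `α t` and `β t` act as constants and need no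
smoothness. -/
theorem velocity_zero (hab : a < b) (hγ : SmoothOn (strip a b) γ)
    (hγ₁ : ∀ z ∈ strip a b, γ z 0 = (1 + α (z 1)) * z 0 + β (z 1)) (hz : z ∈ strip a b) :
    velocity a b γ z 0 = 1 + α (z 1) := by
  obtain ⟨d, p, g, h⟩ := hγ.exists_isLocalForm hz
  have hX := uniqueDiffWithinAt_strip hab hz
  have h1 := ((h 0).hasPartial 0)
  have h2 := h1.eq_mul (hasPartial_coord (strip a b) z 0) (1 + α (z 1)) (β (z 1)) hz hX
    fun s hs => by rw [hγ₁ _ hs, shift_zero_apply_one]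
  rw [mul_one] at h2
  rw [← h2]
  exact h1.pd_eq hz hX

theorem exists_isLocalForm_ext_velocity (hab : a < b) (hγ : SmoothOn (strip a b) γ)
    (hz : z ∈ strip a b) (hv : st (velocity a b γ z 0) ≠ 0) {F : (Fin 2 → ℝ) → ℝ}
    (hF : ∀ q, q 0 ≠ 0 → ContDiffAt ℝ ∞ F q) :
    ∃ (d : ℕ) (p : Fin d → FermatReal) (g : (Fin d ⊕ Fin 2 → ℝ) → ℝ),
      IsLocalForm (strip a b) (fun w => ext F (velocity a b γ w)) z p g := by
  obtain ⟨d, p, g, h⟩ := exists_isLocalForm_velocity hab hγ hz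
  refine ⟨d, p, _, IsLocalForm.comp h (F := F) ?_⟩
  have h1 : st (velocity a b γ z 0) = g 0 (stv (Sum.elim p z)) := by
    rw [(h 0).eq hz, st_ext (h 0).contDiffAt]
  have hc := (continuous_apply (0 : Fin 2)).tendsto fun k => g k (stv (Sum.elim p z))
  rw [h1] at hv
  exact (hc.eventually (isOpen_ne.mem_nhds hv)).mono fun q hq => hF q hq

/-! ### Arc length, and the orders of `φ` and `cos φ - 1` -/

theorem st_one_add {x : FermatReal} (hx : x ∈ growth (1 / 2)) : st (1 + x) = 1 := by
  rw [map_add, map_one, st_of_mem_growth (by norm_num) hx, add_zero]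

theorem ext₁_sqrt_eq_ext {v : Fin 2 → FermatReal} (hv : st (v 0) ≠ 0) :
    ext₁ Real.sqrt (v 0 ^ 2 + v 1 ^ 2) = ext (fun q => √(q 0 ^ 2 + q 1 ^ 2)) v := by
  have h1 : v 0 ^ 2 + v 1 ^ 2 = ext (fun q => q 0 * q 0 + q 1 * q 1) v := by
    rw [ext_add (by fun_prop) (by fun_prop), ext_mul (by fun_prop) (by fun_prop),
      ext_mul (by fun_prop) (by fun_prop), ext_coord, ext_coord, sq, sq]
  have h2 : stv v 0 * stv v 0 + stv v 1 * stv v 1 ≠ 0 := by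
    have : stv v 0 ≠ 0 := hv
    have := mul_self_pos.2 this
    have := mul_self_nonneg (stv v 1)
    positivity
  rw [h1, ext₁_ext (by fun_prop) (Real.contDiffAt_sqrt h2)]
  simp only [sq]

theorem sq_ext₁_sqrt {y : FermatReal} (hy : 0 < st y) : ext₁ Real.sqrt y ^ 2 = y := by
  have h := Real.contDiffAt_sqrt (n := ∞) hy.ne'
  rw [sq, ← ext₁_mul h h]
  conv_rhs => rw [← ext₁_id y]
  refine ext₁_congr ?_ (h.mul h)
  filter_upwards [isOpen_Ioi.mem_nhds hy] with s hs
  exact Real.mul_self_sqrt (le_of_lt hs)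

theorem exists_isLength (hab : a < b) (hγ : SmoothOn (strip a b) γ)
    (hv : ∀ z ∈ strip a b, st (velocity a b γ z 0) ≠ 0) {t : FermatReal} (ht : 0 ≤ t) :
    ∃ L, IsLength a b γ t L := by
  refine exists_hasIntegral hab fun z hz => ?_
  have hF : ∀ q : Fin 2 → ℝ, q 0 ≠ 0 → ContDiffAt ℝ ∞ (fun q : Fin 2 → ℝ => √(q 0 ^ 2 + q 1 ^ 2)) q :=
    fun q hq => ContDiffAt.sqrt (by fun_prop) (by positivity)
  obtain ⟨d, p, g, h⟩ := exists_isLocalForm_ext_velocity (z := ![z 0, t]) hab hγ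
    ⟨hz.1, hz.2, ht⟩ (hv _ ⟨hz.1, hz.2, ht⟩) hF
  obtain ⟨g', h'⟩ := h.slice ht
  rw [vec_eq] at h'
  exact ⟨_, inferInstance, _, g', h'.congr fun w hw =>
    ext₁_sqrt_eq_ext (hv _ ⟨hw.1, hw.2, ht⟩)⟩

/-- Multiplying by the unit `√y + 1` leaves `y - 1 = (2 + α) * α + v 1 ^ 2`. Here `v 1` is a
multiple of `tan φ`, hence `O(t ^ (1 / 4))`, and its square is `O(t ^ (1 / 2))`. -/
theorem ext₁_sqrt_sub_one_mem_growth {α φ : FermatReal} {v : Fin 2 → FermatReal}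
    (hα : α ∈ growth (1 / 2)) (hv : v 0 = 1 + α) (hv' : v 1 = v 0 * ext₁ Real.tan φ)
    (hφ : φ ∈ growth (1 / 4)) : ext₁ Real.sqrt (v 0 ^ 2 + v 1 ^ 2) - 1 ∈ growth (1 / 2) := by
  have h1 : ext₁ Real.tan φ ∈ growth (1 / 4) :=
    ext₁_mem_growth (by norm_num) hφ (Real.contDiffAt_tan.2 (by simp)) Real.tan_zero
  have h2 : v 1 ∈ growth (1 / 4) := by rw [hv']; exact Ideal.mul_mem_left _ _ h1
  have h3 : v 1 ^ 2 ∈ growth (1 / 2) := by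
    have := (sq_mem_growth_iff (by norm_num) (by norm_num)).2 h2
    convert this using 2
    norm_num
  have hst : st (v 0 ^ 2 + v 1 ^ 2) = 1 := by
    rw [map_add, st_of_mem_growth (by norm_num) h3, map_pow, hv, st_one_add hα]; norm_num
  set y := v 0 ^ 2 + v 1 ^ 2 with hy
  have h4 := sq_ext₁_sqrt (y := y) (by rw [hst]; exact one_pos)
  have hst' : st (ext₁ Real.sqrt y) = 1 := by
    rw [st_ext₁ (Real.contDiffAt_sqrt (by rw [hst]; exact one_ne_zero)), hst, Real.sqrt_one]
  have h5 : IsUnit (ext₁ Real.sqrt y + 1) := isUnit_of_st_ne_zero (by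
    rw [map_add, hst', map_one]; norm_num)
  have h6 : (ext₁ Real.sqrt y + 1) * (ext₁ Real.sqrt y - 1) ∈ growth (1 / 2) := by
    have e : (ext₁ Real.sqrt y + 1) * (ext₁ Real.sqrt y - 1) = (2 + α) * α + v 1 ^ 2 := by
      have : (ext₁ Real.sqrt y + 1) * (ext₁ Real.sqrt y - 1) = ext₁ Real.sqrt y ^ 2 - 1 := by ring
      rw [this, h4, hy, hv]; ring
    rw [e]
    exact Ideal.add_mem _ (Ideal.mul_mem_left _ _ hα) h3
  exact (Ideal.unit_mul_mem_iff_mem _ h5).1 h6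

/-- Since `cos φ - 1 = -2 sin² (φ / 2)`, the exponent is halved by taking the root of the square,
and `arcsin` recovers `φ` from the sine without loss of order. -/
theorem cos_sub_one_mem_growth_iff {φ : FermatReal}
    (hφ : st φ ∈ Set.Ioo (-(Real.pi / 2)) (Real.pi / 2)) :
    ext₁ Real.cos φ - 1 ∈ growth (1 / 2) ↔ φ ∈ growth (1 / 4) := by
  have hs : ∀ s : ℝ, ContDiffAt ℝ ∞ (fun s => Real.sin (s / 2)) s := fun s =>
    contDiffAt_sin.comp s (by fun_prop)
  set y := ext₁ (fun s => Real.sin (s / 2)) φ with hy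
  have h1 : ext₁ Real.cos φ - 1 = ((-2 : ℝ) : FermatReal) * y ^ 2 := by
    have e1 : Real.cos = fun s => 1 + (-2 : ℝ) * (Real.sin (s / 2) * Real.sin (s / 2)) := by
      ext s
      have := Real.cos_sq' (s / 2)
      have h2 := Real.cos_two_mul (s / 2)
      rw [mul_div_cancel₀ s two_ne_zero] at h2
      rw [h2, this]; ring
    rw [e1, ext₁_add contDiffAt_const (contDiffAt_const.mul ((hs _).mul (hs _))),
      ext₁_mul contDiffAt_const ((hs _).mul (hs _)), ext₁_mul (hs _) (hs _), ext₁_const,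
      ext₁_const, map_one, sq]
    ring
  have hu : IsUnit ((-2 : ℝ) : FermatReal) := isUnit_of_st_ne_zero (by simp)
  have h2 : ext₁ Real.cos φ - 1 ∈ growth (1 / 2) ↔ y ∈ growth (1 / 4) := by
    rw [h1, Ideal.unit_mul_mem_iff_mem _ hu, ← sq_mem_growth_iff (x := y) (by norm_num) (by norm_num),
      show (2 * (1 / 4) : ℝ) = 1 / 2 by norm_num]
  rw [h2]
  constructor
  · intro h
    have hasin : ContDiffAt ℝ ∞ (fun s => 2 * Real.arcsin s) (Real.sin (st φ / 2)) := by
      refine contDiffAt_const.mul (Real.contDiffAt_arcsin ?_ ?_)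
      · have := Real.sin_lt_sin_of_lt_of_le_pi_div_two (x := -(Real.pi / 2)) (y := st φ / 2)
          le_rfl (by linarith [hφ.2, Real.pi_pos]) (by linarith [hφ.1, Real.pi_pos])
        rw [Real.sin_neg, Real.sin_pi_div_two] at this
        exact this.ne'
      · have := Real.sin_lt_sin_of_lt_of_le_pi_div_two (x := st φ / 2) (y := Real.pi / 2)
          (by linarith [hφ.1, Real.pi_pos]) le_rfl (by linarith [hφ.2, Real.pi_pos])
        rw [Real.sin_pi_div_two] at this
        exact this.ne
    have h3 : ext₁ (fun s => 2 * Real.arcsin s) y = φ := by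
      rw [hy, ext₁_ext₁ (hs _) hasin]
      conv_rhs => rw [← ext₁_id φ]
      refine ext₁_congr ?_ (ContDiffAt.comp (g := fun s => 2 * Real.arcsin s) _ hasin (hs _))
      filter_upwards [isOpen_Ioo.mem_nhds hφ] with s hs
      rw [Real.arcsin_sin (by linarith [hs.1, Real.pi_pos]) (by linarith [hs.2, Real.pi_pos])]
      ring
    rw [← h3]
    refine ext₁_mem_growth (by norm_num) h ?_ (by simp)
    exact contDiffAt_const.mul (Real.contDiffAt_arcsin (by norm_num) (by norm_num))
  · intro h
    exact ext₁_mem_growth (by norm_num) h (hs 0) (by simp)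

/-- Newton's law for the infinitesimal displacements `± t ^ r` determines the acceleration up to
infinitesimals of order `2`. -/
theorem sub_sub_mem_growth_of_newton (hab : a < b) {S : (Fin 2 → FermatReal) → FermatReal}
    {v y : FermatReal} (hz : z ∈ strip a b) (hS : HasPartial (strip a b) S 0 z v)
    (h : ∀ δ ∈ D 1, shift z 0 δ ∈ strip a b → δ * y = S (shift z 0 δ) - S z) :
    y - v ∈ growth (1 / 2) := by
  obtain ⟨d, p, g, hg, rfl⟩ := hasPartial_iff.1 hS
  -- The exponents `1 / 2 < r ≤ 1` give displacements in `D 1`, whose squares vanish; that is all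
  -- Newton's law needs to be tested on.
  refine mem_growth_half_of_tpow_mul fun r hr hr1 => ?_
  have hr0 : 0 < r := by
    rw [← NNReal.coe_pos]; linarith
  obtain ⟨ε, hε, hmem⟩ := exists_shift_tpow_mem_strip hab hz hr0
  have hδ : (ε : FermatReal) * tpow r ∈ growth r :=
    coe_mul_mem_growth ε (tpow_mem_growth r.2 le_rfl)
  have h1 := h _ (coe_mul_tpow_mem_D hr hr1 hε) hmem
  have hst : stv (shift z 0 ((ε : FermatReal) * tpow r)) = stv z := by
    rw [stv_shift, st_of_mem_growth (NNReal.coe_pos.2 hr0) hδ]; simp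
  have h2 : S (shift z 0 ((ε : FermatReal) * tpow r))
      = ext g (Sum.elim p (shift z 0 ((ε : FermatReal) * tpow r))) :=
    hg.2.self_of_nhds _ hmem hst
  rw [h2, hg.eq hz, ← shift_elim, ext_shift_of_mem_growth hg.contDiffAt _ hr hδ] at h1
  have hu : IsUnit (ε : FermatReal) := isUnit_of_st_ne_zero (by simpa using hε)
  refine hu.mul_left_cancel ?_
  rw [mul_zero]
  linear_combination h1

theorem mem_growth_iff_of_sub_mem {K : Ideal FermatReal} {x y : FermatReal} (h : x - y ∈ K) :
    x ∈ K ↔ y ∈ K :=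
  ⟨fun hx => by simpa using Ideal.sub_mem _ hx h, fun hy => by simpa using Ideal.add_mem _ h hy⟩

end curve

end FermatReal

namespace FermatReal
open FermatReals

/-- The second derivatives of a curve with tangent `(cos φ, sin φ)` and first velocity component
`1 + α`, `α ∈ I₂`, agree with the derivatives of the tangent vector if and only if `φ ∈ I₄`. -/
theorem mul_cos_sub_mem_growth_iff {α φ φ' d : FermatReal} (hα : α ∈ growth (1 / 2))
    (hφ : st φ ∈ Set.Ioo (-(Real.pi / 2)) (Real.pi / 2)) (hφ' : IsUnit φ')
    (hd : ext₁ Real.cos φ ^ 2 * d = 1) :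
    ext₁ Real.cos φ * φ' - (1 + α) * (d * φ') ∈ growth (1 / 2) ↔ φ ∈ growth (1 / 4) := by
  have hc := cos_pos_of_mem hφ
  have hst : st (ext₁ Real.cos φ) = Real.cos (st φ) := st_ext₁ contDiffAt_cos
  rw [← cos_sub_one_mem_growth_iff hφ]
  set c := ext₁ Real.cos φ with hcd
  have hcu : IsUnit (c ^ 2) := isUnit_of_st_ne_zero (by rw [map_pow, hst]; positivity)
  have hqu : IsUnit (c ^ 2 + c + 1) := isUnit_of_st_ne_zero (by
    rw [map_add, map_add, map_pow, hst, map_one]; positivity)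
  have e1 : c * φ' - (1 + α) * (d * φ') = φ' * (c - (1 + α) * d) := by ring
  -- Multiplication by `c ^ 2` replaces `c - (1 + α) * d` by `c ^ 3 - 1 - α`, and `c ^ 3 - 1 = (c ^
  -- 2 + c + 1) * (c - 1)` with a unit as first factor.
  rw [e1, Ideal.unit_mul_mem_iff_mem _ hφ', ← Ideal.unit_mul_mem_iff_mem _ hcu,
    ← Ideal.unit_mul_mem_iff_mem (x := c - 1) _ hqu]
  refine mem_growth_iff_of_sub_mem ?_
  have e2 : c ^ 2 * (c - (1 + α) * d) - (c ^ 2 + c + 1) * (c - 1) = (-1) * α := by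
    linear_combination (-1 - α) * hd
  rw [e2]
  exact Ideal.mul_mem_left _ _ hα

end FermatReal

/-! ### The wave equation and the length of the string -/

theorem mainTheorem11 (a b : ℝ) (hab : a < b)
    (γ G Tn : (Fin 2 → FermatReal) → (Fin 2 → FermatReal))
    (ρ : (Fin 2 → FermatReal) → FermatReal) (T : FermatReal)
    (hγ : SmoothOn (strip a b) γ) (hG : SmoothOn (strip a b) G) (hTn : SmoothOn (strip a b) Tn)
    (hρ : SmoothOn (strip a b) (fun z (_ : Fin 1) => ρ z)) (hT : IsUnit T)
    (α β : FermatReal → FermatReal)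
    (hα : ∀ t, 0 ≤ t → α t ∈ I 2)
    (hγ₁ : ∀ z ∈ strip a b, γ z 0 = (1 + α (z 1)) * z 0 + β (z 1)) :
    -- the unit tangent vector exists at every point
    (∀ z ∈ strip a b, ∃! τ, IsUnitTangent a b γ z τ) ∧
    ∀ τ : (Fin 2 → FermatReal) → (Fin 2 → FermatReal),
      (∀ z ∈ strip a b, IsUnitTangent a b γ z (τ z)) →
      -- hence so does its angle with the axis
      (∀ z ∈ strip a b, ∃! φ, IsAngle (τ z) φ) ∧
      ∀ φ : (Fin 2 → FermatReal) → FermatReal,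
        (∀ z ∈ strip a b, IsAngle (τ z) (φ z)) →
        -- the tension
        (∀ z ∈ openStrip a b, ∀ i, EqUpTo 2 (Tn z i) (T * τ z i)) →
        -- Newton's law
        (∀ z ∈ openStrip a b, ∀ δ ∈ D 1, ![z 0 + δ, z 1] ∈ strip a b → ∀ i,
          ρ z * δ * pd (strip a b) (pd (strip a b) (fun w => γ w i) 1) 1 z
            = Tn ![z 0 + δ, z 1] i - Tn z i + G z i * ρ z * δ) →
        (∀ z ∈ openStrip a b, IsUnit (pd (strip a b) φ 0 z) →
          (EqUpTo 2 (ρ z * pd (strip a b) (pd (strip a b) (fun w => γ w 1) 1) 1 z)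
              (T * pd (strip a b) (pd (strip a b) (fun w => γ w 1) 0) 0 z + G z 1 * ρ z)
            ↔ φ z ∈ I 4)) ∧
        ((∀ z ∈ openStrip a b, φ z ∈ I 4) →
          ∀ t, 0 ≤ t → ∃ L, IsLength a b γ t L ∧ (∀ L', IsLength a b γ t L' → L' = L) ∧
            EqUpTo 2 L (((b - a : ℝ) : FermatReal))) := by
  have hα' : ∀ z ∈ strip a b, α (z 1) ∈ growth (1 / 2) := fun z hz =>
    (mem_I_iff (by norm_num)).1 (hα _ hz.2.2)
  have hv0 : ∀ z ∈ strip a b, velocity a b γ z 0 = 1 + α (z 1) := fun z hz =>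
    velocity_zero hab hγ hγ₁ hz
  have hst : ∀ z ∈ strip a b, st (velocity a b γ z 0) = 1 := fun z hz => by
    rw [hv0 z hz, st_one_add (hα' z hz)]
  have hpos : ∀ z ∈ strip a b, 0 < st (velocity a b γ z 0) := fun z hz => by
    rw [hst z hz]; exact one_pos
  refine ⟨fun z hz => ⟨_, isDirection_cos_sin (hpos z hz), fun σ hσ =>
    IsDirection.unique hσ (isDirection_cos_sin (hpos z hz))⟩, fun τ hτ => ⟨fun z hz =>
    IsDirection.existsUnique_angle (hτ z hz) (hpos z hz), fun φ hφ hTτ hNewton => ?_⟩⟩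
  have hspec : ∀ z ∈ strip a b, st (φ z) ∈ Set.Ioo (-(Real.pi / 2)) (Real.pi / 2) ∧
      velocity a b γ z 1 = velocity a b γ z 0 * ext₁ Real.tan (φ z) := fun z hz =>
    IsDirection.angle_spec (hτ z hz) (hpos z hz) (hφ z hz)
  -- The angle is a smooth function of the velocity, which is what makes `φ` differentiable.
  have hφa : ∀ z ∈ strip a b, φ z = angle (velocity a b γ z) := fun z hz =>
    eq_angle (hpos z hz).ne' (hspec z hz).1 (hspec z hz).2
  refine ⟨fun z hz hunit => ?_, fun hI t ht => ?_⟩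
  · have hzs := openStrip_subset_strip hz
    have hX := uniqueDiffWithinAt_strip hab hzs
    have hY := uniqueDiffWithinAt_openStrip hab hz
    have hcos := cos_pos_of_mem (hspec z hzs).1
    -- the derivative of the angle
    obtain ⟨d, p, g, hg⟩ := exists_isLocalForm_ext_velocity hab hγ hzs (hpos z hzs).ne'
      (fun q hq => contDiffAt_arctan_div hq)
    have hφx := (hg.congr (f' := φ) hφa).hasPartial 0
    rw [← hφx.pd_eq hzs hX] at hφx
    set φx := pd (strip a b) φ 0 z
    have htan := hφx.ext₁ hzs (h := Real.tan) (by
      filter_upwards [Real.continuous_cos.continuousAt.eventually (isOpen_ne.mem_nhds hcos.ne')]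
        with s hs
      exact Real.contDiffAt_tan.2 hs)
    have hsin := hφx.ext₁ hzs (h := Real.sin) (Eventually.of_forall fun s => contDiffAt_sin)
    rw [Real.deriv_sin] at hsin
    -- the second derivative of the curve
    obtain ⟨d₁, p₁, g₁, hg₁⟩ := exists_isLocalForm_velocity hab hγ hzs
    have hv1 := (hg₁ 1).hasPartial 0
    rw [← hv1.pd_eq hzs hX] at hv1
    -- Differentiating `∂γ₂/∂x = (1 + α) tan φ` in `x`, with `1 + α` constant along the
    -- displacement.
    have hxx := hv1.eq_mul htan (1 + α (z 1)) 0 hzs hX fun s hs => by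
      rw [(hspec _ hs).2, hv0 _ hs, shift_zero_apply_one, add_zero]
    -- the derivative of the tension
    obtain ⟨d₂, p₂, g₂, hg₂⟩ := hTn.exists_isLocalForm hzs
    have hTx := (hg₂ 1).hasPartial 0
    have hTτx := hTx.sub_mul_mem hsin (growth (1 / 2)) T 0 openStrip_subset_strip hz hY
      fun s hs => by
        have := (eqUpTo_iff (by norm_num)).1 (hTτ _ hs 1)
        rw [(hφ _ (openStrip_subset_strip hs)).2.2.2] at this
        rwa [sub_zero]
    have hN := sub_sub_mem_growth_of_newton hab hzs hTx
      (y := ρ z * pd (strip a b) (pd (strip a b) (fun w => γ w 1) 1) 1 z - G z 1 * ρ z)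
      fun δ hδ hmem => by
        rw [shift_eq_vec] at hmem ⊢
        linear_combination hNewton z hz δ hδ hmem 1
    rw [eqUpTo_iff (by norm_num), mem_I_iff (by norm_num),
      ← mul_cos_sub_mem_growth_iff (hα' z hzs) (hspec z hzs).1 hunit
        (ext₁_cos_sq_mul_deriv_tan hcos.ne'), ← Ideal.unit_mul_mem_iff_mem (x :=
        ext₁ Real.cos (φ z) * φx - (1 + α (z 1)) * (ext₁ (deriv Real.tan) (φ z) * φx)) _ hT]
    -- The two expressions differ by the sum of `hN` and `hTτx`, that is, of `ρ ∂²γ₂/∂t² - G₂ ρ ≡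
    -- ∂𝐓₂/∂x` and `∂𝐓₂/∂x ≡ T cos φ · φ_x`.
    refine mem_growth_iff_of_sub_mem ?_
    have hxx' : pd (strip a b) (pd (strip a b) (fun w => γ w 1) 0) 0 z = _ := hxx
    rw [hxx']
    convert Ideal.add_mem _ hN hTτx using 1
    ring
  · obtain ⟨L, hL⟩ := exists_isLength hab hγ (fun z hz => (hpos z hz).ne') ht
    refine ⟨L, hL, fun L' hL' => HasIntegral.unique hab hL hL', ?_⟩
    rw [eqUpTo_iff (by norm_num)]
    -- The speed has to be compared with `1` only at standard interior points, all of which lie in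
    -- the open strip.
    refine HasIntegral.sub_mem hab hL _ fun s hs => ?_
    have hz : ![(s : FermatReal), t] ∈ openStrip a b :=
      ⟨lt_of_st_lt (by simpa using hs.1), lt_of_st_lt (by simpa using hs.2), ht⟩
    have hzs := openStrip_subset_strip hz
    exact ext₁_sqrt_sub_one_mem_growth (hα' _ hzs) (hv0 _ hzs) (hspec _ hzs).2
      ((mem_I_iff (by norm_num)).1 (hI _ hz))
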